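/- **Setting.** Let $P=\{x_1,\dots,x_n\}$ be a set of $n$ distinct points in $\mathbb R^d$. For a non-empty $S\subseteq P$ put $\mu(S)=\frac1{|S|}\sum_{x\in S}x$ and $$\sigma(S)=\max_{|v|=1}\Big(\frac1{|S|}\sum_{x\in S}\big(v\cdot(x-\mu(S))\big)^2\Big)^{1/2};$$ for a line $L$ through the origin, $\pi_L$ is the orthogonal projection onto $L$ and $\sigma(\pi_L(S))$ is the same quantity for the projected points, counted with multiplicity. For $K>0$ and $w_0>0$, consider the following conditions on a partition $C_1,\dots,C_k$ of $P$: 1. (minimum cluster weight) $|C_\ell|\ge w_0n$ for all $\ell$, and $n\ge 100/w_0^5$; 2. (well-separatedness) $|\mu(C_\ell)-\mu(C_{\ell'})|\ge \frac{K}{w_0^{11}}\max_r\sigma(C_r)$ for all $\ell\ne\ell'$; 3. (NTSC) for every $\ell$, every $T\subseteq C_\ell$ with $|T|\ge\frac{\sqrt n\,\ln n}{100}$ and every line $L$ through the origin, $\sigma^2(\pi_L(T))\ge\frac{|T|^2}{125\,|C_\ell|^2}\,\sigma^2(\pi_L(C_\ell))$. **Theorem.** There are an absolute constant $K>0$ and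 an algorithm (a uniform real-RAM program using only field operations and comparisons of reals, at unit cost, and counters) that takes as input only $n$, $d$ and the points $x_1,\dots,x_n$, halts on every input after a number of steps that is polynomial in $n+d$, and has the following property. Whenever the points are distinct and $C_1,\dots,C_k$ is a partition of $P$ that satisfies conditions 1–3 with this $K$ for some $w_0>0$, the algorithm, which is given neither $k$ nor $w_0$, outputs $k$ together with a partition of $P$ into sets $X_1,\dots,X_k$ such that, after a relabeling, $|X_\ell\,\triangle\,C_\ell|\le \frac{w_0^2n}{10}$ for every $\ell$. -/

import Mathlib

namespace RealRAM

/-! A uniform real random access machine.  A program is a finite piece of code; its memory consists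
of arrays of natural numbers (used as counters, addresses and labels) and two-dimensional arrays of
real numbers.  Natural numbers are only added, subtracted and compared; real numbers are combined
by the four field operations and compared.  There is no rounding, no root and no other
transcendental or oracle operation. -/

/-- The memory: `nat a i` is entry `i` of the `a`-th array of natural numbers, and `real a i j` is
entry `(i, j)` of the `a`-th array of real numbers. -/
structure State where
  nat : ℕ → ℕ → ℕ
  real : ℕ → ℕ → ℕ → ℝ

/-- Expressions with a natural number as value. -/
inductive NExp where
  | const (m : ℕ)
  | read (a : ℕ) (i : NExp)
  | add (e f : NExp)
  | sub (e f : NExp)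

/-- The value of an expression; subtraction is cut off at `0`. -/
def NExp.eval (s : State) : NExp → ℕ
  | const m => m
  | read a i => s.nat a (i.eval s)
  | add e f => e.eval s + f.eval s
  | sub e f => e.eval s - f.eval s

/-- Expressions with a real number as value. -/
inductive RExp where
  | ofNat (e : NExp)
  | read (a : ℕ) (i j : NExp)
  | add (e f : RExp)
  | sub (e f : RExp)
  | mul (e f : RExp)
  | div (e f : RExp)

/-- The value of an expression; division by `0` returns `0`. -/
noncomputable def RExp.eval (s : State) : RExp → ℝ
  | ofNat e => (e.eval s : ℝ)
  | read a i j => s.real a (i.eval s) (j.eval s)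
  | add e f => e.eval s + f.eval s
  | sub e f => e.eval s - f.eval s
  | mul e f => e.eval s * f.eval s
  | div e f => e.eval s / f.eval s

/-- Tests. -/
inductive BExp where
  | natLe (e f : NExp)
  | realLe (e f : RExp)
  | neg (b : BExp)
  | and (b c : BExp)

/-- The truth of a test in a state. -/
def BExp.Holds (s : State) : BExp → Prop
  | natLe e f => e.eval s ≤ f.eval s
  | realLe e f => e.eval s ≤ f.eval s
  | neg b => ¬ b.Holds s
  | and b c => b.Holds s ∧ c.Holds s

/-- Programs: two kinds of assignment, composition, branching and the `while` loop. -/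
inductive Prog where
  | setNat (a : ℕ) (i e : NExp)
  | setReal (a : ℕ) (i j : NExp) (e : RExp)
  | seq (p q : Prog)
  | branch (b : BExp) (p q : Prog)
  | loop (b : BExp) (p : Prog)

/-- Overwrite one entry of an array of natural numbers. -/
def State.setNat (s : State) (a i m : ℕ) : State :=
  { s with nat := fun a' i' => if a' = a ∧ i' = i then m else s.nat a' i' }

/-- Overwrite one entry of an array of real numbers. -/
def State.setReal (s : State) (a i j : ℕ) (r : ℝ) : State :=
  { s with real := fun a' i' j' => if a' = a ∧ i' = i ∧ j' = j then r else s.real a' i' j' }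

/-- `p.Runs s s' t`: started in `s`, the program `p` halts in `s'` after `t` steps.  Each executed
assignment and each executed test is one step; as an expression is loop-free and its size is fixed
by the program, this is the number of executed operations up to a factor that depends on the
program only. -/
inductive Prog.Runs : Prog → State → State → ℕ → Prop
  | setNat (a : ℕ) (i e : NExp) (s : State) :
      Runs (.setNat a i e) s (s.setNat a (i.eval s) (e.eval s)) 1
  | setReal (a : ℕ) (i j : NExp) (e : RExp) (s : State) :
      Runs (.setReal a i j e) s (s.setReal a (i.eval s) (j.eval s) (e.eval s)) 1
  | seq {p q : Prog} {s s₁ s₂ : State} {t₁ t₂ : ℕ} :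
      Runs p s s₁ t₁ → Runs q s₁ s₂ t₂ → Runs (.seq p q) s s₂ (t₁ + t₂)
  | branchTrue {b : BExp} {p q : Prog} {s s' : State} {t : ℕ} :
      b.Holds s → Runs p s s' t → Runs (.branch b p q) s s' (t + 1)
  | branchFalse {b : BExp} {p q : Prog} {s s' : State} {t : ℕ} :
      ¬ b.Holds s → Runs q s s' t → Runs (.branch b p q) s s' (t + 1)
  | loopStop {b : BExp} {p : Prog} {s : State} :
      ¬ b.Holds s → Runs (.loop b p) s s 1
  | loopStep {b : BExp} {p : Prog} {s s₁ s₂ : State} {t₁ t₂ : ℕ} :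
      b.Holds s → Runs p s s₁ t₁ → Runs (.loop b p) s₁ s₂ t₂ →
        Runs (.loop b p) s s₂ (t₁ + t₂ + 1)

/-- The initial memory for `n` points in `ℝ^d`: the numbers `n` and `d` are entry `0` of the arrays
`0` and `1` of natural numbers, the coordinates of the points are the entries of the real array
`0`, and all other entries are `0`. -/
noncomputable def State.input {n d : ℕ} (x : Fin n → EuclideanSpace ℝ (Fin d)) : State where
  nat a i := if i = 0 then (if a = 0 then n else if a = 1 then d else 0) else 0
  real a i j :=
    if h : a = 0 ∧ i < n ∧ j < d then x ⟨i, h.2.1⟩ ⟨j, h.2.2⟩ else 0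

end RealRAM

namespace Clustering

variable {n d k : ℕ}

/-- The mean of the points with index in `S`. -/
noncomputable def mean (x : Fin n → EuclideanSpace ℝ (Fin d)) (S : Finset (Fin n)) :
    EuclideanSpace ℝ (Fin d) :=
  (S.card : ℝ)⁻¹ • ∑ i ∈ S, x i

/-- The maximum directional standard deviation of the points with index in `S`. -/
noncomputable def sigma (x : Fin n → EuclideanSpace ℝ (Fin d)) (S : Finset (Fin n)) : ℝ :=
  ⨆ v : Metric.sphere (0 : EuclideanSpace ℝ (Fin d)) 1,
    Real.sqrt ((∑ i ∈ S, (inner ℝ (v : EuclideanSpace ℝ (Fin d)) (x i - mean x S)) ^ 2) / S.card)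

/-- The sets `C 0, …, C (k - 1)` partition the indices of the points. -/
def IsPartition (C : Fin k → Finset (Fin n)) : Prop :=
  ∀ i, ∃! l, i ∈ C l

/-- The minimum cluster weight condition. -/
def MinWeight (w₀ : ℝ) (C : Fin k → Finset (Fin n)) : Prop :=
  0 < w₀ ∧ (∀ l, w₀ * n ≤ (C l).card) ∧ 100 / w₀ ^ 5 ≤ (n : ℝ)

/-- Well-separatedness (strong separation) with constant `K`. -/
def WellSeparated (K w₀ : ℝ) (x : Fin n → EuclideanSpace ℝ (Fin d))
    (C : Fin k → Finset (Fin n)) : Prop :=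
  ∀ l l', l ≠ l' → K / w₀ ^ 11 * (⨆ r, sigma x (C r)) ≤ ‖mean x (C l) - mean x (C l')‖

/-- The no tight sub-cluster condition, on all orthogonal projections to lines. -/
def NTSC (x : Fin n → EuclideanSpace ℝ (Fin d)) (C : Fin k → Finset (Fin n)) : Prop :=
  ∀ l, ∀ T ⊆ C l, Real.sqrt n * Real.log n / 100 ≤ (T.card : ℝ) →
    ∀ L : Submodule ℝ (EuclideanSpace ℝ (Fin d)), Module.finrank ℝ L = 1 →
      (T.card : ℝ) ^ 2 / (125 * ((C l).card : ℝ) ^ 2) *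
          sigma (fun i => L.starProjection (x i)) (C l) ^ 2
        ≤ sigma (fun i => L.starProjection (x i)) T ^ 2

/-- The output labels `lab` describe a clustering into `k` clusters that, up to a renaming of the
labels, differs from each cluster of `C` in at most `w₀ ^ 2 * n / 10` points. -/
def ApproxClustering (w₀ : ℝ) (C : Fin k → Finset (Fin n)) (lab : Fin n → ℕ) : Prop :=
  (∀ i, lab i < k) ∧ ∃ e : Equiv.Perm (Fin k), ∀ l,
    ((symmDiff (Finset.univ.filter fun i => lab i = (e l : ℕ)) (C l)).card : ℝ)
      ≤ w₀ ^ 2 * n / 10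

end Clustering

/-! ### Programs with bounded loops and their compilation. -/

namespace RealRAM

/-! The algorithm tries many guesses of a minimum cluster size `m` and a squared scale `s`. Each
guess yields a positive semidefinite form `‖Φ ·‖²` on the space, a radius `r`, and greedy seeds:
points with at least `m` points within `r`, pairwise farther apart than `200 u⁴ r`, where `u = n /
m`. The guess with the most seeds wins, ties go to the smaller `m`, and each point joins its nearest
seed.

Too many seeds are impossible, whatever the form and the radius, as long as `m` is at least `n ^ (4
/ 5)`. The balls of the seeds are disjoint, so there are at most `u` of them. If there are at least
`k` seeds, pigeonhole puts at least `n / u²` points of one cluster into each ball. By NTSC, so large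
a part of a cluster cannot be much tighter than the cluster in any direction, so in the direction
joining two seeds the whole cluster is concentrated near its seed (`NTSC.concentrated`). Hence two
seeds never share a cluster, which gives at most `k` seeds (`IsSeparated.card_le`). If there are
exactly `k`, Chebyshev's inequality in the same directions shows that few points are nearer to a
wrong seed, and the error is as claimed once `m ≤ w₀ n` (`IsSeparated.approxClustering`).

Some guess gives at least `k` seeds (`SeedsFor.le_card`). For `m` about `w₀ n / 2` (`exists_size`)
and `s` within a factor `2` of the largest cluster variance (`exists_scaleGuess`), the form nearly
ignores the eigenvectors of the scatter matrix with small eigenvalues. Only about `2k` directions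
survive, so most points of each cluster are near its mean (`sum_norm_weightedMap_le`), while the
distances of the means are almost preserved (`norm_weightedMap_sub_mean`). Each mean is then near a
seed, and different means have different seeds.

So the maximal number of seeds is `k`, and the tie rule forces `m ≤ w₀ n` for the winner. Its scale
may be far from the true one: the upper bound and the error bound do not use it.

An exact spectral projection is not available with field operations. It is replaced by the rational
function `β ^ (2d) / (1 + β ^ (2d))` of the scatter matrix. The inverse is built from rank one
updates (`Matrix.shermanMorrison_symm`), whose denominators are at least `1`, so that no pivoting
occurs. Since all loops are `for` loops over `n` or `d`, the running time is polynomial by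
`Code.runs_compile`. -/

/-- Structured programs in which every loop is a `for` loop whose number of passes is one of two
dimensions, stored in entry `0` of the arrays `0` and `2` of natural numbers. -/
inductive Code where
  | setNat (a : ℕ) (i e : NExp)
  | setReal (a : ℕ) (i j : NExp) (e : RExp)
  | seq (p q : Code)
  | branch (b : BExp) (p q : Code)
  | forTo (dim : Bool) (c : ℕ) (p : Code)

/-- The array that holds a dimension. -/
def dimArray (dim : Bool) : ℕ := if dim then 2 else 0

/-- Entry `0` of an array of natural numbers. -/
abbrev NExp.var (a : ℕ) : NExp := .read a (.const 0)

namespace Code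

/-- The program for a structured program. -/
def compile : Code → Prog
  | setNat a i e => .setNat a i e
  | setReal a i j e => .setReal a i j e
  | seq p q => .seq p.compile q.compile
  | branch b p q => .branch b p.compile q.compile
  | forTo dim c p =>
      .seq (.setNat c (.const 0) (.const 0))
        (.loop (.natLe (.add (.var c) (.const 1)) (.var (dimArray dim)))
          (.seq p.compile (.setNat c (.const 0) (.add (.var c) (.const 1)))))

open Classical in
/-- The state transformation of a structured program. -/
noncomputable def den (N : Bool → ℕ) : Code → State → State
  | setNat a i e => fun s => s.setNat a (i.eval s) (e.eval s)
  | setReal a i j e => fun s => s.setReal a (i.eval s) (j.eval s) (e.eval s)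
  | seq p q => fun s => q.den N (p.den N s)
  | branch b p q => fun s => if b.Holds s then p.den N s else q.den N s
  | forTo dim c p => fun s =>
      (fun s' => (p.den N s').setNat c 0 ((p.den N s').nat c 0 + 1))^[N dim] (s.setNat c 0 0)

/-- Whether the program may write to an array of natural numbers. -/
def writesNat : Code → ℕ → Bool
  | setNat a _ _, b => a == b
  | setReal _ _ _ _, _ => false
  | seq p q, b => p.writesNat b || q.writesNat b
  | branch _ p q, b => p.writesNat b || q.writesNat b
  | forTo _ c p, b => c == b || p.writesNat b

/-- Whether the program may write to an array of real numbers. -/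
def writesReal : Code → ℕ → Bool
  | setNat _ _ _, _ => false
  | setReal a _ _ _, b => a == b
  | seq p q, b => p.writesReal b || q.writesReal b
  | branch _ p q, b => p.writesReal b || q.writesReal b
  | forTo _ _ p, b => p.writesReal b

/-- No loop body writes to its own counter. -/
def wellFormed : Code → Bool
  | setNat _ _ _ => true
  | setReal _ _ _ _ => true
  | seq p q => p.wellFormed && q.wellFormed
  | branch _ p q => p.wellFormed && q.wellFormed
  | forTo _ c p => !p.writesNat c && p.wellFormed

/-- A bound for the number of steps, as a polynomial in a bound for the dimensions. -/
noncomputable def cost : Code → Polynomial ℕ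
  | setNat _ _ _ => 1
  | setReal _ _ _ _ => 1
  | seq p q => p.cost + q.cost
  | branch _ p q => p.cost + q.cost + 1
  | forTo _ _ p => 1 + Polynomial.X * (p.cost + 2) + 1

variable {N : Bool → ℕ}

/-- Since `writesNat` is computable, the side condition is closed by `rfl` for each concrete
program; later proofs transport the values of unchanged arrays in this way. -/
theorem den_nat_frame (c : Code) (s : State) (a : ℕ) (h : c.writesNat a = false) :
    (c.den N s).nat a = s.nat a := by
  induction c generalizing s with
  | setNat b i e =>
    have : a ≠ b := by rintro rfl; simp [writesNat] at h
    funext j; simp [den, State.setNat, this]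
  | setReal b i j e => rfl
  | seq p q hp hq =>
    simp only [writesNat, Bool.or_eq_false_iff] at h
    simp only [den]; rw [hq _ h.2, hp _ h.1]
  | branch b p q hp hq =>
    simp only [writesNat, Bool.or_eq_false_iff] at h
    simp only [den]; split_ifs
    · exact hp _ h.1
    · exact hq _ h.2
  | forTo dim c p hp =>
    simp only [writesNat, Bool.or_eq_false_iff, beq_eq_false_iff_ne] at h
    have hset : ∀ (s : State) (m : ℕ), (s.setNat c 0 m).nat a = s.nat a := by
      intro s m; funext j; simp [State.setNat, h.1.symm]
    simp only [den]
    generalize N dim = m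
    induction m with
    | zero => exact hset _ _
    | succ m ih => rw [Function.iterate_succ_apply', hset, hp _ h.2, ih]

theorem den_real_frame (c : Code) (s : State) (a : ℕ) (h : c.writesReal a = false) :
    (c.den N s).real a = s.real a := by
  induction c generalizing s with
  | setNat b i e => rfl
  | setReal b i j e =>
    have : a ≠ b := by rintro rfl; simp [writesReal] at h
    funext j; simp [den, State.setReal, this]
  | seq p q hp hq =>
    simp only [writesReal, Bool.or_eq_false_iff] at h
    simp only [den]; rw [hq _ h.2, hp _ h.1]
  | branch b p q hp hq =>
    simp only [writesReal, Bool.or_eq_false_iff] at h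
    simp only [den]; split_ifs
    · exact hp _ h.1
    · exact hq _ h.2
  | forTo dim c p hp =>
    simp only [writesReal] at h
    simp only [den]
    generalize N dim = m
    induction m with
    | zero => rfl
    | succ m ih => rw [Function.iterate_succ_apply']; exact (hp _ h).trans ih

/-- `s'` agrees with `s` on all arrays that `c` does not write to. -/
def Frame (c : Code) (s s' : State) : Prop :=
  (∀ a, c.writesNat a = false → s'.nat a = s.nat a) ∧
    ∀ a, c.writesReal a = false → s'.real a = s.real a

theorem frame_den (c : Code) (s : State) : c.Frame s (c.den N s) :=
  ⟨fun a h => den_nat_frame c s a h, fun a h => den_real_frame c s a h⟩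

/-- The invariant rule for `for` loops. -/
theorem forTo_induction {dim : Bool} {c : ℕ} {p : Code} (hw : p.writesNat c = false) (s : State)
    (I : ℕ → State → Prop) (h0 : I 0 (s.setNat c 0 0))
    (hs : ∀ i < N dim, ∀ s', (forTo dim c p).Frame s s' → s'.nat c 0 = i → I i s' →
      I (i + 1) ((p.den N s').setNat c 0 (i + 1))) :
    I (N dim) ((forTo dim c p).den N s) := by
  simp only [den]
  have key : ∀ m ≤ N dim, ∀ s'', s'' = (fun s' => (p.den N s').setNat c 0
      ((p.den N s').nat c 0 + 1))^[m] (s.setNat c 0 0) →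
      (forTo dim c p).Frame s s'' ∧ s''.nat c 0 = m ∧ I m s'' := by
    intro m
    induction m with
    | zero =>
      rintro - s'' rfl
      refine ⟨⟨fun a h => ?_, fun a h => rfl⟩, by simp [State.setNat], h0⟩
      simp only [writesNat, Bool.or_eq_false_iff, beq_eq_false_iff_ne] at h
      funext j; simp [State.setNat, h.1.symm]
    | succ m ih =>
      rintro hm s'' rfl
      obtain ⟨hf, hc, hI⟩ := ih (by omega) _ rfl
      rw [Function.iterate_succ_apply']
      generalize (fun s' => (p.den N s').setNat c 0
        ((p.den N s').nat c 0 + 1))^[m] (s.setNat c 0 0) = s₁ at *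
      have hn : (p.den N s₁).nat c 0 = m := by rw [den_nat_frame p _ _ hw, hc]
      refine ⟨⟨fun a h => ?_, fun a h => ?_⟩, ?_, ?_⟩
      · rw [← hf.1 a h]
        simp only [writesNat, Bool.or_eq_false_iff, beq_eq_false_iff_ne] at h
        rw [← den_nat_frame (N := N) p s₁ a h.2]
        funext j; simp [State.setNat, h.1.symm]
      · rw [← hf.2 a h]
        exact den_real_frame p s₁ a h
      · simp [State.setNat, hn]
      · simp only [hn]
        exact hs m (by omega) s₁ hf hc hI
  exact (key _ le_rfl _ rfl).2.2

/-- A well-formed structured program that keeps the dimensions runs in polynomial time and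
computes its state transformation. -/
theorem runs_compile (c : Code) (hc : c.wellFormed = true) (h0 : c.writesNat 0 = false)
    (h2 : c.writesNat 2 = false) {L : ℕ} (hL : ∀ b, N b ≤ L) (s : State)
    (hs : ∀ b, s.nat (dimArray b) 0 = N b) :
    ∃ t, c.compile.Runs s (c.den N s) t ∧ t ≤ c.cost.eval L := by
  have hdim : ∀ (p : Code) (s : State), p.writesNat 0 = false → p.writesNat 2 = false →
      (∀ b, s.nat (dimArray b) 0 = N b) → ∀ b, (p.den N s).nat (dimArray b) 0 = N b := by
    intro p s h0 h2 hs b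
    rw [den_nat_frame, hs]
    cases b <;> assumption
  induction c generalizing s with
  | setNat a i e => exact ⟨1, .setNat a i e s, by simp [cost]⟩
  | setReal a i j e => exact ⟨1, .setReal a i j e s, by simp [cost]⟩
  | seq p q hp hq =>
    simp only [writesNat, Bool.or_eq_false_iff, wellFormed, Bool.and_eq_true] at h0 h2 hc
    obtain ⟨t₁, r₁, b₁⟩ := hp hc.1 h0.1 h2.1 s hs
    obtain ⟨t₂, r₂, b₂⟩ := hq hc.2 h0.2 h2.2 _ (hdim p s h0.1 h2.1 hs)
    exact ⟨_, .seq r₁ r₂, by simpa [cost] using add_le_add b₁ b₂⟩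
  | branch b p q hp hq =>
    simp only [writesNat, Bool.or_eq_false_iff, wellFormed, Bool.and_eq_true] at h0 h2 hc
    by_cases hb : b.Holds s
    · obtain ⟨t, r, ht⟩ := hp hc.1 h0.1 h2.1 s hs
      refine ⟨t + 1, ?_, by simp only [cost, Polynomial.eval_add, Polynomial.eval_one]; omega⟩
      simp only [den, if_pos hb]
      exact .branchTrue hb r
    · obtain ⟨t, r, ht⟩ := hq hc.2 h0.2 h2.2 s hs
      refine ⟨t + 1, ?_, by simp only [cost, Polynomial.eval_add, Polynomial.eval_one]; omega⟩
      simp only [den, if_neg hb]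
      exact .branchFalse hb r
  | forTo dim c p hp =>
    simp only [writesNat, Bool.or_eq_false_iff, wellFormed, Bool.and_eq_true,
      beq_eq_false_iff_ne, Bool.not_eq_true'] at h0 h2 hc
    have hset : ∀ (s : State) (m : ℕ), (∀ b, s.nat (dimArray b) 0 = N b) →
        ∀ b, (s.setNat c 0 m).nat (dimArray b) 0 = N b := by
      intro s m hs b
      have : dimArray b ≠ c := by cases b <;> simp [dimArray, h0.1.symm, h2.1.symm]
      simp [State.setNat, this, hs]
    set f : State → State := fun s' => (p.den N s').setNat c 0 ((p.den N s').nat c 0 + 1)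
    -- The `while` loop is followed by induction on the number `m` of remaining passes. The counter
    -- plus `m` stays equal to the dimension because the body changes neither.
    have key : ∀ m (s₁ : State), (∀ b, s₁.nat (dimArray b) 0 = N b) → s₁.nat c 0 + m = N dim →
        ∃ t, (Prog.loop (.natLe (.add (.var c) (.const 1)) (.var (dimArray dim)))
          (.seq p.compile (.setNat c (.const 0) (.add (.var c) (.const 1))))).Runs s₁
            (f^[m] s₁) t ∧ t ≤ m * (p.cost.eval L + 2) + 1 := by
      intro m
      induction m with
      | zero =>
        intro s₁ h₁ hm
        refine ⟨1, .loopStop ?_, by simp⟩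
        simp only [BExp.Holds, NExp.eval, h₁]
        omega
      | succ m ih =>
        intro s₁ h₁ hm
        obtain ⟨t₁, r₁, b₁⟩ := hp hc.2 h0.2 h2.2 s₁ h₁
        have hn : (p.den N s₁).nat c 0 = s₁.nat c 0 := by rw [den_nat_frame p _ _ hc.1]
        obtain ⟨t₂, r₂, b₂⟩ := ih (f s₁) (hset _ _ (hdim p s₁ h0.2 h2.2 h₁))
          (by simp only [f, State.setNat, and_self, if_true, hn]; omega)
        refine ⟨t₁ + 1 + t₂ + 1, .loopStep ?_ (.seq r₁ (.setNat _ _ _ _)) r₂, ?_⟩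
        · simp only [BExp.Holds, NExp.eval, h₁]
          omega
        · have : (m + 1) * (p.cost.eval L + 2) = m * (p.cost.eval L + 2) + (p.cost.eval L + 2) := by
            ring
          omega
    obtain ⟨t, r, ht⟩ := key (N dim) (s.setNat c 0 0) (hset s 0 hs) (by simp [State.setNat])
    refine ⟨1 + t, .seq (.setNat _ _ _ _) r, ?_⟩
    have : N dim * (p.cost.eval L + 2) ≤ L * (p.cost.eval L + 2) := Nat.mul_le_mul_right _ (hL dim)
    simp only [cost, Polynomial.eval_add, Polynomial.eval_one, Polynomial.eval_mul,
      Polynomial.eval_X, Polynomial.eval_ofNat]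
    omega

/-! ### Loops that fill matrices entry by entry. -/

/-- Add the values of `term` over the counter `22` into the real accumulator `6`. -/
def sumBlock (d₃ : Bool) (term : RExp) : Code :=
  .seq (.setReal 6 (.const 0) (.const 0) (.ofNat (.const 0)))
    (.forTo d₃ 22 (.setReal 6 (.const 0) (.const 0)
      (.add (.read 6 (.const 0) (.const 0)) term)))

/-- Fill the real array `a`: entry `(i, j)` becomes the value of `e`, computed after the sum of
`term` is in the accumulator.  The counters are `20` and `21`, and `22` for the sum. -/
def matBlock (d₁ d₂ d₃ : Bool) (a : ℕ) (term e : RExp) : Code :=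
  .forTo d₁ 20 (.forTo d₂ 21 (.seq (sumBlock d₃ term) (.setReal a (.var 20) (.var 21) e)))

/-- `s'` agrees with `s` outside the counters of `matBlock`, the accumulator and the array `a`. -/
def MatFrame (a : ℕ) (s s' : State) : Prop :=
  (∀ b, b ≠ 20 → b ≠ 21 → b ≠ 22 → s'.nat b = s.nat b) ∧
    ∀ b, b ≠ 6 → b ≠ a → s'.real b = s.real b

theorem MatFrame.trans {a : ℕ} {s s' s'' : State} (h : MatFrame a s s') (h' : MatFrame a s' s'') :
    MatFrame a s s'' :=
  ⟨fun b h₁ h₂ h₃ => (h'.1 b h₁ h₂ h₃).trans (h.1 b h₁ h₂ h₃),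
    fun b h₁ h₂ => (h'.2 b h₁ h₂).trans (h.2 b h₁ h₂)⟩

theorem Frame.matFrame {c : Code} {a : ℕ} {s s' : State} (h : c.Frame s s')
    (hn : ∀ b, b ≠ 20 → b ≠ 21 → b ≠ 22 → c.writesNat b = false)
    (hr : ∀ b, b ≠ 6 → b ≠ a → c.writesReal b = false) : MatFrame a s s' :=
  ⟨fun b h₁ h₂ h₃ => h.1 b (hn b h₁ h₂ h₃), fun b h₁ h₂ => h.2 b (hr b h₁ h₂)⟩

theorem sumBlock_spec {d₃ : Bool} {term : RExp} (s : State) (tv : ℕ → ℝ)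
    (ht : ∀ s' l, l < N d₃ → (sumBlock d₃ term).Frame s s' → s'.nat 22 0 = l →
      term.eval s' = tv l) :
    ((sumBlock d₃ term).den N s).real 6 0 0 = ∑ l ∈ Finset.range (N d₃), tv l := by
  simp only [sumBlock, den]
  refine forTo_induction (N := N) (dim := d₃) (c := 22) (p := .setReal 6 (.const 0) (.const 0)
    (.add (.read 6 (.const 0) (.const 0)) term)) rfl _
    (fun m s' => s'.real 6 0 0 = ∑ l ∈ Finset.range m, tv l) ?_ ?_
  · simp [State.setNat, State.setReal, RExp.eval, NExp.eval]
  · intro i hi s' hf hc hI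
    have hterm : term.eval s' = tv i := by
      refine ht s' i hi ⟨fun a h => ?_, fun a h => ?_⟩ hc
      · rw [hf.1 a (by simpa [sumBlock, writesNat] using h)]
        rfl
      · have h6 : (6 == a) = false := by simpa [sumBlock, writesReal] using h
        rw [hf.2 a (by simpa [writesReal] using h6)]
        funext i j
        simp only [beq_eq_false_iff_ne] at h6
        simp [State.setReal, h6.symm]
    simp only [den, State.setNat, State.setReal, RExp.eval, NExp.eval, and_self, if_true,
      Finset.sum_range_succ, ← hI, hterm]

/-- The hypothesis `ht` leaves array `a` arbitrary, so `term` must not depend on it. The expression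
`e` may use the old value of the entry being overwritten; for this the loop invariants also record
that the entries not yet visited are unchanged. This allows the in-place update in `inverseBlock`.
-/
theorem matBlock_spec {d₁ d₂ d₃ : Bool} {a : ℕ} {term e : RExp} (ha : a ≠ 6) (s : State)
    (tv : ℕ → ℕ → ℕ → ℝ) (ev : ℕ → ℕ → ℝ → ℝ)
    (ht : ∀ s' i j l, i < N d₁ → j < N d₂ → l < N d₃ → MatFrame a s s' → s'.nat 20 0 = i →
      s'.nat 21 0 = j → s'.nat 22 0 = l → term.eval s' = tv i j l)
    (he : ∀ s' i j, i < N d₁ → j < N d₂ → MatFrame a s s' → s'.nat 20 0 = i →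
      s'.nat 21 0 = j → s'.real a i j = s.real a i j → e.eval s' = ev i j (s'.real 6 0 0)) :
    ∀ i < N d₁, ∀ j < N d₂, ((matBlock d₁ d₂ d₃ a term e).den N s).real a i j =
      ev i j (∑ l ∈ Finset.range (N d₃), tv i j l) := by
  have ha6 : (6 == a) = false := by simpa using ha.symm
  suffices H : (∀ i < N d₁, ∀ j < N d₂, ((matBlock d₁ d₂ d₃ a term e).den N s).real a i j =
      ev i j (∑ l ∈ Finset.range (N d₃), tv i j l)) ∧ ∀ i ≥ N d₁, ∀ j,
        ((matBlock d₁ d₂ d₃ a term e).den N s).real a i j = s.real a i j from H.1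
  refine forTo_induction (N := N) (dim := d₁) (c := 20) rfl s
    (fun m s' => (∀ i < m, ∀ j < N d₂, s'.real a i j =
      ev i j (∑ l ∈ Finset.range (N d₃), tv i j l)) ∧ ∀ i ≥ m, ∀ j, s'.real a i j = s.real a i j)
    ⟨by simp, fun i _ j => rfl⟩ ?_
  intro i hi s₁ hf₁ hc₁ hI₁
  have hm₁ : MatFrame a s s₁ := hf₁.matFrame
    (fun b h₁ h₂ h₃ => by simp [writesNat, sumBlock, h₁.symm, h₂.symm, h₃.symm])
    (fun b h₁ h₂ => by simp [writesReal, sumBlock, h₁.symm, h₂.symm])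
  have inner := forTo_induction (N := N) (dim := d₂) (c := 21)
    (p := .seq (sumBlock d₃ term) (.setReal a (.var 20) (.var 21) e)) rfl s₁
    (fun m s' => (∀ j < m, s'.real a i j = ev i j (∑ l ∈ Finset.range (N d₃), tv i j l)) ∧
      (∀ j ≥ m, s'.real a i j = s.real a i j) ∧ ∀ i' ≠ i, s'.real a i' = s₁.real a i')
    ⟨by simp, fun j _ => hI₁.2 i le_rfl j, fun _ _ => rfl⟩ ?_
  · refine ⟨fun i' hi' j hj => ?_, fun i' hi' j => ?_⟩
    · rcases Nat.lt_succ_iff_lt_or_eq.1 hi' with h | rfl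
      · exact (congrFun (inner.2.2 i' h.ne) j).trans (hI₁.1 i' h j hj)
      · exact inner.1 j hj
    · exact (congrFun (inner.2.2 i' (by omega)) j).trans (hI₁.2 i' (by omega) j)
  · intro j hj s₂ hf₂ hc₂ hI₂
    have hc₂' : s₂.nat 20 0 = i := by
      rw [hf₂.1 20 (by simp [writesNat, sumBlock]), hc₁]
    have hm₂ : MatFrame a s s₂ := hm₁.trans (hf₂.matFrame
      (fun b h₁ h₂ h₃ => by simp [writesNat, sumBlock, h₂.symm, h₃.symm])
      (fun b h₁ h₂ => by simp [writesReal, sumBlock, h₁.symm, h₂.symm]))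
    have hsumFrame : ∀ s₃, (sumBlock d₃ term).Frame s₂ s₃ → MatFrame a s s₃ ∧ s₃.nat 20 0 = i ∧
        s₃.nat 21 0 = j ∧ s₃.real a = s₂.real a := by
      intro s₃ h₃
      refine ⟨hm₂.trans (h₃.matFrame (fun b h₁ h₂ h₃ => by simp [writesNat, sumBlock, h₃.symm])
        (fun b h₁ h₂ => by simp [writesReal, sumBlock, h₁.symm])), ?_, ?_, ?_⟩
      · rw [h₃.1 20 (by simp [writesNat, sumBlock]), hc₂']
      · rw [h₃.1 21 (by simp [writesNat, sumBlock]), hc₂]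
      · exact h₃.2 a (by simp [writesReal, sumBlock, ha.symm])
    have hsum := sumBlock_spec (N := N) (d₃ := d₃) (term := term) s₂ (tv i j) (by
      intro s₃ l hl h₃ hl'
      obtain ⟨g₁, g₂, g₃, -⟩ := hsumFrame s₃ h₃
      exact ht s₃ i j l hi hj hl g₁ g₂ g₃ hl')
    obtain ⟨g₁, g₂, g₃, g₄⟩ := hsumFrame _ (frame_den (N := N) _ s₂)
    have hev := he _ i j hi hj g₁ g₂ g₃ (by rw [g₄]; exact hI₂.2.1 j le_rfl)
    rw [hsum] at hev
    simp only [den, State.setNat, State.setReal, NExp.eval, g₂, g₃, g₄, hev, true_and]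
    refine ⟨fun j' hj' => ?_, fun j' hj' => ?_, fun i' hi' => ?_⟩
    · rcases Nat.lt_succ_iff_lt_or_eq.1 hj' with h | rfl
      · simpa [h.ne] using hI₂.1 j' h
      · simp
    · have : j' ≠ j := by omega
      simpa [this] using hI₂.2.1 j' (by omega)
    · funext j'
      simp [hi', hI₂.2.2 i' hi']

end Code
end RealRAM

/-! ### Matrix powers, inverses and Gram matrices by field operations. -/

open Matrix

/-- The Sherman–Morrison step: a rank one update of an inverse. -/
theorem Matrix.shermanMorrison_symm {ι : Type*} [Fintype ι] [DecidableEq ι]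
    {M A : Matrix ι ι ℝ} (hA : Aᵀ = A) (hMA : M * A = 1)
    (hpos : ∀ v, 0 ≤ v ⬝ᵥ A *ᵥ v) (g : ι → ℝ) :
    (M - (1 + g ⬝ᵥ M *ᵥ g)⁻¹ • vecMulVec (M *ᵥ g) (M *ᵥ g)) * (A + vecMulVec g g) = 1 := by
  have hAM : A * M = 1 := mul_eq_one_comm.1 hMA
  set u := M *ᵥ g with hu
  have hAu : A *ᵥ u = g := by rw [hu, mulVec_mulVec, hAM, one_mulVec]
  -- Testing the form `A` at `u = M g` gives `u ⬝ᵥ A u = g ⬝ᵥ M g`, so the denominator of the update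
  -- is at least `1`.
  have hnn : 0 ≤ g ⬝ᵥ u := by
    have := hpos u
    rwa [hAu, dotProduct_comm] at this
  have hne : 1 + g ⬝ᵥ u ≠ 0 := by positivity
  have huA : u ᵥ* A = g := by rw [← mulVec_transpose, hA, hAu]
  have h1 : M * vecMulVec g g = vecMulVec u g := by rw [mul_vecMulVec]
  have h2 : vecMulVec u u * A = vecMulVec u g := by rw [vecMulVec_mul, huA]
  have h3 : vecMulVec u u * vecMulVec g g = (g ⬝ᵥ u) • vecMulVec u g := by
    rw [vecMulVec_mul_vecMulVec, dotProduct_comm]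
    ext i j
    simp [vecMulVec_apply, mul_left_comm]
  rw [sub_mul, mul_add, mul_add, hMA, h1, smul_mul_assoc, smul_mul_assoc, h2, h3, smul_smul]
  have : (1 + g ⬝ᵥ u)⁻¹ • vecMulVec u g + ((1 + g ⬝ᵥ u)⁻¹ * g ⬝ᵥ u) • vecMulVec u g
      = vecMulVec u g := by
    rw [← add_smul]
    have : (1 + g ⬝ᵥ u)⁻¹ + (1 + g ⬝ᵥ u)⁻¹ * g ⬝ᵥ u = 1 := by field_simp
    rw [this, one_smul]
  rw [this]; abel

namespace RealRAM
namespace Code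

variable {N : Bool → ℕ}

/-- The numeral `c` as a real expression. -/
abbrev num (c : ℕ) : RExp := .ofNat (.const c)

/-- The indicator of equality of two counters. -/
def indicator (p q : ℕ) : RExp :=
  .ofNat (.sub (.const 1) (.add (.sub (.var p) (.var q)) (.sub (.var q) (.var p))))

/-- The entry of a real array at two counters. -/
abbrev entry (a p q : ℕ) : RExp := .read a (.var p) (.var q)

/-- The accumulator. -/
abbrev acc : RExp := .read 6 (.const 0) (.const 0)

theorem indicator_eval (s : State) (p q : ℕ) :
    (indicator p q).eval s = if s.nat p 0 = s.nat q 0 then 1 else 0 := by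
  simp only [indicator, RExp.eval, NExp.eval]
  split_ifs with h
  · simp [h]
  · have : 1 - (s.nat p 0 - s.nat q 0 + (s.nat q 0 - s.nat p 0)) = 0 := by omega
    rw [this, Nat.cast_zero]

/-- The squared distances of all pairs of points, in array `9`. -/
def distBlock : Code :=
  matBlock false false true 9
    (.mul (.sub (entry 0 20 22) (entry 0 21 22)) (.sub (entry 0 20 22) (entry 0 21 22))) acc

/-- The guess for the squared scale. -/
def scale : RExp :=
  .div (entry 9 11 12)
    (.mul (.ofNat (.add (.var 13) (.const 1))) (.ofNat (.add (.var 14) (.const 1))))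

/-- The normalized scatter matrix, in array `1`. -/
def scatterBlock : Code :=
  matBlock true true false 1 (.mul (entry 0 22 20) (entry 0 22 21))
    (.div acc (.mul (.mul (num 4) (.ofNat (.var 0))) scale))

/-- The identity matrix, in array `a`. -/
def identityBlock (a : ℕ) : Code := matBlock true true true a (num 0) (indicator 20 21)

/-- The power of the scatter matrix, in array `2`. -/
def powerBlock : Code :=
  .forTo true 15 (.seq (matBlock true true true 3 (.mul (entry 2 20 22) (entry 1 22 21)) acc)
    (matBlock true true true 2 (num 0) (entry 3 20 21)))

/-- The inverse of `1 + G * Gᵀ`, where `G` is in array `2`, by rank one updates in array `4`. -/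
def inverseBlock : Code :=
  .forTo true 15 (.seq (matBlock true true true 5 (.mul (entry 4 20 22) (entry 2 22 15)) acc)
    (matBlock true true true 4 (.mul (entry 2 22 15) (entry 5 22 22))
      (.sub (entry 4 20 21) (.div (.mul (entry 5 20 20) (entry 5 21 21)) (.add (num 1) acc)))))

/-- The Gram matrix of the points for the form `1 - M`, in array `8`. -/
def gramBlock : Code :=
  .seq (matBlock false true true 7
      (.mul (entry 0 20 22) (.sub (indicator 22 21) (entry 4 22 21))) acc)
    (matBlock false false true 8 (.mul (entry 7 20 22) (entry 0 21 22)) acc)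

/-- The complete numerical part for one guess of the scale. -/
def spectralBlock : Code :=
  .seq scatterBlock (.seq (identityBlock 2) (.seq powerBlock (.seq (identityBlock 4)
    (.seq inverseBlock gramBlock))))

/-- The upper left square part of a real array, as a matrix. -/
def _root_.RealRAM.State.mat (s : State) (d a : ℕ) : Matrix (Fin d) (Fin d) ℝ :=
  .of fun p q => s.real a p q

/-- A row of a real array, as a vector. -/
def _root_.RealRAM.State.row (s : State) (d a i : ℕ) : Fin d → ℝ := fun p => s.real a i p

theorem frame_matBlock {d₁ d₂ d₃ : Bool} {a : ℕ} {term e : RExp} (s : State) :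
    MatFrame a s ((matBlock d₁ d₂ d₃ a term e).den N s) :=
  (frame_den _ s).matFrame
    (fun b h₁ h₂ h₃ => by simp [matBlock, writesNat, sumBlock, h₁.symm, h₂.symm, h₃.symm])
    (fun b h₁ h₂ => by simp [matBlock, writesReal, sumBlock, h₁.symm, h₂.symm])

theorem distBlock_spec (s : State) : ∀ i < N false, ∀ j < N false,
    (distBlock.den N s).real 9 i j =
      ∑ p ∈ Finset.range (N true), (s.real 0 i p - s.real 0 j p) ^ 2 := by
  refine matBlock_spec (by norm_num) s (fun i j p => (s.real 0 i p - s.real 0 j p) ^ 2)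
    (fun _ _ r => r) ?_ ?_
  · intro s' i j l _ _ _ hf h₁ h₂ h₃
    simp [RExp.eval, NExp.eval, h₁, h₂, h₃, hf.2 0, sq]
  · intro s' i j _ _ _ _ _ _
    simp [RExp.eval, NExp.eval]

theorem scatterBlock_spec (s : State) :
    (scatterBlock.den N s).mat (N true) 1 =
      ((4 * s.nat 0 0 * scale.eval s)⁻¹ : ℝ) •
        ∑ i ∈ Finset.range (N false), vecMulVec (s.row (N true) 0 i) (s.row (N true) 0 i) := by
  have := matBlock_spec (N := N) (d₁ := true) (d₂ := true) (d₃ := false) (a := 1)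
    (term := .mul (entry 0 22 20) (entry 0 22 21))
    (e := .div acc (.mul (.mul (num 4) (.ofNat (.var 0))) scale)) (by norm_num) s
    (fun p q i => s.real 0 i p * s.real 0 i q)
    (fun _ _ r => r / (4 * s.nat 0 0 * scale.eval s)) ?_ ?_
  · ext p q
    refine (this p p.2 q q.2).trans ?_
    simp [Matrix.sum_apply, vecMulVec_apply, State.row, div_eq_inv_mul]
  · intro s' i j l _ _ _ hf h₁ h₂ h₃
    simp [RExp.eval, NExp.eval, h₁, h₂, h₃, hf.2 0]
  · intro s' i j _ _ hf _ _ _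
    simp [RExp.eval, NExp.eval, scale, hf.2 9, hf.1 0, hf.1 11, hf.1 12, hf.1 13, hf.1 14]

theorem identityBlock_spec {a : ℕ} (ha : a ≠ 6) (s : State) :
    ((identityBlock a).den N s).mat (N true) a = 1 := by
  ext p q
  refine (matBlock_spec ha s (fun _ _ _ => 0) (fun i j _ => if i = j then 1 else 0) ?_ ?_
    p p.2 q q.2).trans ?_
  · intro s' i j l _ _ _ _ _ _ _
    simp [RExp.eval, NExp.eval]
  · intro s' i j _ _ _ h₁ h₂ _
    rw [indicator_eval, h₁, h₂]
  · simp [Matrix.one_apply, Fin.ext_iff]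

theorem powerBlock_spec (s : State) (h : s.mat (N true) 2 = 1) :
    (powerBlock.den N s).mat (N true) 2 = s.mat (N true) 1 ^ N true := by
  refine forTo_induction (N := N) (dim := true) (c := 15) rfl s
    (fun r s' => s'.mat (N true) 2 = s.mat (N true) 1 ^ r) ((show (s.setNat 15 0 0).mat (N true) 2 = 1 from h).trans (pow_zero _).symm) ?_
  intro r hr s₁ hf hc hI
  have hB : s₁.real 1 = s.real 1 := hf.2 1 (by simp [matBlock, sumBlock, writesReal])
  simp only [den]
  -- The product goes to array `3` and is copied back, since its computation still reads array `2`.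
  set s₂ := (matBlock true true true 3 (.mul (entry 2 20 22) (entry 1 22 21)) acc).den N s₁
    with hs₂
  have h₂ : s₂.mat (N true) 3 = s₁.mat (N true) 2 * s₁.mat (N true) 1 := by
    ext p q
    refine (matBlock_spec (by norm_num) s₁ (fun i j l => s₁.real 2 i l * s₁.real 1 l j)
      (fun _ _ r => r) ?_ ?_ p p.2 q q.2).trans ?_
    · intro s' i j l _ _ _ hf h₁ h₂ h₃
      simp [RExp.eval, NExp.eval, h₁, h₂, h₃, hf.2 1, hf.2 2]
    · intro s' i j _ _ hf _ _ _
      simp [RExp.eval, NExp.eval]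
    · simp [Matrix.mul_apply, State.mat, Finset.sum_range]
  have h₃ : ((matBlock true true true 2 (num 0) (entry 3 20 21)).den N s₂).mat (N true) 2 =
      s₂.mat (N true) 3 := by
    ext p q
    refine (matBlock_spec (by norm_num) s₂ (fun i j l => 0)
      (fun i j _ => s₂.real 3 i j) ?_ ?_ p p.2 q q.2).trans ?_
    · intro s' i j l _ _ _ _ _ _ _
      simp [RExp.eval, NExp.eval]
    · intro s' i j _ _ hf h₁ h₂ _
      simp [RExp.eval, NExp.eval, h₁, h₂, hf.2 3]
    · rfl
  have hB' : s₁.mat (N true) 1 = s.mat (N true) 1 := by simp only [State.mat, hB]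
  rw [pow_succ, ← hI, ← hB', ← h₂, ← h₃]
  rfl

/-- With `g r` the columns of `G`, `1 + G Gᵀ` is `1` plus the sum of the matrices `g r (g r)ᵀ`. Each
pass adds one summand, and the invariant says that array `4` is a left inverse of the partial sum `A
r`. -/
theorem inverseBlock_spec (s : State) (h : s.mat (N true) 4 = 1) :
    (inverseBlock.den N s).mat (N true) 4 *
      (1 + s.mat (N true) 2 * (s.mat (N true) 2)ᵀ) = 1 := by
  set G := s.mat (N true) 2 with hG
  set g : ℕ → Fin (N true) → ℝ := fun r p => s.real 2 p r with hg
  set A : ℕ → Matrix (Fin (N true)) (Fin (N true)) ℝ :=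
    fun r => 1 + ∑ t ∈ Finset.range r, vecMulVec (g t) (g t) with hA
  have hAG : A (N true) = 1 + G * Gᵀ := by
    rw [hA]
    ext p q
    simp [Matrix.sum_apply, vecMulVec_apply, Finset.sum_range, Matrix.mul_apply, hg, hG, State.mat]
  have hAt : ∀ r, (A r)ᵀ = A r := by
    intro r
    ext p q
    simp [hA, Matrix.sum_apply, vecMulVec_apply, mul_comm, Matrix.one_apply, eq_comm]
  have hApos : ∀ r v, 0 ≤ v ⬝ᵥ A r *ᵥ v := by
    intro r v
    induction r with
    | zero =>
      have : 0 ≤ v ⬝ᵥ v := Finset.sum_nonneg fun i _ => mul_self_nonneg (v i)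
      simpa [hA] using this
    | succ r ih =>
      have : A (r + 1) = A r + vecMulVec (g r) (g r) := by
        simp only [hA, Finset.sum_range_succ, add_assoc]
      rw [this, add_mulVec, dotProduct_add, vecMulVec_mulVec]
      have h2 : v ⬝ᵥ (MulOpposite.op (g r ⬝ᵥ v) • g r) = (g r ⬝ᵥ v) ^ 2 := by
        rw [dotProduct_smul, dotProduct_comm v]
        simp [sq]
      rw [h2]
      positivity
  rw [← hAG]
  refine forTo_induction (N := N) (dim := true) (c := 15) rfl s
    (fun r s' => s'.mat (N true) 4 * A r = 1)
    ?_ ?_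
  · have : (s.setNat 15 0 0).mat (N true) 4 = 1 := h
    simp [this, hA]
  · intro r hr s₁ hf hc hI
    have hG₁ : s₁.real 2 = s.real 2 := hf.2 2 (by simp [matBlock, sumBlock, writesReal])
    simp only [den]
    set s₂ := (matBlock true true true 5 (.mul (entry 4 20 22) (entry 2 22 15)) acc).den N s₁
      with hs₂
    have hf₂ : MatFrame 5 s₁ s₂ := frame_matBlock s₁
    set M := s₁.mat (N true) 4 with hM
    -- Every column of array `5` is the vector `M g`; its diagonal therefore serves as a copy of
    -- this vector in the update.
    have hu : ∀ p q : Fin (N true), s₂.real 5 p q = (M *ᵥ g r) p := by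
      intro p q
      refine (matBlock_spec (by norm_num) s₁ (fun i j l => s₁.real 4 i l * s.real 2 l r)
        (fun _ _ r => r) ?_ ?_ p p.2 q q.2).trans ?_
      · intro s' i j l _ _ _ hf h₁ h₂ h₃
        simp [RExp.eval, NExp.eval, h₁, h₃, hf.2 2, hf.2 4, hf.1 15, hc, hG₁]
      · intro s' i j _ _ hf _ _ _
        simp [RExp.eval, NExp.eval]
      · simp [Matrix.mulVec, dotProduct, State.mat, hM, hg, Finset.sum_range]
    set s₃ := (matBlock true true true 4 (.mul (entry 2 22 15) (entry 5 22 22))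
      (.sub (entry 4 20 21) (.div (.mul (entry 5 20 20) (entry 5 21 21))
        (.add (num 1) acc)))).den N s₂ with hs₃
    have hnew : s₃.mat (N true) 4 =
        M - (1 + g r ⬝ᵥ M *ᵥ g r)⁻¹ • vecMulVec (M *ᵥ g r) (M *ᵥ g r) := by
      ext p q
      refine (matBlock_spec (by norm_num) s₂ (fun i j l => s.real 2 l r * s₂.real 5 l l)
        (fun i j t => s₁.real 4 i j - s₂.real 5 i i * s₂.real 5 j j / (1 + t)) ?_ ?_
        p p.2 q q.2).trans ?_
      · intro s' i j l _ _ _ hf h₁ h₂ h₃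
        simp [RExp.eval, NExp.eval, h₃, hf.2 2, hf.2 5, hf.1 15, hc, hG₁, hf₂.2 2, hf₂.1 15]
      · intro s' i j _ _ hf h₁ h₂ h₃
        simp [RExp.eval, NExp.eval, h₁, h₂, h₃, hf.2 5, hf₂.2 4]
      · rw [Finset.sum_range]
        simp only [hu]
        simp [vecMulVec_apply, dotProduct, hM, State.mat, hg, div_eq_inv_mul]
    have hfinal : (s₃.setNat 15 0 (r + 1)).mat (N true) 4 = s₃.mat (N true) 4 := rfl
    have hAsucc : A (r + 1) = A r + vecMulVec (g r) (g r) := by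
      simp only [hA, Finset.sum_range_succ, add_assoc]
    rw [hfinal, hnew, hAsucc]
    exact Matrix.shermanMorrison_symm (hAt r) hI (hApos r) (g r)

theorem gramBlock_spec (s : State) : ∀ i < N false, ∀ j < N false,
    (gramBlock.den N s).real 8 i j =
      s.row (N true) 0 i ⬝ᵥ (1 - s.mat (N true) 4) *ᵥ s.row (N true) 0 j := by
  intro i hi j hj
  simp only [gramBlock, den]
  set s₂ := (matBlock false true true 7
      (.mul (entry 0 20 22) (.sub (indicator 22 21) (entry 4 22 21))) acc).den N s with hs₂
  have hf₂ : MatFrame 7 s s₂ := frame_matBlock s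
  have hW : ∀ p : Fin (N true), s₂.real 7 i p =
      (s.row (N true) 0 i ᵥ* (1 - s.mat (N true) 4)) p := by
    intro p
    refine (matBlock_spec (by norm_num) s (fun i j l => s.real 0 i l *
      ((if l = j then 1 else 0) - s.real 4 l j)) (fun _ _ r => r) ?_ ?_ i hi p p.2).trans ?_
    · intro s' i j l _ _ _ hf h₁ h₂ h₃
      simp only [RExp.eval, indicator_eval, NExp.eval, h₁, h₂, h₃, hf.2 0 (by norm_num)
        (by norm_num), hf.2 4 (by norm_num) (by norm_num)]
    · intro s' i j _ _ hf _ _ _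
      simp [RExp.eval, NExp.eval]
    · simp [Matrix.vecMul, dotProduct, State.mat, State.row, Finset.sum_range, Matrix.one_apply,
        Fin.ext_iff]
  refine (matBlock_spec (by norm_num) s₂ (fun i j l => s₂.real 7 i l * s.real 0 j l)
    (fun _ _ r => r) ?_ ?_ i hi j hj).trans ?_
  · intro s' i j l _ _ _ hf h₁ h₂ h₃
    simp [RExp.eval, NExp.eval, h₁, h₂, h₃, hf.2 0, hf.2 7, hf₂.2 0]
  · intro s' i j _ _ hf _ _ _
    simp [RExp.eval, NExp.eval]
  · rw [dotProduct_mulVec, Finset.sum_range]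
    simp only [hW]
    rfl

theorem spectralBlock_spec (s : State) {B : Matrix (Fin (N true)) (Fin (N true)) ℝ}
    (hB : B = ((4 * s.nat 0 0 * scale.eval s)⁻¹ : ℝ) •
        ∑ i ∈ Finset.range (N false), vecMulVec (s.row (N true) 0 i) (s.row (N true) 0 i)) :
    ∃ M : Matrix (Fin (N true)) (Fin (N true)) ℝ,
      M * (1 + B ^ N true * (B ^ N true)ᵀ) = 1 ∧ ∀ i < N false, ∀ j < N false,
        (spectralBlock.den N s).real 8 i j =
          s.row (N true) 0 i ⬝ᵥ (1 - M) *ᵥ s.row (N true) 0 j := by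
  simp only [spectralBlock, den]
  set s₁ := scatterBlock.den N s with h₁
  set s₂ := (identityBlock 2).den N s₁ with h₂
  set s₃ := powerBlock.den N s₂ with h₃
  set s₄ := (identityBlock 4).den N s₃ with h₄
  set s₅ := inverseBlock.den N s₄ with h₅
  have e₁ : s₁.mat (N true) 1 = B := by rw [hB, h₁, scatterBlock_spec]
  have e₂ : s₂.mat (N true) 2 = 1 := identityBlock_spec (by norm_num) s₁
  have e₂' : s₂.mat (N true) 1 = B := by
    rw [← e₁]; simp only [State.mat, h₂]; rw [den_real_frame _ _ _ rfl]
  have e₃ : s₃.mat (N true) 2 = B ^ N true := by rw [h₃, powerBlock_spec s₂ e₂, e₂']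
  have e₄ : s₄.mat (N true) 4 = 1 := identityBlock_spec (by norm_num) s₃
  have e₄' : s₄.mat (N true) 2 = B ^ N true := by
    rw [← e₃]; simp only [State.mat, h₄]; rw [den_real_frame _ _ _ rfl]
  have e₅ := inverseBlock_spec s₄ e₄
  have e₀ : ∀ i, s₅.row (N true) 0 i = s.row (N true) 0 i := by
    intro i
    funext p
    simp only [State.row, h₁, h₂, h₃, h₄, h₅]
    repeat rw [den_real_frame _ _ _ rfl]
  rw [e₄'] at e₅
  refine ⟨_, e₅, fun i hi j hj => ?_⟩
  rw [gramBlock_spec s₅ i hi j hj, e₀, e₀]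

end Code
end RealRAM

/-! ### Greedy seeding and labelling on the machine. -/

/-- Greedily chosen seeds: `D` is a squared distance on `{0, …, n - 1}`, a point is heavy if its
ball of squared radius `H` has at least `m` points, the seeds are heavy, their mutual squared
distances exceed `S`, and every heavy point is within squared distance `S` of a seed. -/
structure IsSeeding (D : ℕ → ℕ → ℝ) (n m : ℕ) (H S : ℝ) (q : ℕ) (seed : ℕ → ℕ) : Prop where
  lt : ∀ j < q, seed j < n
  heavy : ∀ j < q, m ≤ ((Finset.range n).filter fun i => D (seed j) i ≤ H).card
  sep : ∀ j < q, ∀ j' < j, S < D (seed j) (seed j')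
  cover : ∀ i < n, m ≤ ((Finset.range n).filter fun i' => D i i' ≤ H).card →
    ∃ j < q, D i (seed j) ≤ S

namespace RealRAM

/-- The squared distance that belongs to the Gram matrix in array `8`. -/
def State.sqDist (s : State) (i j : ℕ) : ℝ :=
  s.real 8 i i + s.real 8 j j - s.real 8 i j - s.real 8 j i

namespace Code

variable {N : Bool → ℕ}

/-- The squared distance that belongs to the Gram matrix in array `8`. -/
def sqDistExp (i j : NExp) : RExp :=
  .sub (.sub (.add (.read 8 i i) (.read 8 j j)) (.read 8 i j)) (.read 8 j i)

theorem sqDistExp_eval (s : State) (i j : NExp) :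
    (sqDistExp i j).eval s = s.sqDist (i.eval s) (j.eval s) := rfl

/-- The guess for the minimum size of a cluster. -/
abbrev sizeExp : NExp := .add (.var 10) (.const 1)

/-- The reciprocal of the guess for the minimum weight. -/
def ratioExp : RExp := .div (.ofNat (.var 0)) (.ofNat sizeExp)

/-- The squared radius in which the points are counted. -/
def heavyExp : RExp := .mul (.mul (num 6) scale) (.mul ratioExp ratioExp)

/-- The squared distance that separates seeds. -/
def sepExp : RExp :=
  let sq : RExp := .mul ratioExp ratioExp
  let quad : RExp := .mul sq sq
  .mul (.mul (num 40000) (.mul quad quad)) heavyExp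

/-- A statement without relevant effect. -/
def skip : Code := .setNat 9 (.const 0) (.const 0)

/-- Count the points in the ball of point `20`, in array `6`. -/
def countBlock : Code :=
  .seq (.setNat 6 (.const 0) (.const 0))
    (.forTo false 21 (.branch (.realLe (sqDistExp (.var 20) (.var 21)) heavyExp)
      (.setNat 6 (.const 0) (.add (.var 6) (.const 1))) skip))

/-- Test whether point `20` is close to one of the seeds in array `4`. -/
def flagBlock : Code :=
  .seq (.setNat 7 (.const 0) (.const 0))
    (.forTo false 21 (.branch (.and (.natLe (.add (.var 21) (.const 1)) (.var 5))
        (.realLe (sqDistExp (.var 20) (.read 4 (.var 21))) sepExp))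
      (.setNat 7 (.const 0) (.const 1)) skip))

/-- Choose seeds, in array `4`, and their number, in array `5`. -/
def seedBlock : Code :=
  .seq (.setNat 5 (.const 0) (.const 0))
    (.forTo false 20 (.seq countBlock (.seq flagBlock
      (.branch (.and (.natLe sizeExp (.var 6)) (.natLe (.var 7) (.const 0)))
        (.seq (.setNat 4 (.var 5) (.var 20)) (.setNat 5 (.const 0) (.add (.var 5) (.const 1))))
        skip))))

/-- Find the nearest seed of point `20`, in array `8`. -/
def nearestBlock : Code :=
  .seq (.setNat 8 (.const 0) (.const 0))
    (.forTo false 21 (.branch (.and (.natLe (.add (.var 21) (.const 1)) (.var 5))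
        (.realLe (sqDistExp (.var 20) (.read 4 (.var 21)))
          (sqDistExp (.var 20) (.read 4 (.var 8)))))
      (.setNat 8 (.const 0) (.var 21)) skip))

/-- Label every point by its nearest seed, in array `1`. -/
def labelBlock : Code :=
  .forTo false 20 (.seq nearestBlock (.setNat 1 (.var 20) (.var 8)))

/-- `s'` has the real arrays of `s` and the parameters that the guess depends on. -/
def ParamFrame (s s' : State) : Prop :=
  s'.real = s.real ∧ s'.nat 0 = s.nat 0 ∧ s'.nat 10 = s.nat 10 ∧ s'.nat 11 = s.nat 11 ∧
    s'.nat 12 = s.nat 12 ∧ s'.nat 13 = s.nat 13 ∧ s'.nat 14 = s.nat 14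

theorem ParamFrame.trans {s s' s'' : State} (h : ParamFrame s s') (h' : ParamFrame s' s'') :
    ParamFrame s s'' := by
  obtain ⟨h0, h1, h2, h3, h4, h5, h6⟩ := h
  obtain ⟨g0, g1, g2, g3, g4, g5, g6⟩ := h'
  exact ⟨g0.trans h0, g1.trans h1, g2.trans h2, g3.trans h3, g4.trans h4, g5.trans h5,
    g6.trans h6⟩

theorem Frame.paramFrame {c : Code} {s s' : State} (h : c.Frame s s')
    (hr : ∀ a, c.writesReal a = false) (h0 : c.writesNat 0 = false) (h10 : c.writesNat 10 = false)
    (h11 : c.writesNat 11 = false) (h12 : c.writesNat 12 = false) (h13 : c.writesNat 13 = false)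
    (h14 : c.writesNat 14 = false) : ParamFrame s s' :=
  ⟨funext fun a => h.2 a (hr a), h.1 0 h0, h.1 10 h10, h.1 11 h11, h.1 12 h12, h.1 13 h13,
    h.1 14 h14⟩

theorem ParamFrame.heavyExp {s s' : State} (h : ParamFrame s s') :
    heavyExp.eval s' = heavyExp.eval s := by
  obtain ⟨h0, h1, h2, h3, h4, h5, h6⟩ := h
  simp [Code.heavyExp, ratioExp, scale, RExp.eval, NExp.eval, h0, h1, h2, h3, h4, h5, h6]

theorem ParamFrame.sepExp {s s' : State} (h : ParamFrame s s') :
    sepExp.eval s' = sepExp.eval s := by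
  have hh := h.heavyExp
  obtain ⟨h0, h1, h2, h3, h4, h5, h6⟩ := h
  simp [Code.sepExp, ratioExp, RExp.eval, NExp.eval, hh, h1, h2]

theorem ParamFrame.sqDist {s s' : State} (h : ParamFrame s s') : s'.sqDist = s.sqDist := by
  funext i j
  simp [State.sqDist, h.1]

theorem countBlock_spec (s : State) : (countBlock.den N s).nat 6 0 =
    ((Finset.range (N false)).filter fun i => s.sqDist (s.nat 20 0) i ≤ heavyExp.eval s).card := by
  simp only [countBlock, den]
  refine forTo_induction (N := N) (dim := false) (c := 21)
    (p := .branch (.realLe (sqDistExp (.var 20) (.var 21)) heavyExp)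
      (.setNat 6 (.const 0) (.add (.var 6) (.const 1))) skip) rfl _
    (fun r s' => s'.nat 6 0 =
      ((Finset.range r).filter fun i => s.sqDist (s.nat 20 0) i ≤ heavyExp.eval s).card) ?_ ?_
  · simp [State.setNat, NExp.eval]
  · intro i hi s' hf hc hI
    have hp : ParamFrame s s' :=
      ParamFrame.trans (s' := s.setNat 6 0 0) (by simp [ParamFrame, State.setNat])
        (hf.paramFrame (fun _ => rfl) rfl rfl rfl rfl rfl rfl)
    have h20 : s'.nat 20 0 = s.nat 20 0 := by
      rw [hf.1 20 rfl]; simp [State.setNat]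
    have hiff : (BExp.realLe (sqDistExp (.var 20) (.var 21)) heavyExp).Holds s' ↔
        s.sqDist (s.nat 20 0) i ≤ heavyExp.eval s := by
      simp only [BExp.Holds, sqDistExp_eval, hp.sqDist, hp.heavyExp, NExp.eval, h20, hc]
    rw [Finset.range_add_one, Finset.filter_insert]
    by_cases hb : s.sqDist (s.nat 20 0) i ≤ heavyExp.eval s
    · simp only [den, if_pos (hiff.2 hb), if_pos hb]
      simp [State.setNat, NExp.eval, hI]
    · simp only [den, if_neg (fun h => hb (hiff.1 h)), if_neg hb]
      simp [State.setNat, skip, NExp.eval, hI, den]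

/-- The loop runs over all `n` indices and tests `j < s.nat 5 0` inside, because a loop bound can
only be one of the two dimensions. -/
theorem flagBlock_spec (s : State) : (flagBlock.den N s).nat 7 0 = 0 ↔
    ∀ j < N false, j < s.nat 5 0 → sepExp.eval s < s.sqDist (s.nat 20 0) (s.nat 4 j) := by
  simp only [flagBlock, den]
  refine forTo_induction (N := N) (dim := false) (c := 21)
    (p := .branch (.and (.natLe (.add (.var 21) (.const 1)) (.var 5))
        (.realLe (sqDistExp (.var 20) (.read 4 (.var 21))) sepExp))
      (.setNat 7 (.const 0) (.const 1)) skip) rfl _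
    (fun r s' => s'.nat 7 0 = 0 ↔
      ∀ j < r, j < s.nat 5 0 → sepExp.eval s < s.sqDist (s.nat 20 0) (s.nat 4 j)) ?_ ?_
  · simp [State.setNat, NExp.eval]
  · intro i hi s' hf hc hI
    have hp : ParamFrame s s' :=
      ParamFrame.trans (s' := s.setNat 7 0 0) (by simp [ParamFrame, State.setNat])
        (hf.paramFrame (fun _ => rfl) rfl rfl rfl rfl rfl rfl)
    have hn : ∀ b, b ≠ 7 → b ≠ 21 → b ≠ 9 → s'.nat b = s.nat b := by
      intro b h7 h21 h9
      rw [hf.1 b (by simp [writesNat, skip, h7.symm, h21.symm, h9.symm])]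
      funext i; simp [State.setNat, h7]
    have hiff : (BExp.and (.natLe (.add (.var 21) (.const 1)) (.var 5))
        (.realLe (sqDistExp (.var 20) (.read 4 (.var 21))) sepExp)).Holds s' ↔
        i < s.nat 5 0 ∧ s.sqDist (s.nat 20 0) (s.nat 4 i) ≤ sepExp.eval s := by
      simp only [BExp.Holds, sqDistExp_eval, hp.sqDist, hp.sepExp, NExp.eval, hc,
        hn 20 (by norm_num) (by norm_num) (by norm_num),
        hn 5 (by norm_num) (by norm_num) (by norm_num),
        hn 4 (by norm_num) (by norm_num) (by norm_num), Nat.succ_le_iff]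
    by_cases hb : i < s.nat 5 0 ∧ s.sqDist (s.nat 20 0) (s.nat 4 i) ≤ sepExp.eval s
    · simp only [den, if_pos (hiff.2 hb)]
      simp only [State.setNat, NExp.eval, and_self, if_true]
      simp only [Nat.reduceEqDiff, false_and, if_false, one_ne_zero, false_iff, not_forall]
      exact ⟨i, by omega, hb.1, not_lt.2 hb.2⟩
    · simp only [den, if_neg (fun h => hb (hiff.1 h))]
      simp only [State.setNat, skip, den, NExp.eval]
      simp only [Nat.reduceEqDiff, false_and, if_false, hI]
      constructor
      · intro h j hj hj'
        rcases Nat.lt_succ_iff_lt_or_eq.1 hj with h' | rfl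
        · exact h j h' hj'
        · by_contra h''
          exact hb ⟨hj', not_lt.1 h''⟩
      · intro h j hj
        exact h j (by omega)

theorem seedBlock_spec (s : State)
    (hS : 0 ≤ sepExp.eval s) :
    IsSeeding s.sqDist (N false) (s.nat 10 0 + 1) (heavyExp.eval s) (sepExp.eval s)
      ((seedBlock.den N s).nat 5 0) ((seedBlock.den N s).nat 4) ∧
    (seedBlock.den N s).nat 5 0 ≤ N false := by
  set heavy : ℕ → Prop := fun i => s.nat 10 0 + 1 ≤
    ((Finset.range (N false)).filter fun i' => s.sqDist i i' ≤ heavyExp.eval s).card with hheavy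
  suffices H : ((∀ j < (seedBlock.den N s).nat 5 0, (seedBlock.den N s).nat 4 j < N false ∧
      heavy ((seedBlock.den N s).nat 4 j)) ∧
      (∀ j < (seedBlock.den N s).nat 5 0, ∀ j' < j, sepExp.eval s <
        s.sqDist ((seedBlock.den N s).nat 4 j) ((seedBlock.den N s).nat 4 j')) ∧
      ∀ i < N false, heavy i → ∃ j < (seedBlock.den N s).nat 5 0,
        s.sqDist i ((seedBlock.den N s).nat 4 j) ≤ sepExp.eval s) ∧
      (seedBlock.den N s).nat 5 0 ≤ N false from
    ⟨⟨fun j hj => (H.1.1 j hj).1, fun j hj => (H.1.1 j hj).2, H.1.2.1, H.1.2.2⟩, H.2⟩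
  simp only [seedBlock, den]
  refine forTo_induction (N := N) (dim := false) (c := 20)
    (p := .seq countBlock (.seq flagBlock
      (.branch (.and (.natLe sizeExp (.var 6)) (.natLe (.var 7) (.const 0)))
        (.seq (.setNat 4 (.var 5) (.var 20)) (.setNat 5 (.const 0) (.add (.var 5) (.const 1))))
        skip))) rfl _
    (fun r s' => ((∀ j < s'.nat 5 0, s'.nat 4 j < N false ∧ heavy (s'.nat 4 j)) ∧
      (∀ j < s'.nat 5 0, ∀ j' < j, sepExp.eval s < s.sqDist (s'.nat 4 j) (s'.nat 4 j')) ∧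
      ∀ i < r, heavy i → ∃ j < s'.nat 5 0, s.sqDist i (s'.nat 4 j) ≤ sepExp.eval s) ∧
      s'.nat 5 0 ≤ r) ?_ ?_
  · simp [State.setNat, NExp.eval]
  · intro i hi s₁ hf hc hI
    have hp : ParamFrame s s₁ :=
      ParamFrame.trans (s' := s.setNat 5 0 0) (by simp [ParamFrame, State.setNat])
        (hf.paramFrame (fun _ => rfl) rfl rfl rfl rfl rfl rfl)
    simp only [den]
    set s₂ := countBlock.den N s₁ with h₂
    set s₃ := flagBlock.den N s₂ with h₃
    have f₂ : countBlock.Frame s₁ s₂ := frame_den _ _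
    have f₃ : flagBlock.Frame s₂ s₃ := frame_den _ _
    have hp₂ : ParamFrame s s₂ := hp.trans
      (f₂.paramFrame (fun _ => rfl) rfl rfl rfl rfl rfl rfl)
    have hp₃ : ParamFrame s s₃ := hp₂.trans
      (f₃.paramFrame (fun _ => rfl) rfl rfl rfl rfl rfl rfl)
    have hcount : s₃.nat 6 0 = ((Finset.range (N false)).filter
        fun i' => s.sqDist i i' ≤ heavyExp.eval s).card := by
      rw [f₃.1 6 rfl, h₂, countBlock_spec, hp.sqDist, hp.heavyExp, hc]
    have hq : s₃.nat 5 = s₁.nat 5 := by rw [f₃.1 5 rfl, f₂.1 5 rfl]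
    have h20 : s₃.nat 20 0 = i := by rw [f₃.1 20 rfl, f₂.1 20 rfl, hc]
    have h4 : s₃.nat 4 = s₁.nat 4 := by rw [f₃.1 4 rfl, f₂.1 4 rfl]
    have h10 : s₃.nat 10 0 = s.nat 10 0 := by rw [hp₃.2.2.1]
    have hflag : s₃.nat 7 0 = 0 ↔ ∀ j < s₁.nat 5 0,
        sepExp.eval s < s.sqDist i (s₁.nat 4 j) := by
      rw [h₃, flagBlock_spec, hp₂.sqDist, hp₂.sepExp, f₂.1 5 rfl, f₂.1 4 rfl, f₂.1 20 rfl, hc]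
      exact ⟨fun h j hj => h j (by omega) hj, fun h j _ hj => h j hj⟩
    have hiff : (BExp.and (.natLe sizeExp (.var 6)) (.natLe (.var 7) (.const 0))).Holds s₃ ↔
        heavy i ∧ ∀ j < s₁.nat 5 0, sepExp.eval s < s.sqDist i (s₁.nat 4 j) := by
      simp only [BExp.Holds, NExp.eval, h10, hcount, Nat.le_zero, hflag, hheavy]
    obtain ⟨⟨I₁, I₂, I₃⟩, I₄⟩ := hI
    by_cases hb : heavy i ∧ ∀ j < s₁.nat 5 0, sepExp.eval s < s.sqDist i (s₁.nat 4 j)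
    · simp only [if_pos (hiff.2 hb)]
      set s₄ := ((((s₃.setNat 4 (NExp.eval s₃ (.var 5)) (NExp.eval s₃ (.var 20)))).setNat 5
        (NExp.eval (s₃.setNat 4 (NExp.eval s₃ (.var 5)) (NExp.eval s₃ (.var 20))) (.const 0))
        (NExp.eval (s₃.setNat 4 (NExp.eval s₃ (.var 5)) (NExp.eval s₃ (.var 20)))
          (.add (.var 5) (.const 1)))).setNat 20 0 (i + 1)) with h₄
      have e5 : s₄.nat 5 0 = s₁.nat 5 0 + 1 := by
        simp [h₄, State.setNat, NExp.eval, hq]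
      have e4 : ∀ j, s₄.nat 4 j = if j = s₁.nat 5 0 then i else s₁.nat 4 j := by
        intro j
        simp [h₄, State.setNat, NExp.eval, hq, h4, h20]
      simp only [e5, e4]
      refine ⟨⟨fun j hj => ?_, fun j hj j' hj' => ?_, fun i' hi' hh => ?_⟩, by omega⟩
      · split_ifs with h
        · exact ⟨hi, hb.1⟩
        · exact I₁ j (by omega)
      · rw [if_neg (show ¬ j' = s₁.nat 5 0 by omega)]
        split_ifs with h
        · exact hb.2 j' (by omega)
        · exact I₂ j (by omega) j' hj'
      · rcases Nat.lt_succ_iff_lt_or_eq.1 hi' with h | rfl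
        · obtain ⟨j, hj, hj'⟩ := I₃ i' h hh
          exact ⟨j, by omega, by rwa [if_neg (by omega)]⟩
        · refine ⟨s₁.nat 5 0, by omega, ?_⟩
          rw [if_pos rfl]
          -- A new seed covers itself: its squared distance to itself is `0`, at most the separation
          -- radius.
          simpa [State.sqDist] using hS
    · simp only [if_neg (fun h => hb (hiff.1 h))]
      set s₄ := (skip.den N s₃).setNat 20 0 (i + 1) with h₄
      have e5 : s₄.nat 5 0 = s₁.nat 5 0 := by
        simp [h₄, skip, den, State.setNat, NExp.eval, hq]
      have e4 : s₄.nat 4 = s₁.nat 4 := by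
        funext j
        simp [h₄, skip, den, State.setNat, NExp.eval, h4]
      simp only [e5, e4]
      refine ⟨⟨I₁, I₂, fun i' hi' hh => ?_⟩, by omega⟩
      rcases Nat.lt_succ_iff_lt_or_eq.1 hi' with h | rfl
      · exact I₃ i' h hh
      · by_contra hne
        exact hb ⟨hh, fun j hj => not_le.1 fun hle => hne ⟨j, hj, hle⟩⟩

/-- The search starts with seed `0` as the candidate, hence `hq`. By `hqn` a loop over the points
visits all seeds. -/
theorem nearestBlock_spec (s : State) (hq : 0 < s.nat 5 0) (hqn : s.nat 5 0 ≤ N false) :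
    (nearestBlock.den N s).nat 8 0 < s.nat 5 0 ∧ ∀ j < s.nat 5 0,
      s.sqDist (s.nat 20 0) (s.nat 4 ((nearestBlock.den N s).nat 8 0)) ≤
        s.sqDist (s.nat 20 0) (s.nat 4 j) := by
  suffices H : (nearestBlock.den N s).nat 8 0 < s.nat 5 0 ∧ ∀ j < N false, j < s.nat 5 0 →
      s.sqDist (s.nat 20 0) (s.nat 4 ((nearestBlock.den N s).nat 8 0)) ≤
        s.sqDist (s.nat 20 0) (s.nat 4 j) from ⟨H.1, fun j hj => H.2 j (by omega) hj⟩
  simp only [nearestBlock, den]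
  refine forTo_induction (N := N) (dim := false) (c := 21)
    (p := .branch (.and (.natLe (.add (.var 21) (.const 1)) (.var 5))
        (.realLe (sqDistExp (.var 20) (.read 4 (.var 21)))
          (sqDistExp (.var 20) (.read 4 (.var 8)))))
      (.setNat 8 (.const 0) (.var 21)) skip) rfl _
    (fun r s' => s'.nat 8 0 < s.nat 5 0 ∧ ∀ j < r, j < s.nat 5 0 →
      s.sqDist (s.nat 20 0) (s.nat 4 (s'.nat 8 0)) ≤ s.sqDist (s.nat 20 0) (s.nat 4 j)) ?_ ?_
  · simp [State.setNat, NExp.eval, hq]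
  · intro i hi s' hf hc hI
    have hn : ∀ b, b ≠ 8 → b ≠ 21 → b ≠ 9 → s'.nat b = s.nat b := by
      intro b h8 h21 h9
      rw [hf.1 b (by simp [writesNat, skip, h8.symm, h21.symm, h9.symm])]
      funext i; simp [State.setNat, h8]
    have hd : s'.sqDist = s.sqDist := by
      have : s'.real = s.real := funext fun a => hf.2 a rfl
      funext i j; simp [State.sqDist, this]
    have hiff : (BExp.and (.natLe (.add (.var 21) (.const 1)) (.var 5))
        (.realLe (sqDistExp (.var 20) (.read 4 (.var 21)))
          (sqDistExp (.var 20) (.read 4 (.var 8))))).Holds s' ↔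
        i < s.nat 5 0 ∧ s.sqDist (s.nat 20 0) (s.nat 4 i) ≤
          s.sqDist (s.nat 20 0) (s.nat 4 (s'.nat 8 0)) := by
      simp only [BExp.Holds, sqDistExp_eval, hd, NExp.eval, hc,
        hn 20 (by norm_num) (by norm_num) (by norm_num),
        hn 5 (by norm_num) (by norm_num) (by norm_num),
        hn 4 (by norm_num) (by norm_num) (by norm_num), Nat.succ_le_iff]
    by_cases hb : i < s.nat 5 0 ∧ s.sqDist (s.nat 20 0) (s.nat 4 i) ≤
        s.sqDist (s.nat 20 0) (s.nat 4 (s'.nat 8 0))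
    · simp only [den, if_pos (hiff.2 hb)]
      have e8 : ((s'.setNat 8 (NExp.eval s' (.const 0)) (NExp.eval s' (.var 21))).setNat 21 0
          (i + 1)).nat 8 0 = i := by
        simp [State.setNat, NExp.eval, hc]
      rw [e8]
      refine ⟨hb.1, fun j hj hj' => ?_⟩
      rcases Nat.lt_succ_iff_lt_or_eq.1 hj with h' | rfl
      · exact hb.2.trans (hI.2 j h' hj')
      · exact le_rfl
    · simp only [den, if_neg (fun h => hb (hiff.1 h))]
      have e8 : ((skip.den N s').setNat 21 0 (i + 1)).nat 8 0 = s'.nat 8 0 := by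
        simp [State.setNat, skip, den, NExp.eval]
      rw [e8]
      refine ⟨hI.1, fun j hj hj' => ?_⟩
      rcases Nat.lt_succ_iff_lt_or_eq.1 hj with h' | rfl
      · exact hI.2 j h' hj'
      · by_contra h''
        exact hb ⟨hj', (not_le.1 h'').le⟩

theorem labelBlock_spec (s : State) (hq : 0 < s.nat 5 0) (hqn : s.nat 5 0 ≤ N false) :
    ∀ i < N false, (labelBlock.den N s).nat 1 i < s.nat 5 0 ∧ ∀ j < s.nat 5 0,
      s.sqDist i (s.nat 4 ((labelBlock.den N s).nat 1 i)) ≤ s.sqDist i (s.nat 4 j) := by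
  refine forTo_induction (N := N) (dim := false) (c := 20)
    (p := .seq nearestBlock (.setNat 1 (.var 20) (.var 8))) rfl s
    (fun r s' => ∀ i < r, s'.nat 1 i < s.nat 5 0 ∧ ∀ j < s.nat 5 0,
      s.sqDist i (s.nat 4 (s'.nat 1 i)) ≤ s.sqDist i (s.nat 4 j)) (by simp) ?_
  intro i hi s₁ hf hc hI i' hi'
  simp only [den]
  set s₂ := nearestBlock.den N s₁ with h₂
  have f₂ : nearestBlock.Frame s₁ s₂ := frame_den _ _
  have hd : s₁.sqDist = s.sqDist := by
    have : s₁.real = s.real := funext fun a => hf.2 a rfl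
    funext i j; simp [State.sqDist, this]
  have e1 : ((s₂.setNat 1 (NExp.eval s₂ (.var 20)) (NExp.eval s₂ (.var 8))).setNat 20 0
      (i + 1)).nat 1 i' = if i' = i then s₂.nat 8 0 else s₁.nat 1 i' := by
    simp [State.setNat, NExp.eval, f₂.1 20 rfl, hc, f₂.1 1 rfl]
  rw [e1]
  have := nearestBlock_spec (N := N) s₁ (by rwa [hf.1 5 rfl]) (by rwa [hf.1 5 rfl])
  rw [hd, hf.1 5 rfl, hf.1 4 rfl, hc, ← h₂] at this
  split_ifs with h
  · rw [h]; exact this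
  · exact hI i' (by omega)

end Code
end RealRAM

/-- The computed distances are specified only for indices below `n`; a seeding looks at no others.
-/
theorem IsSeeding.congr {D D' : ℕ → ℕ → ℝ} {n m : ℕ} {H S : ℝ} {q : ℕ} {seed : ℕ → ℕ}
    (h : IsSeeding D n m H S q seed) (hD : ∀ i < n, ∀ j < n, D i j = D' i j) :
    IsSeeding D' n m H S q seed := by
  have hcard : ∀ i < n, ((Finset.range n).filter fun i' => D' i i' ≤ H) =
      (Finset.range n).filter fun i' => D i i' ≤ H := by
    intro i hi
    refine Finset.filter_congr fun j hj => ?_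
    rw [hD i hi j (Finset.mem_range.1 hj)]
  refine ⟨h.lt, fun j hj => ?_, fun j hj j' hj' => ?_, fun i hi hc => ?_⟩
  · rw [hcard _ (h.lt j hj)]; exact h.heavy j hj
  · rw [← hD _ (h.lt j hj) _ (h.lt j' (hj'.trans hj))]; exact h.sep j hj j' hj'
  · rw [hcard i hi] at hc
    obtain ⟨j, hj, hj'⟩ := h.cover i hi hc
    exact ⟨j, hj, by rwa [← hD i hi _ (h.lt j hj)]⟩

/-! ### The quantities that belong to one guess. -/

namespace Clustering

variable {n d : ℕ}

/-- The `i`-th point as a vector of coordinates, `0` if there is no such point. -/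
def coords (x : Fin n → EuclideanSpace ℝ (Fin d)) (i : ℕ) : Fin d → ℝ :=
  fun p => if h : i < n then x ⟨i, h⟩ p else 0

/-- The normalized scatter matrix of the points, for the squared scale `s`. -/
noncomputable def scatter (x : Fin n → EuclideanSpace ℝ (Fin d)) (s : ℝ) :
    Matrix (Fin d) (Fin d) ℝ :=
  ((4 * n * s)⁻¹ : ℝ) • ∑ i ∈ Finset.range n, vecMulVec (coords x i) (coords x i)

/-- A smooth substitute for the orthogonal projection to the eigenspaces of the scatter matrix with
an eigenvalue above `1`. -/
noncomputable def cutoff (x : Fin n → EuclideanSpace ℝ (Fin d)) (s : ℝ) :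
    Matrix (Fin d) (Fin d) ℝ :=
  1 - (1 + scatter x s ^ d * (scatter x s ^ d)ᵀ)⁻¹

/-- The squared distance of two points in the form `cutoff`. -/
noncomputable def cutoffSqDist (x : Fin n → EuclideanSpace ℝ (Fin d)) (s : ℝ) (i j : ℕ) : ℝ :=
  (coords x i - coords x j) ⬝ᵥ cutoff x s *ᵥ (coords x i - coords x j)

/-- The squared radius in which the points are counted. -/
noncomputable def heavyRadius (n m : ℕ) (s : ℝ) : ℝ := 6 * s * ((n : ℝ) / m) ^ 2

/-- The squared distance that separates seeds. -/
noncomputable def sepRadius (n m : ℕ) (s : ℝ) : ℝ :=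
  40000 * ((n : ℝ) / m) ^ 8 * heavyRadius n m s

/-- Seeds for the guesses `m` of the minimum cluster size and `s` of the squared scale. -/
def SeedsFor (x : Fin n → EuclideanSpace ℝ (Fin d)) (m : ℕ) (s : ℝ) (q : ℕ)
    (seed : ℕ → ℕ) : Prop :=
  IsSeeding (cutoffSqDist x s) n m (heavyRadius n m s) (sepRadius n m s) q seed

/-- The labels `lab` point to a nearest seed. -/
def NearestLabels (x : Fin n → EuclideanSpace ℝ (Fin d)) (s : ℝ) (q : ℕ) (seed lab : ℕ → ℕ) :
    Prop :=
  ∀ i < n, lab i < q ∧ ∀ j < q, cutoffSqDist x s i (seed (lab i)) ≤ cutoffSqDist x s i (seed j)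

/-- The guess for the squared scale from two points and a divisor. -/
noncomputable def scaleGuess (x : Fin n → EuclideanSpace ℝ (Fin d)) (a b i j : ℕ) : ℝ :=
  (∑ p, (coords x a p - coords x b p) ^ 2) / ((i + 1 : ℕ) * (j + 1 : ℕ))

theorem scaleGuess_nonneg (x : Fin n → EuclideanSpace ℝ (Fin d)) (a b i j : ℕ) :
    0 ≤ scaleGuess x a b i j := by
  unfold scaleGuess; positivity

theorem sepRadius_nonneg {m : ℕ} {s : ℝ} (hs : 0 ≤ s) : 0 ≤ sepRadius n m s := by
  unfold sepRadius heavyRadius; positivity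

end Clustering

/-! ### The search over all guesses. -/

namespace RealRAM
open Clustering


namespace Code

variable {n d : ℕ}

/-- The two dimensions of the loops. -/
def dims (n d : ℕ) : Bool → ℕ := fun b => if b then d else n

/-- Keep the clustering by nearest seeds if it has more clusters than the best one so far. -/
def updateBlock : Code :=
  .branch (.natLe (.add (.var 3) (.const 1)) (.var 5))
    (.seq (.setNat 3 (.const 0) (.var 5)) labelBlock) skip

/-- Treat one guess. -/
def guessBlock : Code := .seq spectralBlock (.seq seedBlock updateBlock)

/-- All guesses for the squared scale. -/
def scaleLoop : Code :=
  .forTo false 11 (.forTo false 12 (.forTo false 13 (.forTo true 14 guessBlock)))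

/-- The test whether the guess for the size is at least the power `4 / 5` of the number of points. -/
def sizeTest : BExp :=
  let N : RExp := .ofNat (.var 0)
  let M : RExp := .ofNat sizeExp
  .realLe (.mul (.mul N N) (.mul N N)) (.mul M (.mul (.mul M M) (.mul M M)))

/-- All guesses for the size. -/
def searchLoop : Code := .forTo false 10 (.branch sizeTest scaleLoop skip)

/-- The clustering algorithm, up to the treatment of input and output. -/
def clusterCode : Code := .seq distBlock searchLoop

/-- The part of the memory that stays fixed during the search. -/
structure Fixed (x : Fin n → EuclideanSpace ℝ (Fin d)) (st : State) : Prop where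
  card : st.nat 0 0 = n
  points : ∀ i, st.row d 0 i = coords x i
  dist : ∀ a < n, ∀ b < n, st.real 9 a b = ∑ p, (coords x a p - coords x b p) ^ 2

/-- The best clustering so far is that of a guess of the size that is least among those treated
with the same number of clusters. `P` holds for the treated guesses, and `L` bounds their sizes. -/
structure SearchInv (x : Fin n → EuclideanSpace ℝ (Fin d)) (L : ℕ) (P : ℕ → ℝ → Prop)
    (st : State) : Prop extends Fixed x st where
  best : ∃ m ≤ L, (st.nat 3 0 = 0 ∨ ∃ s seed, 0 ≤ s ∧ n ^ 4 ≤ m ^ 5 ∧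
      SeedsFor x m s (st.nat 3 0) seed ∧ NearestLabels x s (st.nat 3 0) seed (st.nat 1)) ∧
    ∀ m' s', P m' s' → ∃ q seed, SeedsFor x m' s' q seed ∧ q ≤ st.nat 3 0 ∧
      (q = st.nat 3 0 → m ≤ m')

theorem SearchInv.congr {x : Fin n → EuclideanSpace ℝ (Fin d)} {L : ℕ} {P P' : ℕ → ℝ → Prop}
    {st st' : State} (h : SearchInv x L P st) (h0 : st'.nat 0 0 = st.nat 0 0)
    (h1 : st'.nat 1 = st.nat 1) (h3 : st'.nat 3 0 = st.nat 3 0) (hx : st'.real 0 = st.real 0)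
    (h9 : st'.real 9 = st.real 9) (hP : ∀ m s, P' m s → P m s) : SearchInv x L P' st' where
  card := h0.trans h.card
  points i := by rw [← h.points i]; funext p; simp only [State.row, hx]
  dist := by rw [h9]; exact h.dist
  best := by
    rw [h1, h3]
    obtain ⟨m, hm, h₁, h₂⟩ := h.best
    exact ⟨m, hm, h₁, fun m' s' h' => h₂ m' s' (hP _ _ h')⟩

theorem SearchInv.setNat {x : Fin n → EuclideanSpace ℝ (Fin d)} {L : ℕ} {P : ℕ → ℝ → Prop}
    {st : State} (h : SearchInv x L P st) {c : ℕ} (hc : 3 < c) (v : ℕ) :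
    SearchInv x L P (st.setNat c 0 v) := by
  refine h.congr ?_ ?_ ?_ rfl rfl fun _ _ h => h
  · simp [State.setNat, show ¬ 0 = c by omega]
  · funext i; simp [State.setNat, show ¬ 1 = c by omega]
  · simp [State.setNat, show ¬ 3 = c by omega]

/-- A loop whose passes treat the guesses in `R i`. -/
theorem forTo_searchInv {x : Fin n → EuclideanSpace ℝ (Fin d)} {L : ℕ} {dim : Bool} {c : ℕ}
    {p : Code} (hw : p.writesNat c = false) (hc : 3 < c) (s : State) (R : ℕ → ℕ → ℝ → Prop)
    (P : ℕ → ℝ → Prop) (h : SearchInv x L P s)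
    (hbody : ∀ i < dims n d dim, ∀ s', (forTo dim c p).Frame s s' → s'.nat c 0 = i →
      ∀ P', SearchInv x L P' s' →
        SearchInv x L (fun m t => P' m t ∨ R i m t) (p.den (dims n d) s')) :
    SearchInv x L (fun m t => P m t ∨ ∃ i < dims n d dim, R i m t)
      ((forTo dim c p).den (dims n d) s) := by
  refine forTo_induction (N := dims n d) (dim := dim) (c := c) hw s
    (fun r s' => SearchInv x L (fun m t => P m t ∨ ∃ i < r, R i m t) s') ?_ ?_
  · exact (h.setNat hc 0).congr rfl rfl rfl rfl rfl (by simp)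
  · intro i hi s' hf hci hI
    refine ((hbody i hi s' hf hci _ hI).setNat hc (i + 1)).congr rfl rfl rfl rfl rfl ?_
    rintro m t (h | ⟨i', hi', h⟩)
    · exact Or.inl (Or.inl h)
    · rcases Nat.lt_succ_iff_lt_or_eq.1 hi' with h' | rfl
      · exact Or.inl (Or.inr ⟨i', h', h⟩)
      · exact Or.inr h

theorem Fixed.scale {x : Fin n → EuclideanSpace ℝ (Fin d)} {st : State} (h : Fixed x st)
    (ha : st.nat 11 0 < n) (hb : st.nat 12 0 < n) :
    scale.eval st = scaleGuess x (st.nat 11 0) (st.nat 12 0) (st.nat 13 0) (st.nat 14 0) := by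
  simp only [Code.scale, RExp.eval, NExp.eval, h.dist _ ha _ hb, scaleGuess]

/-- Expanding the form at `x i - x j` gives the four Gram entries in `State.sqDist`. The numerical
part only provides a left inverse, which for square matrices is the inverse used in `cutoff`. -/
theorem spectralBlock_sqDist {x : Fin n → EuclideanSpace ℝ (Fin d)} {st : State}
    (h : Fixed x st) : ∀ i < n, ∀ j < n, (spectralBlock.den (dims n d) st).sqDist i j =
      cutoffSqDist x (scale.eval st) i j := by
  have hB : scatter x (Code.scale.eval st) = ((4 * st.nat 0 0 * Code.scale.eval st)⁻¹ : ℝ) •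
      ∑ i ∈ Finset.range n, vecMulVec (st.row d 0 i) (st.row d 0 i) := by
    simp only [scatter, h.points, h.card]
  have key : ∃ M : Matrix (Fin d) (Fin d) ℝ,
      M * (1 + scatter x (Code.scale.eval st) ^ d * (scatter x (Code.scale.eval st) ^ d)ᵀ) = 1 ∧
      ∀ i < n, ∀ j < n, (spectralBlock.den (dims n d) st).real 8 i j =
        st.row d 0 i ⬝ᵥ (1 - M) *ᵥ st.row d 0 j :=
    spectralBlock_spec (N := dims n d) st hB
  obtain ⟨M, hM, hY⟩ := key
  have hM' : 1 - M = cutoff x (Code.scale.eval st) := by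
    rw [cutoff, Matrix.inv_eq_left_inv hM]
  simp only [hM', h.points] at hY
  intro i hi j hj
  rw [State.sqDist, hY i hi i hi, hY j hj j hj, hY i hi j hj, hY j hj i hi, cutoffSqDist,
    mulVec_sub, sub_dotProduct, dotProduct_sub, dotProduct_sub]
  ring

/-- The record is replaced only by strictly more seeds. On a tie the old guess stays, and its size
is at most `m` by the bound in the invariant, since the sizes are tried in increasing order. -/
theorem guessBlock_spec {x : Fin n → EuclideanSpace ℝ (Fin d)} {P : ℕ → ℝ → Prop} {st : State}
    {m : ℕ} (h : SearchInv x m P st) (hm : st.nat 10 0 + 1 = m) (hmn : n ^ 4 ≤ m ^ 5)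
    (ha : st.nat 11 0 < n) (hb : st.nat 12 0 < n) :
    SearchInv x m (fun m' t => P m' t ∨ m' = m ∧
        t = scaleGuess x (st.nat 11 0) (st.nat 12 0) (st.nat 13 0) (st.nat 14 0))
      (guessBlock.den (dims n d) st) := by
  set s := scaleGuess x (st.nat 11 0) (st.nat 12 0) (st.nat 13 0) (st.nat 14 0) with hs
  have hscale : Code.scale.eval st = s := h.toFixed.scale ha hb
  simp only [guessBlock, den]
  set s₁ := spectralBlock.den (dims n d) st with h₁
  set s₂ := seedBlock.den (dims n d) s₁ with h₂
  have f₁ : spectralBlock.Frame st s₁ := frame_den _ _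
  have f₂ : seedBlock.Frame s₁ s₂ := frame_den _ _
  have hD : ∀ i < n, ∀ j < n, s₁.sqDist i j = cutoffSqDist x s i j := by
    rw [← hscale]; exact spectralBlock_sqDist h.toFixed
  have hscale₁ : Code.scale.eval s₁ = s := by
    rw [← hscale]
    simp [Code.scale, RExp.eval, NExp.eval, f₁.2 9 rfl, f₁.1 11 rfl, f₁.1 12 rfl, f₁.1 13 rfl,
      f₁.1 14 rfl]
  have h10 : s₁.nat 10 0 + 1 = m := by rw [f₁.1 10 rfl, hm]
  have hcard₁ : s₁.nat 0 0 = n := by rw [f₁.1 0 rfl, h.card]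
  have hratio : ratioExp.eval s₁ = (n : ℝ) / m := by
    simp only [ratioExp, RExp.eval, NExp.eval, hcard₁, h10]
  have hheavy : heavyExp.eval s₁ = heavyRadius n m s := by
    simp only [heavyExp, RExp.eval, hratio, hscale₁, heavyRadius, NExp.eval]
    push_cast; ring
  have hsep : sepExp.eval s₁ = sepRadius n m s := by
    simp only [sepExp, RExp.eval, hratio, hheavy, sepRadius, NExp.eval]
    push_cast; ring
  have hs0 : 0 ≤ s := scaleGuess_nonneg ..
  obtain ⟨hseed, hqn⟩ := seedBlock_spec (N := dims n d) s₁
    (by rw [hsep]; exact sepRadius_nonneg hs0)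
  rw [h10, hheavy, hsep, ← h₂] at hseed
  rw [← h₂] at hqn
  have hseed' : SeedsFor x m s (s₂.nat 5 0) (s₂.nat 4) := hseed.congr hD
  have h3 : s₂.nat 3 = st.nat 3 := by rw [f₂.1 3 rfl, f₁.1 3 rfl]
  have hinv₂ : SearchInv x m P s₂ := by
    refine h.congr ?_ ?_ ?_ ?_ ?_ fun _ _ h => h
    · rw [f₂.1 0 rfl, f₁.1 0 rfl]
    · rw [f₂.1 1 rfl, f₁.1 1 rfl]
    · rw [h3]
    · rw [f₂.2 0 rfl, f₁.2 0 rfl]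
    · rw [f₂.2 9 rfl, f₁.2 9 rfl]
  simp only [updateBlock, den]
  split_ifs with hlt
  · set s₃ := s₂.setNat 3 (NExp.eval s₂ (.const 0)) (NExp.eval s₂ (.var 5)) with h₃
    have hlt' : s₂.nat 3 0 < s₂.nat 5 0 := by
      simpa only [BExp.Holds, NExp.eval, Nat.succ_le_iff] using hlt
    have hn₃ : ∀ b, b ≠ 3 → s₃.nat b = s₂.nat b := by
      intro b hb; funext i; simp [h₃, State.setNat, hb]
    have h33 : s₃.nat 3 0 = s₂.nat 5 0 := by simp [h₃, State.setNat, NExp.eval]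
    set s₄ := labelBlock.den (dims n d) s₃ with h₄
    have f₄ : labelBlock.Frame s₃ s₄ := frame_den _ _
    have hlab := labelBlock_spec (N := dims n d) s₃ (by rw [hn₃ 5 (by norm_num)]; omega)
      (by rw [hn₃ 5 (by norm_num)]; exact hqn)
    have hD₃ : ∀ i < n, ∀ j < n, s₃.sqDist i j = cutoffSqDist x s i j := by
      intro i hi j hj
      rw [← hD i hi j hj]
      have : s₃.real = s₁.real := funext fun a => f₂.2 a rfl
      simp only [State.sqDist, this]
    rw [← h₄, hn₃ 5 (by norm_num), hn₃ 4 (by norm_num)] at hlab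
    have hk : s₄.nat 3 0 = s₂.nat 5 0 := by rw [f₄.1 3 rfl, h33]
    refine ⟨⟨?_, fun i => ?_, ?_⟩, m, le_rfl, Or.inr ⟨s, s₂.nat 4, hs0, hmn, ?_, ?_⟩, ?_⟩
    · rw [f₄.1 0 rfl, hn₃ 0 (by norm_num), hinv₂.card]
    · rw [← hinv₂.points i]; funext p
      simp only [State.row]; rw [f₄.2 0 rfl]; rfl
    · rw [f₄.2 9 rfl]; exact hinv₂.dist
    · rw [hk]; exact hseed'
    · rw [hk]
      intro i hi
      refine ⟨(hlab i hi).1, fun j hj => ?_⟩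
      rw [← hD₃ i hi _ (hseed'.lt j hj), ← hD₃ i hi _ (hseed'.lt _ (hlab i hi).1)]
      exact (hlab i hi).2 j hj
    · rw [hk]
      rintro m' t (hP | ⟨rfl, rfl⟩)
      -- An earlier guess has at most as many seeds as the old record, hence fewer than the new one;
      -- the tie clause is vacuous.
      · obtain ⟨m₀, -, -, hall⟩ := hinv₂.best
        obtain ⟨q, seed, h₁, h₂, -⟩ := hall m' t hP
        exact ⟨q, seed, h₁, by omega, fun h => by omega⟩
      · exact ⟨_, _, hseed', le_rfl, fun _ => le_rfl⟩
  · have hle : s₂.nat 5 0 ≤ s₂.nat 3 0 := by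
      simpa only [BExp.Holds, NExp.eval, Nat.succ_le_iff, not_lt] using hlt
    have hinv₃ : SearchInv x m (fun m' t => P m' t ∨ m' = m ∧ t = s) s₂ := by
      refine ⟨hinv₂.toFixed, ?_⟩
      obtain ⟨m₀, hm₀, hbest, hall⟩ := hinv₂.best
      refine ⟨m₀, hm₀, hbest, ?_⟩
      rintro m' t (hP | ⟨rfl, rfl⟩)
      · exact hall m' t hP
      · exact ⟨_, _, hseed', hle, fun _ => hm₀⟩
    exact hinv₃.setNat (by norm_num) 0

theorem scaleLoop_spec {x : Fin n → EuclideanSpace ℝ (Fin d)} {P : ℕ → ℝ → Prop} {st : State}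
    {m : ℕ} (h : SearchInv x m P st) (hm : st.nat 10 0 + 1 = m) (hmn : n ^ 4 ≤ m ^ 5) :
    SearchInv x m (fun m' t => P m' t ∨ ∃ a < n, ∃ b < n, ∃ i < n, ∃ j < d,
        m' = m ∧ t = scaleGuess x a b i j)
      (scaleLoop.den (dims n d) st) := by
  refine forTo_searchInv (dim := false) rfl (by norm_num) st _ P h ?_
  intro a ha s₁ f₁ c₁ P₁ h₁
  refine forTo_searchInv (dim := false) rfl (by norm_num) s₁ _ P₁ h₁ ?_
  intro b hb s₂ f₂ c₂ P₂ h₂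
  refine forTo_searchInv (dim := false) rfl (by norm_num) s₂ _ P₂ h₂ ?_
  intro i hi s₃ f₃ c₃ P₃ h₃
  refine forTo_searchInv (dim := true) rfl (by norm_num) s₃ _ P₃ h₃ ?_
  intro j hj s₄ f₄ c₄ P₄ h₄
  have e10 : s₄.nat 10 0 + 1 = m := by
    rw [f₄.1 10 rfl, f₃.1 10 rfl, f₂.1 10 rfl, f₁.1 10 rfl, hm]
  have e11 : s₄.nat 11 0 = a := by rw [f₄.1 11 rfl, f₃.1 11 rfl, f₂.1 11 rfl, c₁]
  have e12 : s₄.nat 12 0 = b := by rw [f₄.1 12 rfl, f₃.1 12 rfl, c₂]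
  have e13 : s₄.nat 13 0 = i := by rw [f₄.1 13 rfl, c₃]
  have := guessBlock_spec h₄ e10 hmn (by rw [e11]; exact ha) (by rw [e12]; exact hb)
  rwa [e11, e12, e13, c₄] at this

/-- The guesses that the algorithm treats. -/
def Treated (x : Fin n → EuclideanSpace ℝ (Fin d)) (m : ℕ) (t : ℝ) : Prop :=
  (1 ≤ m ∧ m ≤ n ∧ n ^ 4 ≤ m ^ 5) ∧
    ∃ a < n, ∃ b < n, ∃ i < n, ∃ j < d, t = scaleGuess x a b i j

/-- Pass `r` handles the size `r + 1`. After it the invariant covers all treated guesses of size at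
most `r + 1`; if the size test fails, there are no treated guesses of size exactly `r + 1`. -/
theorem searchLoop_spec {x : Fin n → EuclideanSpace ℝ (Fin d)} {st : State}
    (h : SearchInv x 0 (fun _ _ => False) st) :
    SearchInv x n (Treated x) (searchLoop.den (dims n d) st) := by
  refine forTo_induction (N := dims n d) (dim := false) (c := 10) rfl st
    (fun r s' => SearchInv x r (fun m t => m ≤ r ∧ Treated x m t) s') ?_ ?_ |>.congr
      rfl rfl rfl rfl rfl (fun m t h => ⟨h.1.2.1, h⟩)
  · refine (h.setNat (by norm_num) 0).congr rfl rfl rfl rfl rfl ?_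
    rintro m t ⟨hm, hT, -⟩
    omega
  · intro r hr s₁ f₁ c₁ hI
    have hI' : SearchInv x (r + 1) (fun m t => m ≤ r ∧ Treated x m t) s₁ := by
      refine ⟨hI.toFixed, ?_⟩
      obtain ⟨m, hm, h⟩ := hI.best
      exact ⟨m, by omega, h⟩
    -- The machine cannot multiply natural numbers, so the powers are formed and compared as reals.
    have htest : sizeTest.Holds s₁ ↔ n ^ 4 ≤ (r + 1) ^ 5 := by
      simp only [sizeTest, BExp.Holds, RExp.eval, NExp.eval, hI.card, c₁]
      rw [← Nat.cast_le (α := ℝ)]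
      push_cast
      ring_nf
    simp only [den]
    split_ifs with hb
    · refine ((scaleLoop_spec hI' (by rw [c₁]) (htest.1 hb)).setNat (by norm_num) (r + 1)).congr
        rfl rfl rfl rfl rfl ?_
      rintro m t ⟨hm, hT⟩
      by_cases hmr : m ≤ r
      · exact Or.inl ⟨hmr, hT⟩
      · obtain ⟨-, a, ha, b, hb, i, hi, j, hj, e⟩ := hT
        exact Or.inr ⟨a, ha, b, hb, i, hi, j, hj, by omega, e⟩
    · refine ((hI'.setNat (c := 9) (by norm_num) 0).setNat (c := 10) (by norm_num) (r + 1)).congr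
        rfl rfl rfl rfl rfl ?_
      rintro m t ⟨hm, hT⟩
      refine ⟨?_, hT⟩
      by_contra hmr
      have : m = r + 1 := by omega
      rw [htest, ← this] at hb
      exact hb hT.1.2.2

theorem clusterCode_spec (x : Fin n → EuclideanSpace ℝ (Fin d)) :
    SearchInv x n (Treated x)
      (clusterCode.den (dims n d) ((State.input x).setNat 2 0 d)) := by
  simp only [clusterCode, den]
  set s₀ := (State.input x).setNat 2 0 d with h₀
  have hrow : ∀ i, s₀.row d 0 i = coords x i := by
    intro i; funext p
    simp [h₀, State.row, coords, State.input, State.setNat]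
  apply searchLoop_spec
  refine ⟨⟨?_, ?_, ?_⟩, 0, le_rfl, Or.inl ?_, by simp⟩
  · rw [den_nat_frame _ _ _ rfl]; simp [h₀, State.setNat, State.input]
  · intro i
    rw [← hrow i]; funext p
    simp only [State.row]; rw [den_real_frame _ _ _ rfl]
  · intro a ha b hb
    rw [distBlock_spec (N := dims n d) s₀ a ha b hb, Finset.sum_range, ← hrow a, ← hrow b]
    rfl
  · rw [den_nat_frame _ _ _ rfl]; simp [h₀, State.setNat, State.input]

end Code

/-- The clustering algorithm. -/
def clusterProg : Prog :=
  .seq (.setNat 2 (.const 0) (.var 1)) (.seq Code.clusterCode.compile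
    (.setNat 0 (.const 0) (.var 3)))

/-- The algorithm halts in polynomial time with the clustering of a guess that has the most
clusters and, among these, the least size. -/
theorem clusterProg_spec {n d : ℕ} (x : Fin n → EuclideanSpace ℝ (Fin d)) :
    ∃ (s : State) (t : ℕ), clusterProg.Runs (State.input x) s t ∧
      t ≤ (Code.clusterCode.cost + 2).eval (n + d) ∧
      ∃ m : ℕ, (s.nat 0 0 = 0 ∨ ∃ r seed, 0 ≤ r ∧ n ^ 4 ≤ m ^ 5 ∧
          SeedsFor x m r (s.nat 0 0) seed ∧ NearestLabels x r (s.nat 0 0) seed (s.nat 1)) ∧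
        ∀ m' r', Code.Treated x m' r' → ∃ q seed, SeedsFor x m' r' q seed ∧ q ≤ s.nat 0 0 ∧
          (q = s.nat 0 0 → m ≤ m') := by
  set s₀ := (State.input x).setNat 2 0 d with h₀
  obtain ⟨t, hrun, ht⟩ := Code.runs_compile (N := Code.dims n d) Code.clusterCode rfl rfl rfl
    (L := n + d) (by intro b; cases b <;> simp [Code.dims]) s₀
    (by intro b; cases b <;> simp [dimArray, Code.dims, h₀, State.setNat, State.input])
  obtain ⟨m, -, h₁, h₂⟩ := (Code.clusterCode_spec x).best
  set s₁ := Code.clusterCode.den (Code.dims n d) s₀ with hs₁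
  -- The dimension `d` moves to array `2`, since array `1` will receive the labels.
  have hfirst : Prog.Runs (.setNat 2 (.const 0) (.var 1)) (State.input x) s₀ 1 := by
    have := Prog.Runs.setNat 2 (.const 0) (.var 1) (State.input x)
    simpa [NExp.eval, State.input, h₀] using this
  refine ⟨_, 1 + (t + 1), .seq hfirst (.seq hrun (.setNat _ _ _ _)), ?_, m, ?_⟩
  · simp only [Polynomial.eval_add, Polynomial.eval_ofNat]
    omega
  · have e0 : (s₁.setNat 0 (NExp.eval s₁ (.const 0)) (NExp.eval s₁ (.var 3))).nat 0 0 =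
        s₁.nat 3 0 := by simp [State.setNat, NExp.eval]
    have e1 : (s₁.setNat 0 (NExp.eval s₁ (.const 0)) (NExp.eval s₁ (.var 3))).nat 1 =
        s₁.nat 1 := by funext i; simp [State.setNat]
    rw [e0, e1]
    exact ⟨h₁, h₂⟩

end RealRAM

/-! ### Directional deviations and the NTSC condition. -/

open scoped RealInnerProductSpace

namespace Clustering

variable {n d k : ℕ}

/-- The sum of the squared deviations from the mean in the direction `a`. -/
noncomputable def deviation (x : Fin n → EuclideanSpace ℝ (Fin d)) (a : EuclideanSpace ℝ (Fin d))
    (S : Finset (Fin n)) : ℝ :=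
  ∑ i ∈ S, ⟪a, x i - mean x S⟫ ^ 2

theorem deviation_nonneg (x : Fin n → EuclideanSpace ℝ (Fin d)) (a : EuclideanSpace ℝ (Fin d))
    (S : Finset (Fin n)) : 0 ≤ deviation x a S :=
  Finset.sum_nonneg fun _ _ => sq_nonneg _

theorem sum_inner_sub_mean (x : Fin n → EuclideanSpace ℝ (Fin d)) (a : EuclideanSpace ℝ (Fin d))
    (S : Finset (Fin n)) : ∑ i ∈ S, ⟪a, x i - mean x S⟫ = 0 := by
  rcases S.eq_empty_or_nonempty with rfl | hS
  · simp
  have hc : (S.card : ℝ) ≠ 0 := by exact_mod_cast hS.card_pos.ne'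
  rw [← inner_sum, Finset.sum_sub_distrib, Finset.sum_const, mean, ← Nat.cast_smul_eq_nsmul ℝ,
    smul_smul, mul_inv_cancel₀ hc, one_smul, sub_self, inner_zero_right]

/-- The Steiner identity: deviations from an arbitrary point. -/
theorem sum_inner_sub_sq (x : Fin n → EuclideanSpace ℝ (Fin d)) (a p : EuclideanSpace ℝ (Fin d))
    (S : Finset (Fin n)) :
    ∑ i ∈ S, ⟪a, x i - p⟫ ^ 2 = deviation x a S + S.card * ⟪a, mean x S - p⟫ ^ 2 := by
  have h : ∀ i ∈ S, ⟪a, x i - p⟫ ^ 2 = ⟪a, x i - mean x S⟫ ^ 2 +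
      2 * ⟪a, mean x S - p⟫ * ⟪a, x i - mean x S⟫ + ⟪a, mean x S - p⟫ ^ 2 := by
    intro i _
    have : x i - p = (x i - mean x S) + (mean x S - p) := by abel
    rw [this, inner_add_right]; ring
  rw [Finset.sum_congr rfl h, Finset.sum_add_distrib, Finset.sum_add_distrib, ← Finset.mul_sum,
    sum_inner_sub_mean, Finset.sum_const, nsmul_eq_mul, deviation]
  ring

theorem deviation_le (x : Fin n → EuclideanSpace ℝ (Fin d)) (a p : EuclideanSpace ℝ (Fin d))
    (S : Finset (Fin n)) : deviation x a S ≤ ∑ i ∈ S, ⟪a, x i - p⟫ ^ 2 := by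
  rw [sum_inner_sub_sq]
  have : 0 ≤ (S.card : ℝ) * ⟪a, mean x S - p⟫ ^ 2 := by positivity
  linarith

theorem deviation_le_norm (x : Fin n → EuclideanSpace ℝ (Fin d)) (S : Finset (Fin n))
    (p v : EuclideanSpace ℝ (Fin d)) (hv : ‖v‖ = 1) :
    deviation x v S ≤ ∑ i ∈ S, ‖x i - p‖ ^ 2 := by
  refine (deviation_le x v p S).trans (Finset.sum_le_sum fun i _ => ?_)
  have := abs_real_inner_le_norm v (x i - p)
  rw [hv, one_mul] at this
  exact sq_le_sq' (by linarith [neg_abs_le ⟪v, x i - p⟫]) ((le_abs_self _).trans this)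

/-- Without boundedness the real supremum in `sigma` would take the default value `0` and bound
nothing. -/
theorem bddAbove_sigma (x : Fin n → EuclideanSpace ℝ (Fin d)) (S : Finset (Fin n)) :
    BddAbove (Set.range fun v : Metric.sphere (0 : EuclideanSpace ℝ (Fin d)) 1 =>
      Real.sqrt ((∑ i ∈ S, ⟪(v : EuclideanSpace ℝ (Fin d)), x i - mean x S⟫ ^ 2) / S.card)) := by
  refine ⟨Real.sqrt ((∑ i ∈ S, ‖x i - mean x S‖ ^ 2) / S.card), ?_⟩
  rintro _ ⟨v, rfl⟩
  have hv : ‖(v : EuclideanSpace ℝ (Fin d))‖ = 1 := by simp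
  exact Real.sqrt_le_sqrt (div_le_div_of_nonneg_right (deviation_le_norm x S _ v hv) (by positivity))

theorem sigma_nonneg (x : Fin n → EuclideanSpace ℝ (Fin d)) (S : Finset (Fin n)) :
    0 ≤ sigma x S := Real.iSup_nonneg fun _ => Real.sqrt_nonneg _

theorem deviation_le_sigma (x : Fin n → EuclideanSpace ℝ (Fin d)) (S : Finset (Fin n))
    (v : EuclideanSpace ℝ (Fin d)) (hv : ‖v‖ = 1) :
    deviation x v S ≤ S.card * sigma x S ^ 2 := by
  rcases S.eq_empty_or_nonempty with rfl | hS
  · simp [deviation]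
  have hc : (0 : ℝ) < S.card := by exact_mod_cast hS.card_pos
  have h := le_ciSup (bddAbove_sigma x S) ⟨v, by simpa using hv⟩
  have h2 : Real.sqrt (deviation x v S / S.card) ≤ sigma x S := h
  have h3 := (Real.sqrt_le_left (sigma_nonneg x S)).1 h2
  rw [div_le_iff₀ hc] at h3
  linarith

theorem sigma_sq_le (x : Fin n → EuclideanSpace ℝ (Fin d)) (S : Finset (Fin n))
    (p : EuclideanSpace ℝ (Fin d)) :
    sigma x S ^ 2 ≤ (∑ i ∈ S, ‖x i - p‖ ^ 2) / S.card := by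
  have h0 : 0 ≤ (∑ i ∈ S, ‖x i - p‖ ^ 2) / S.card := by positivity
  rw [← Real.sq_sqrt h0]
  refine pow_le_pow_left₀ (sigma_nonneg x S) (Real.iSup_le (fun v => ?_) (Real.sqrt_nonneg _)) 2
  have hv : ‖(v : EuclideanSpace ℝ (Fin d))‖ = 1 := by simp
  exact Real.sqrt_le_sqrt
    (div_le_div_of_nonneg_right (deviation_le_norm x S p v hv) (by positivity))

theorem mean_map (x : Fin n → EuclideanSpace ℝ (Fin d)) (S : Finset (Fin n))
    (P : EuclideanSpace ℝ (Fin d) →L[ℝ] EuclideanSpace ℝ (Fin d)) :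
    mean (fun i => P (x i)) S = P (mean x S) := by
  simp [mean, map_smul, map_sum]

/-- The standard deviation of the projection to a line. -/
theorem sigma_span_sq (x : Fin n → EuclideanSpace ℝ (Fin d)) (S : Finset (Fin n))
    {a : EuclideanSpace ℝ (Fin d)} (ha : a ≠ 0) :
    sigma (fun i => (ℝ ∙ a).starProjection (x i)) S ^ 2 =
      deviation x a S / S.card / ‖a‖ ^ 2 := by
  have hna : 0 < ‖a‖ := norm_pos_iff.2 ha
  have hP : ∀ i, (ℝ ∙ a).starProjection (x i) -
      mean (fun i => (ℝ ∙ a).starProjection (x i)) S =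
      (⟪a, x i - mean x S⟫ / ‖a‖ ^ 2) • a := by
    intro i
    rw [mean_map, ← map_sub, Submodule.starProjection_singleton]
    rfl
  have hterm : ∀ v : EuclideanSpace ℝ (Fin d), ∑ i ∈ S,
      ⟪v, (ℝ ∙ a).starProjection (x i) - mean (fun i => (ℝ ∙ a).starProjection (x i)) S⟫ ^ 2 =
      (⟪v, a⟫ / ‖a‖) ^ 2 * (deviation x a S / ‖a‖ ^ 2) := by
    intro v
    simp only [hP, inner_smul_right, deviation]
    rw [Finset.sum_div, Finset.mul_sum]
    refine Finset.sum_congr rfl fun i _ => ?_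
    field_simp
  have hdev := deviation_nonneg x a S
  have hval : sigma (fun i => (ℝ ∙ a).starProjection (x i)) S =
      Real.sqrt (deviation x a S / ‖a‖ ^ 2 / S.card) := by
    refine le_antisymm (Real.iSup_le (fun v => ?_) (Real.sqrt_nonneg _)) ?_
    · have hv : ‖(v : EuclideanSpace ℝ (Fin d))‖ = 1 := by simp
      rw [hterm]
      refine Real.sqrt_le_sqrt (div_le_div_of_nonneg_right ?_ (by positivity))
      refine mul_le_of_le_one_left (by positivity) ?_
      have := abs_real_inner_le_norm (v : EuclideanSpace ℝ (Fin d)) a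
      rw [hv, one_mul] at this
      rw [sq_le_one_iff_abs_le_one, abs_div, abs_norm]
      exact div_le_one_of_le₀ this (norm_nonneg _)
    · have hmem : ‖a‖⁻¹ • a ∈ Metric.sphere (0 : EuclideanSpace ℝ (Fin d)) 1 := by
        simp [norm_smul, hna.ne']
      refine le_trans (le_of_eq ?_)
        (le_ciSup (bddAbove_sigma (fun i => (ℝ ∙ a).starProjection (x i)) S) ⟨_, hmem⟩)
      simp only
      rw [hterm, real_inner_smul_left, real_inner_self_eq_norm_sq]
      congr 2
      field_simp
  rw [hval, Real.sq_sqrt (by positivity)]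
  ring

/-- NTSC on the line spanned by `a`, with variances turned into sums of squares: the two averages
contribute one more factor `T.card` and `(C l).card`, hence the cubes. -/
theorem NTSC.deviation_le {x : Fin n → EuclideanSpace ℝ (Fin d)} {C : Fin k → Finset (Fin n)}
    (h : NTSC x C) {l : Fin k} {T : Finset (Fin n)} (hT : T ⊆ C l)
    (hcard : Real.sqrt n * Real.log n / 100 ≤ T.card) (hpos : 0 < T.card)
    (a : EuclideanSpace ℝ (Fin d)) :
    (T.card : ℝ) ^ 3 * deviation x a (C l) ≤ 125 * ((C l).card : ℝ) ^ 3 * deviation x a T := by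
  rcases eq_or_ne a 0 with rfl | ha
  · simp [deviation]
  have hT0 : (0 : ℝ) < T.card := by exact_mod_cast hpos
  have hC0 : (0 : ℝ) < (C l).card := by
    exact_mod_cast hpos.trans_le (Finset.card_le_card hT)
  have hna : 0 < ‖a‖ := norm_pos_iff.2 ha
  have h1 := h l T hT hcard (ℝ ∙ a) (finrank_span_singleton ha)
  rw [sigma_span_sq x _ ha, sigma_span_sq x _ ha] at h1
  rw [div_div, div_div, div_mul_div_comm, div_le_div_iff₀ (by positivity) (by positivity)] at h1
  have h2 : (‖a‖ ^ 2) * (T.card * deviation x a (C l) * T.card * T.card) ≤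
      (‖a‖ ^ 2) * (125 * ((C l).card : ℝ) ^ 3 * deviation x a T) := by
    nlinarith [h1]
  have h3 := le_of_mul_le_mul_left h2 (by positivity)
  nlinarith [h3]

end Clustering

/-! ### Separated seeds under NTSC. -/

namespace Clustering

variable {n d k : ℕ} {V : Type*} [NormedAddCommGroup V] [InnerProductSpace ℝ V]

/-- From `m ≥ n ^ (4 / 5)` follows `m ^ 2 / n ≥ n ^ (3 / 5)`, and `log n ≤ 10 n ^ (1 / 10)`. So the
parts of size `m ^ 2 / n = n / u ^ 2` found by pigeonhole are large enough for NTSC. -/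
theorem sqrt_mul_log_le {m : ℕ} (hn : 0 < n) (hm : n ^ 4 ≤ m ^ 5) :
    Real.sqrt n * Real.log n / 100 ≤ (m : ℝ) ^ 2 / n := by
  have hn0 : (0 : ℝ) < n := by exact_mod_cast hn
  have hn1 : (1 : ℝ) ≤ n := by exact_mod_cast hn
  have h1 : (n : ℝ) ^ (4 / 5 : ℝ) ≤ m := by
    have h5 : ((n : ℝ) ^ (4 / 5 : ℝ)) ^ 5 ≤ (m : ℝ) ^ 5 := by
      rw [← Real.rpow_natCast, ← Real.rpow_mul hn0.le]
      norm_num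
      exact_mod_cast hm
    exact le_of_pow_le_pow_left₀ (by norm_num) (by positivity) h5
  have h2 : (n : ℝ) ^ (3 / 5 : ℝ) ≤ (m : ℝ) ^ 2 / n := by
    rw [le_div_iff₀ hn0]
    calc (n : ℝ) ^ (3 / 5 : ℝ) * n = ((n : ℝ) ^ (4 / 5 : ℝ)) ^ 2 := by
          rw [← Real.rpow_natCast, ← Real.rpow_mul hn0.le, ← Real.rpow_add_one hn0.ne']
          norm_num
      _ ≤ (m : ℝ) ^ 2 := pow_le_pow_left₀ (by positivity) h1 2
  have h3 : Real.log n ≤ (n : ℝ) ^ (1 / 10 : ℝ) / (1 / 10) :=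
    Real.log_le_rpow_div hn0.le (by norm_num)
  have h4 : Real.sqrt n * (n : ℝ) ^ (1 / 10 : ℝ) = (n : ℝ) ^ (3 / 5 : ℝ) := by
    rw [Real.sqrt_eq_rpow, ← Real.rpow_add hn0]
    norm_num
  have h5 := mul_le_mul_of_nonneg_left h3 (Real.sqrt_nonneg n)
  have h6 : 0 < (n : ℝ) ^ (3 / 5 : ℝ) := by positivity
  have h7 : Real.sqrt n * ((n : ℝ) ^ (1 / 10 : ℝ) / (1 / 10)) = 10 * (n : ℝ) ^ (3 / 5 : ℝ) := by
    rw [← h4]; ring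
  linarith

/-- If a large part of a cluster lies near the point `p` in the seminorm `‖Φ ·‖`, then the whole
cluster is concentrated near `p` in every direction that is bounded by this seminorm. -/
theorem NTSC.concentrated {x : Fin n → EuclideanSpace ℝ (Fin d)} {C : Fin k → Finset (Fin n)}
    (h : NTSC x C) {l : Fin k} {T : Finset (Fin n)} (hT : T ⊆ C l)
    {m : ℕ} (hn : 0 < n) (hm0 : 0 < m) (hm : n ^ 4 ≤ m ^ 5) {u : ℝ} (hu : u = n / m) (hu1 : 1 ≤ u)
    (hcard : (n : ℝ) ≤ T.card * u ^ 2) (Φ : EuclideanSpace ℝ (Fin d) →ₗ[ℝ] V) {r D : ℝ}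
    (hr : 0 ≤ r) (hD : 0 ≤ D) {a p : EuclideanSpace ℝ (Fin d)}
    (ha : ∀ y, |⟪a, y⟫| ≤ D * ‖Φ y‖) (hnear : ∀ i ∈ T, ‖Φ (x i - p)‖ ≤ r) :
    deviation x a (C l) ≤ 125 * u ^ 4 * (D * r) ^ 2 * n ∧
      |⟪a, p - mean x (C l)⟫| ≤ 13 * u ^ 3 * (D * r) := by
  have hn0 : (0 : ℝ) < n := by exact_mod_cast hn
  have hm0' : (0 : ℝ) < m := by exact_mod_cast hm0
  have hT0 : (0 : ℝ) < T.card := by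
    by_contra hcon
    have : (T.card : ℝ) = 0 := le_antisymm (not_lt.1 hcon) (by positivity)
    rw [this] at hcard; linarith
  have hTpos : 0 < T.card := by exact_mod_cast hT0
  have hthr : Real.sqrt n * Real.log n / 100 ≤ T.card := by
    refine (sqrt_mul_log_le hn hm).trans ?_
    rw [div_le_iff₀ hn0]
    have : (T.card : ℝ) * u ^ 2 * m ^ 2 = T.card * n ^ 2 := by
      rw [hu]; field_simp
    have h2 : (n : ℝ) * m ^ 2 ≤ T.card * n ^ 2 := by
      rw [← this]; exact mul_le_mul_of_nonneg_right hcard (by positivity)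
    have h3 : (n : ℝ) * (m : ℝ) ^ 2 ≤ n * (T.card * n) := by nlinarith
    exact le_of_mul_le_mul_left h3 hn0
  have hdev := h.deviation_le hT hthr hTpos a
  have hDr : 0 ≤ D * r := by positivity
  have hTdev : deviation x a T ≤ T.card * (D * r) ^ 2 := by
    refine (Clustering.deviation_le x a p T).trans ?_
    rw [← nsmul_eq_mul]
    refine Finset.sum_le_card_nsmul _ _ _ fun i hi => ?_
    have h1 : |⟪a, x i - p⟫| ≤ D * r :=
      (ha _).trans (mul_le_mul_of_nonneg_left (hnear i hi) hD)
    rw [← sq_abs]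
    exact pow_le_pow_left₀ (abs_nonneg _) h1 2
  have hCn : ((C l).card : ℝ) ≤ n := by
    exact_mod_cast (Finset.card_le_univ (C l)).trans_eq (by simp)
  have hCu : ((C l).card : ℝ) ≤ T.card * u ^ 2 := hCn.trans hcard
  -- The loss in NTSC is `125 (|C l| / |T|)²`, and `|C l| / |T| ≤ u²`.
  have hCdev : deviation x a (C l) ≤ 125 * u ^ 4 * (D * r) ^ 2 * n := by
    have h1 : (T.card : ℝ) ^ 3 * deviation x a (C l) ≤
        (T.card : ℝ) ^ 3 * (125 * u ^ 4 * (D * r) ^ 2 * n) := by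
      calc (T.card : ℝ) ^ 3 * deviation x a (C l)
          ≤ 125 * ((C l).card : ℝ) ^ 3 * deviation x a T := hdev
        _ ≤ 125 * ((C l).card : ℝ) ^ 3 * (T.card * (D * r) ^ 2) := by gcongr
        _ = 125 * (((C l).card : ℝ) ^ 2 * (C l).card) * (T.card * (D * r) ^ 2) := by ring
        _ ≤ 125 * ((T.card * u ^ 2) ^ 2 * n) * (T.card * (D * r) ^ 2) := by gcongr
        _ = (T.card : ℝ) ^ 3 * (125 * u ^ 4 * (D * r) ^ 2 * n) := by ring
    exact le_of_mul_le_mul_left h1 (by positivity)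
  refine ⟨hCdev, ?_⟩
  -- By averaging over `T`, some point of `T` is close to the mean of the whole cluster in the
  -- direction `a`. It is also close to `p`, so it links the two; `√125 ≤ 12`, plus `1` for the link
  -- to `p`, gives the constant `13`.
  obtain ⟨i, hi, hle⟩ : ∃ i ∈ T, ⟪a, x i - mean x (C l)⟫ ^ 2 ≤ 125 * u ^ 6 * (D * r) ^ 2 := by
    by_contra hcon
    push Not at hcon
    have h1 : T.card * (125 * u ^ 6 * (D * r) ^ 2) < ∑ i ∈ T, ⟪a, x i - mean x (C l)⟫ ^ 2 := by
      rw [← nsmul_eq_mul, ← Finset.sum_const]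
      exact Finset.sum_lt_sum_of_nonempty (Finset.card_pos.1 hTpos) hcon
    have h2 : ∑ i ∈ T, ⟪a, x i - mean x (C l)⟫ ^ 2 ≤ deviation x a (C l) :=
      Finset.sum_le_sum_of_subset_of_nonneg hT fun _ _ _ => sq_nonneg _
    have h3 : 125 * u ^ 4 * (D * r) ^ 2 * n ≤ T.card * (125 * u ^ 6 * (D * r) ^ 2) := by
      calc 125 * u ^ 4 * (D * r) ^ 2 * n ≤ 125 * u ^ 4 * (D * r) ^ 2 * (T.card * u ^ 2) := by
            gcongr
        _ = T.card * (125 * u ^ 6 * (D * r) ^ 2) := by ring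
    linarith
  have h1 : |⟪a, x i - mean x (C l)⟫| ≤ 12 * u ^ 3 * (D * r) := by
    refine abs_le_of_sq_le_sq ?_ (by positivity)
    refine hle.trans ?_
    have : 0 ≤ u ^ 6 * (D * r) ^ 2 := by positivity
    nlinarith
  have h2 : |⟪a, x i - p⟫| ≤ D * r := (ha _).trans (mul_le_mul_of_nonneg_left (hnear i hi) hD)
  have h3 : p - mean x (C l) = (x i - mean x (C l)) - (x i - p) := by abel
  rw [h3, inner_sub_right]
  have h4 : D * r ≤ u ^ 3 * (D * r) := le_mul_of_one_le_left hDr (one_le_pow₀ hu1)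
  have h5 := abs_sub ⟪a, x i - mean x (C l)⟫ ⟪a, x i - p⟫
  linarith

/-- A direction that measures the distance of two points in the seminorm `‖Φ ·‖`. -/
theorem exists_direction (Φ : EuclideanSpace ℝ (Fin d) →ₗ[ℝ] V) (p : EuclideanSpace ℝ (Fin d)) :
    ∃ a : EuclideanSpace ℝ (Fin d), ∀ y, ⟪a, y⟫ = ⟪Φ p, Φ y⟫ := by
  -- The vector `a` is the Riesz representative of `y ↦ ⟪Φ p, Φ y⟫`. By Cauchy–Schwarz it is bounded
  -- by the seminorm as `NTSC.concentrated` requires, with `D = ‖Φ p‖`.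
  let f : EuclideanSpace ℝ (Fin d) →ₗ[ℝ] ℝ := (innerₛₗ ℝ (Φ p)).comp Φ
  refine ⟨(InnerProductSpace.toDual ℝ _).symm (LinearMap.toContinuousLinearMap f), fun y => ?_⟩
  rw [InnerProductSpace.toDual_symm_apply]
  rfl

/-- Seeds in the seminorm `‖Φ ·‖`: their balls of radius `r` have at least `m` points each, and they
are far apart from each other. -/
structure IsSeparated (x : Fin n → EuclideanSpace ℝ (Fin d))
    (Φ : EuclideanSpace ℝ (Fin d) →ₗ[ℝ] V) (m : ℕ) (u r : ℝ) {q : ℕ} (c : Fin q → Fin n) :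
    Prop where
  heavy : ∀ j, m ≤ (Finset.univ.filter fun i => ‖Φ (x i - x (c j))‖ ≤ r).card
  sep : ∀ j j', j ≠ j' → 200 * u ^ 4 * r < ‖Φ (x (c j) - x (c j'))‖

namespace IsSeparated

variable {x : Fin n → EuclideanSpace ℝ (Fin d)} {C : Fin k → Finset (Fin n)}
  {Φ : EuclideanSpace ℝ (Fin d) →ₗ[ℝ] V} {m : ℕ} {u r : ℝ} {q : ℕ} {c : Fin q → Fin n}

/-- The balls of radius `r` around the seeds are disjoint, because a common point would put two
seeds within `2 r`. -/
theorem mul_card_le (h : IsSeparated x Φ m u r c) (hr : 0 ≤ r) (hu1 : 1 ≤ u) : q * m ≤ n := by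
  have hdisj : ((Finset.univ : Finset (Fin q)) : Set (Fin q)).PairwiseDisjoint
      fun j => Finset.univ.filter fun i => ‖Φ (x i - x (c j))‖ ≤ r := by
    intro j _ j' _ hne
    refine Finset.disjoint_left.2 fun i hi hi' => ?_
    simp only [Finset.mem_filter, Finset.mem_univ, true_and] at hi hi'
    have h1 := h.sep j j' hne
    have h2 : x (c j) - x (c j') = (x i - x (c j')) - (x i - x (c j)) := by abel
    rw [h2, map_sub] at h1
    have h3 := norm_sub_le (Φ (x i - x (c j'))) (Φ (x i - x (c j)))
    have h4 : r ≤ u ^ 4 * r := le_mul_of_one_le_left hr (one_le_pow₀ hu1)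
    nlinarith
  calc q * m = ∑ _j : Fin q, m := by simp
    _ ≤ ∑ j : Fin q, (Finset.univ.filter fun i => ‖Φ (x i - x (c j))‖ ≤ r).card :=
        Finset.sum_le_sum fun j _ => h.heavy j
    _ = (Finset.univ.biUnion fun j : Fin q =>
        Finset.univ.filter fun i => ‖Φ (x i - x (c j))‖ ≤ r).card :=
        (Finset.card_biUnion hdisj).symm
    _ ≤ n := (Finset.card_le_univ _).trans_eq (by simp)

/-- If there are at least as many seeds as clusters, then each seed has a large part of a cluster
in its ball. -/
theorem exists_cluster (h : IsSeparated x Φ m u r c) (hC : IsPartition C) (hr : 0 ≤ r)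
    (hn : 0 < n) (hm0 : 0 < m) (hu : u = n / m) (hu1 : 1 ≤ u) (hkq : k ≤ q) (j : Fin q) :
    ∃ l, (n : ℝ) ≤ ((C l).filter fun i => ‖Φ (x i - x (c j))‖ ≤ r).card * u ^ 2 := by
  by_contra hcon
  push Not at hcon
  have hn0 : (0 : ℝ) < n := by exact_mod_cast hn
  have hm0' : (0 : ℝ) < m := by exact_mod_cast hm0
  have hqm : (q : ℝ) * m ≤ n := by exact_mod_cast h.mul_card_le hr hu1
  have hcover : (Finset.univ.filter fun i => ‖Φ (x i - x (c j))‖ ≤ r) ⊆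
      Finset.univ.biUnion fun l => (C l).filter fun i => ‖Φ (x i - x (c j))‖ ≤ r := by
    intro i hi
    obtain ⟨l, hl, -⟩ := hC i
    simp only [Finset.mem_filter, Finset.mem_univ, true_and] at hi
    exact Finset.mem_biUnion.2 ⟨l, Finset.mem_univ _, Finset.mem_filter.2 ⟨hl, hi⟩⟩
  have h1 : (m : ℝ) ≤ ∑ l : Fin k,
      (((C l).filter fun i => ‖Φ (x i - x (c j))‖ ≤ r).card : ℝ) := by
    exact_mod_cast (h.heavy j).trans ((Finset.card_le_card hcover).trans Finset.card_biUnion_le)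
  have hk : 0 < k := by
    obtain ⟨l, -⟩ := hC ⟨0, hn⟩
    exact l.pos
  have hne : (Finset.univ : Finset (Fin k)).Nonempty := ⟨⟨0, hk⟩, Finset.mem_univ _⟩
  -- Pigeonhole: if every cluster had fewer than `n / u²` points in the ball, then `m u² < k n`. But
  -- `m u² = u n`, and `k ≤ q ≤ u` since the balls are disjoint.
  have h2 : (m : ℝ) * u ^ 2 < k * n := by
    calc (m : ℝ) * u ^ 2 ≤ (∑ l : Fin k,
          (((C l).filter fun i => ‖Φ (x i - x (c j))‖ ≤ r).card : ℝ)) * u ^ 2 := by gcongr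
      _ = ∑ l : Fin k,
          (((C l).filter fun i => ‖Φ (x i - x (c j))‖ ≤ r).card : ℝ) * u ^ 2 := Finset.sum_mul ..
      _ < ∑ _l : Fin k, (n : ℝ) := Finset.sum_lt_sum_of_nonempty hne fun l _ => hcon l
      _ = k * n := by simp
  have h3 : (m : ℝ) * u ^ 2 = n / m * n := by rw [hu]; field_simp
  have h4 : (k : ℝ) ≤ n / m := by
    rw [le_div_iff₀ hm0']
    have : (k : ℝ) ≤ q := by exact_mod_cast hkq
    nlinarith
  nlinarith

/-- The largest parts at different seeds belong to different clusters. -/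
theorem cluster_injective (h : IsSeparated x Φ m u r c) (hN : NTSC x C) (hr : 0 ≤ r)
    (hn : 0 < n) (hm0 : 0 < m) (hm : n ^ 4 ≤ m ^ 5) (hu : u = n / m) (hu1 : 1 ≤ u)
    {l : Fin q → Fin k}
    (hl : ∀ j, (n : ℝ) ≤ ((C (l j)).filter fun i => ‖Φ (x i - x (c j))‖ ≤ r).card * u ^ 2) :
    Function.Injective l := by
  intro j j' hjj
  by_contra hne
  obtain ⟨a, ha⟩ := exists_direction Φ (x (c j) - x (c j'))
  set D := ‖Φ (x (c j) - x (c j'))‖ with hD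
  have hsep := h.sep j j' hne
  rw [← hD] at hsep
  have haD : ∀ y, |⟪a, y⟫| ≤ D * ‖Φ y‖ := fun y => by rw [ha]; exact abs_real_inner_le_norm _ _
  have h1 := (hN.concentrated (Finset.filter_subset _ _) hn hm0 hm hu hu1 (hl j) Φ hr
    (norm_nonneg _) haD (p := x (c j)) fun i hi => (Finset.mem_filter.1 hi).2).2
  have h2 := (hN.concentrated (Finset.filter_subset _ _) hn hm0 hm hu hu1 (hl j') Φ hr
    (norm_nonneg _) haD (p := x (c j')) fun i hi => (Finset.mem_filter.1 hi).2).2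
  rw [← hjj] at h2
  -- In the direction `a` the two seeds differ by `D²`, yet both would be within `13 u³ D r` of the
  -- mean of the same cluster. This forces `D ≤ 26 u³ r`, against the separation.
  have h3 : D ^ 2 = ⟪a, x (c j) - mean x (C (l j))⟫ - ⟪a, x (c j') - mean x (C (l j))⟫ := by
    rw [← inner_sub_right, sub_sub_sub_cancel_right, ha, real_inner_self_eq_norm_sq]
  have h4 : D ^ 2 ≤ 26 * u ^ 3 * (D * r) := by
    rw [h3]
    linarith [abs_le.1 h1, abs_le.1 h2]
  have hr4 : 0 ≤ u ^ 4 * r := by positivity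
  have hD0 : 0 < D := by nlinarith
  have h5 : D ≤ 26 * u ^ 3 * r := by
    refine le_of_mul_le_mul_left (a := D) ?_ hD0
    calc D * D = D ^ 2 := by ring
      _ ≤ _ := h4
      _ = _ := by ring
  have h6 : u ^ 3 * r ≤ u ^ 4 * r :=
    mul_le_mul_of_nonneg_right (pow_le_pow_right₀ hu1 (by norm_num)) hr
  nlinarith

/-- More than `k` seeds would make `exists_cluster` applicable and give an injection into the `k`
clusters. Neither the weight nor the separation of the clusters enters, so this holds for bad
guesses too. -/
theorem card_le (h : IsSeparated x Φ m u r c) (hC : IsPartition C) (hN : NTSC x C) (hr : 0 ≤ r)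
    (hn : 0 < n) (hm0 : 0 < m) (hm : n ^ 4 ≤ m ^ 5) (hu : u = n / m) (hu1 : 1 ≤ u) : q ≤ k := by
  by_contra hcon
  choose l hl using h.exists_cluster hC hr hn hm0 hu hu1 (not_le.1 hcon).le
  have := Fintype.card_le_of_injective l (h.cluster_injective hN hr hn hm0 hm hu hu1 hl)
  simp at this
  omega

/-- Few points of a cluster are nearer to a seed other than its own. -/
theorem card_misplaced_le (h : IsSeparated x Φ m u r c) (hN : NTSC x C) (hr : 0 ≤ r)
    (hn : 0 < n) (hm0 : 0 < m) (hm : n ^ 4 ≤ m ^ 5) (hu : u = n / m) (hu1 : 1 ≤ u)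
    {l : Fin k} {j j' : Fin q} (hne : j ≠ j')
    (hl : (n : ℝ) ≤ ((C l).filter fun i => ‖Φ (x i - x (c j))‖ ≤ r).card * u ^ 2)
    {B : Finset (Fin n)} (hB : B ⊆ C l)
    (hnear : ∀ i ∈ B, ‖Φ (x i - x (c j'))‖ ≤ ‖Φ (x i - x (c j))‖) :
    (B.card : ℝ) * (20 * u ^ 4) ≤ n := by
  obtain ⟨a, ha⟩ := exists_direction Φ (x (c j) - x (c j'))
  set D := ‖Φ (x (c j) - x (c j'))‖ with hD
  have hsep := h.sep j j' hne
  rw [← hD] at hsep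
  have haD : ∀ y, |⟪a, y⟫| ≤ D * ‖Φ y‖ := fun y => by rw [ha]; exact abs_real_inner_le_norm _ _
  obtain ⟨h1, h2⟩ := hN.concentrated (Finset.filter_subset _ _) hn hm0 hm hu hu1 hl Φ hr
    (norm_nonneg _) haD (p := x (c j)) fun i hi => (Finset.mem_filter.1 hi).2
  have hr4 : 0 ≤ u ^ 4 * r := by positivity
  have hD0 : 0 < D := by nlinarith
  have hr3 : u ^ 3 * r ≤ u ^ 4 * r :=
    mul_le_mul_of_nonneg_right (pow_le_pow_right₀ hu1 (by norm_num)) hr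
  -- Being nearer to the wrong seed means `⟪a, x i - x (c j)⟫ ≤ -D² / 2`. The mean is within `D² /
  -- 4` of `x (c j)` in this direction, so a deviation of at least `D² / 4` from the mean remains.
  have hfar : ∀ i ∈ B, D ^ 4 / 16 ≤ ⟪a, x i - mean x (C l)⟫ ^ 2 := by
    intro i hi
    have h3 := hnear i hi
    have h4 : x i - x (c j') = (x i - x (c j)) + (x (c j) - x (c j')) := by abel
    have h5 : ‖Φ (x i - x (c j'))‖ ^ 2 = ‖Φ (x i - x (c j))‖ ^ 2 + 2 * ⟪a, x i - x (c j)⟫ +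
        D ^ 2 := by
      rw [h4, map_add, norm_add_sq_real, ha, real_inner_comm, hD]
    have h6 : ‖Φ (x i - x (c j'))‖ ^ 2 ≤ ‖Φ (x i - x (c j))‖ ^ 2 :=
      pow_le_pow_left₀ (norm_nonneg _) h3 2
    have h7 : ⟪a, x i - mean x (C l)⟫ = ⟪a, x i - x (c j)⟫ + ⟪a, x (c j) - mean x (C l)⟫ := by
      rw [← inner_add_right]; congr 1; abel
    have h8 : 13 * u ^ 3 * (D * r) ≤ D ^ 2 / 4 := by
      have : 52 * (u ^ 3 * r) ≤ D := by nlinarith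
      nlinarith
    have h9 : ⟪a, x i - mean x (C l)⟫ ≤ -(D ^ 2 / 4) := by
      rw [h7]; linarith [(abs_le.1 h2).2]
    nlinarith [sq_nonneg D]
  have hsum : (B.card : ℝ) * (D ^ 4 / 16) ≤ 125 * u ^ 4 * (D * r) ^ 2 * n := by
    refine le_trans ?_ h1
    rw [← nsmul_eq_mul]
    exact (Finset.card_nsmul_le_sum B _ _ hfar).trans
      (Finset.sum_le_sum_of_subset_of_nonneg hB fun _ _ _ => sq_nonneg _)
  -- Chebyshev leaves `|B| ≤ 2000 u⁴ r² n / D²`; the separation constant `200` turns this into `n /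
  -- (20 u⁴)`.
  have hDr : (200 * u ^ 4 * r) ^ 2 ≤ D ^ 2 := pow_le_pow_left₀ (by positivity) hsep.le 2
  have hfin : D ^ 4 * u ^ 4 * ((B.card : ℝ) * (20 * u ^ 4)) ≤ D ^ 4 * u ^ 4 * n := by
    calc D ^ 4 * u ^ 4 * ((B.card : ℝ) * (20 * u ^ 4))
        = 320 * u ^ 8 * (B.card * (D ^ 4 / 16)) := by ring
      _ ≤ 320 * u ^ 8 * (125 * u ^ 4 * (D * r) ^ 2 * n) := by gcongr
      _ = (200 * u ^ 4 * r) ^ 2 * (u ^ 4 * D ^ 2 * n) := by ring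
      _ ≤ D ^ 2 * (u ^ 4 * D ^ 2 * n) := by gcongr
      _ = D ^ 4 * u ^ 4 * n := by ring
  exact le_of_mul_le_mul_left hfin (by positivity)

/-- If there are at least as many seeds as clusters, then the nearest seeds give the clusters, up to
few points. -/
theorem approxClustering (h : IsSeparated x Φ m u r c) (hC : IsPartition C) (hN : NTSC x C)
    (hr : 0 ≤ r) (hn : 0 < n) (hm0 : 0 < m) (hm : n ^ 4 ≤ m ^ 5) (hu : u = n / m) (hu1 : 1 ≤ u)
    (hkq : k = q) {w₀ : ℝ} (hw : (m : ℝ) ≤ w₀ * n) {lab : Fin n → ℕ} (hlab : ∀ i, lab i < q)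
    (hnear : ∀ i j, ‖Φ (x i - x (c ⟨lab i, hlab i⟩))‖ ≤ ‖Φ (x i - x (c j))‖) :
    ApproxClustering w₀ C lab := by
  subst hkq
  refine ⟨hlab, ?_⟩
  choose l hl using h.exists_cluster hC hr hn hm0 hu hu1 le_rfl
  have hinj := h.cluster_injective hN hr hn hm0 hm hu hu1 hl
  let e : Equiv.Perm (Fin k) := Equiv.ofBijective l (Finite.injective_iff_bijective.1 hinj)
  have hle : ∀ j, l j = e j := fun _ => rfl
  refine ⟨e.symm, fun l₀ => ?_⟩
  let B : Fin k → Fin k → Finset (Fin n) := fun l j => (C l).filter fun i => lab i = j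
  have hB : ∀ l j, e.symm l ≠ j → ((B l j).card : ℝ) * (20 * u ^ 4) ≤ n := by
    intro l' j hne
    refine h.card_misplaced_le hN hr hn hm0 hm hu hu1 hne (l := l') ?_
      (Finset.filter_subset _ _) fun i hi => ?_
    · have := hl (e.symm l')
      rwa [hle, Equiv.apply_symm_apply] at this
    · have h1 : (⟨lab i, hlab i⟩ : Fin k) = j := Fin.ext (Finset.mem_filter.1 hi).2
      have := hnear i (e.symm l')
      rwa [h1] at this
  -- A wrong point is either in `C l₀` with a foreign label, or in a foreign cluster with the label
  -- of `l₀`. There are at most `2k` such classes, each with at most `n / (20 u⁴)` points.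
  have hsub : symmDiff (Finset.univ.filter fun i => lab i = (e.symm l₀ : ℕ)) (C l₀) ⊆
      ((Finset.univ.filter fun j => e.symm l₀ ≠ j).biUnion fun j => B l₀ j) ∪
      ((Finset.univ.filter fun l => l ≠ l₀).biUnion fun l => B l (e.symm l₀)) := by
    intro i hi
    rw [Finset.mem_symmDiff] at hi
    rcases hi with ⟨h1, h2⟩ | ⟨h1, h2⟩
    · obtain ⟨l', hl', -⟩ := hC i
      refine Finset.mem_union_right _ (Finset.mem_biUnion.2 ⟨l', ?_, ?_⟩)
      · simp only [Finset.mem_filter, Finset.mem_univ, true_and]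
        rintro rfl; exact h2 hl'
      · exact Finset.mem_filter.2 ⟨hl', (Finset.mem_filter.1 h1).2⟩
    · refine Finset.mem_union_left _ (Finset.mem_biUnion.2 ⟨⟨lab i, hlab i⟩, ?_, ?_⟩)
      · simp only [Finset.mem_filter, Finset.mem_univ, true_and] at h2 ⊢
        intro h3; exact h2 (by rw [h3])
      · exact Finset.mem_filter.2 ⟨h1, rfl⟩
  have hn0 : (0 : ℝ) < n := by exact_mod_cast hn
  have hm0' : (0 : ℝ) < m := by exact_mod_cast hm0
  have hu0 : 0 < u := by linarith
  have hB' : ∀ l j, e.symm l ≠ j → ((B l j).card : ℝ) ≤ n / (20 * u ^ 4) := fun l j hne => by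
    rw [le_div_iff₀ (by positivity)]; exact hB l j hne
  have hbound : ∀ (s : Finset (Fin k)) (f : Fin k → Finset (Fin n)),
      (∀ j ∈ s, ((f j).card : ℝ) ≤ n / (20 * u ^ 4)) →
      ((s.biUnion f).card : ℝ) ≤ k * (n / (20 * u ^ 4)) := by
    intro s f hf
    calc ((s.biUnion f).card : ℝ) ≤ ∑ j ∈ s, ((f j).card : ℝ) := by
          exact_mod_cast Finset.card_biUnion_le
      _ ≤ s.card * (n / (20 * u ^ 4)) := by
          rw [← nsmul_eq_mul]; exact Finset.sum_le_card_nsmul _ _ _ hf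
      _ ≤ k * (n / (20 * u ^ 4)) := by
          have : (s.card : ℝ) ≤ k := by
            exact_mod_cast (Finset.card_le_univ s).trans_eq (by simp)
          gcongr
  have h1 := hbound (Finset.univ.filter fun j => e.symm l₀ ≠ j) (fun j => B l₀ j) fun j hj =>
    hB' l₀ j (by simpa using hj)
  have h2 := hbound (Finset.univ.filter fun l => l ≠ l₀) (fun l => B l (e.symm l₀)) fun l hl =>
    hB' l _ (by simpa using hl)
  have h3 : ((symmDiff (Finset.univ.filter fun i => lab i = (e.symm l₀ : ℕ)) (C l₀)).card : ℝ) ≤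
      k * (n / (20 * u ^ 4)) + k * (n / (20 * u ^ 4)) := by
    refine le_trans ?_ (add_le_add h1 h2)
    exact_mod_cast (Finset.card_le_card hsub).trans (Finset.card_union_le _ _)
  refine h3.trans ?_
  have hku : (k : ℝ) ≤ u := by
    rw [hu, le_div_iff₀ hm0']
    exact_mod_cast h.mul_card_le hr hu1
  have hw0 : 1 / u ≤ w₀ := by
    rw [hu, one_div_div, div_le_iff₀ hn0]; exact hw
  calc k * (n / (20 * u ^ 4)) + k * (n / (20 * u ^ 4)) = k * (n / (10 * u ^ 4)) := by
        field_simp; ring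
    _ ≤ u * (n / (10 * u ^ 4)) := by gcongr
    _ = n / (10 * u ^ 3) := by field_simp
    _ ≤ n / (10 * u ^ 2) := by gcongr; norm_num
    _ = (1 / u) ^ 2 * n / 10 := by field_simp
    _ ≤ w₀ ^ 2 * n / 10 := by gcongr

end IsSeparated

end Clustering

/-! ### The rational spectral cutoff. -/

/-- A quadratic form in an orthonormal basis of eigenvectors. -/
theorem Matrix.dotProduct_mulVec_eq_sum {d : ℕ} {Q : Matrix (Fin d) (Fin d) ℝ} (hQ : Qᵀ = Q)
    (b : OrthonormalBasis (Fin d) ℝ (EuclideanSpace ℝ (Fin d))) (c : Fin d → ℝ)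
    (h : ∀ e, Q *ᵥ (b e).ofLp = c e • (b e).ofLp) (v : EuclideanSpace ℝ (Fin d)) :
    v.ofLp ⬝ᵥ Q *ᵥ v.ofLp = ∑ e, c e * ⟪b e, v⟫ ^ 2 := by
  have hinner : ∀ y z : EuclideanSpace ℝ (Fin d), ⟪y, z⟫ = y.ofLp ⬝ᵥ z.ofLp := by
    intro y z
    rw [EuclideanSpace.inner_eq_star_dotProduct, dotProduct_comm]
    rfl
  have h1 : v.ofLp ⬝ᵥ Q *ᵥ v.ofLp = ⟪v, WithLp.toLp 2 (Q *ᵥ v.ofLp)⟫ :=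
    (hinner v (WithLp.toLp 2 (Q *ᵥ v.ofLp))).symm
  rw [h1, ← b.sum_inner_mul_inner]
  refine Finset.sum_congr rfl fun e _ => ?_
  have h2 : ⟪b e, WithLp.toLp 2 (Q *ᵥ v.ofLp)⟫ = c e * ⟪b e, v⟫ := by
    rw [hinner, hinner, dotProduct_mulVec, ← mulVec_transpose, hQ, h e, smul_dotProduct,
      smul_eq_mul]
  rw [h2, real_inner_comm]
  ring

namespace Clustering

variable {n d k : ℕ}

theorem coords_fin (x : Fin n → EuclideanSpace ℝ (Fin d)) (i : Fin n) :
    coords x i = (x i).ofLp := by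
  funext p; simp [coords]

/-- The weight of an eigenvector with eigenvalue `β` in `cutoff`. -/
noncomputable def cutoffWeight (d : ℕ) (β : ℝ) : ℝ := (β ^ d) ^ 2 / (1 + (β ^ d) ^ 2)

theorem cutoffWeight_nonneg (β : ℝ) : 0 ≤ cutoffWeight d β := by
  unfold cutoffWeight; positivity

theorem scatter_dotProduct (x : Fin n → EuclideanSpace ℝ (Fin d)) (s : ℝ)
    (v : EuclideanSpace ℝ (Fin d)) :
    v.ofLp ⬝ᵥ scatter x s *ᵥ v.ofLp = (4 * n * s)⁻¹ * ∑ i, ⟪v, x i⟫ ^ 2 := by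
  rw [scatter, smul_mulVec, dotProduct_smul, smul_eq_mul, Finset.sum_range, Matrix.sum_mulVec,
    dotProduct_sum]
  congr 1
  refine Finset.sum_congr rfl fun i _ => ?_
  rw [coords_fin, vecMulVec_mulVec, dotProduct_smul, EuclideanSpace.inner_eq_star_dotProduct]
  simp only [star_trivial, MulOpposite.smul_eq_mul_unop, MulOpposite.unop_op]
  rw [dotProduct_comm v.ofLp]
  ring

/-- The cutoff is a rational function of the symmetric scatter matrix, so one eigenbasis
diagonalizes both: the eigenvalue `β` becomes `1 - 1 / (1 + β ^ (2d))`. -/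
theorem exists_eigenbasis (x : Fin n → EuclideanSpace ℝ (Fin d)) (s : ℝ) :
    ∃ (b : OrthonormalBasis (Fin d) ℝ (EuclideanSpace ℝ (Fin d))) (β : Fin d → ℝ),
      (∀ v, (4 * n * s)⁻¹ * ∑ i, ⟪v, x i⟫ ^ 2 = ∑ e, β e * ⟪b e, v⟫ ^ 2) ∧
      ∀ v : EuclideanSpace ℝ (Fin d), v.ofLp ⬝ᵥ cutoff x s *ᵥ v.ofLp =
        ∑ e, cutoffWeight d (β e) * ⟪b e, v⟫ ^ 2 := by
  have hsymm : (scatter x s)ᵀ = scatter x s := by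
    ext p q
    simp [scatter, Matrix.sum_apply, vecMulVec_apply, mul_comm]
  have hA : (scatter x s).IsHermitian := by
    rw [Matrix.IsHermitian, conjTranspose_eq_transpose_of_trivial, hsymm]
  set G := scatter x s ^ d with hG
  have hGt : Gᵀ = G := by rw [hG, transpose_pow, hsymm]
  refine ⟨hA.eigenvectorBasis, hA.eigenvalues, fun v => ?_, fun v => ?_⟩
  · rw [← scatter_dotProduct]
    exact dotProduct_mulVec_eq_sum hsymm _ _ hA.mulVec_eigenvectorBasis v
  · have hpow : ∀ (r : ℕ) e, scatter x s ^ r *ᵥ (hA.eigenvectorBasis e).ofLp =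
        hA.eigenvalues e ^ r • (hA.eigenvectorBasis e).ofLp := by
      intro r e
      induction r with
      | zero => simp
      | succ r ih =>
        rw [pow_succ, ← mulVec_mulVec, hA.mulVec_eigenvectorBasis, mulVec_smul, ih, smul_smul,
          pow_succ']
    set A := 1 + G * Gᵀ with hAdef
    have hAe : ∀ e, A *ᵥ (hA.eigenvectorBasis e).ofLp =
        (1 + (hA.eigenvalues e ^ d) ^ 2) • (hA.eigenvectorBasis e).ofLp := by
      intro e
      rw [hAdef, hGt, add_mulVec, one_mulVec, ← mulVec_mulVec, hpow, mulVec_smul, hpow, smul_smul,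
        add_smul, one_smul, sq]
    have hAt : Aᵀ = A := by
      rw [hAdef, transpose_add, transpose_one, transpose_mul, transpose_transpose]
    have hpos : A.PosDef := by
      have : G * Gᵀ = G * Gᴴ := by rw [conjTranspose_eq_transpose_of_trivial]
      rw [hAdef, this]
      exact Matrix.PosDef.one.add_posSemidef (posSemidef_self_mul_conjTranspose G)
    have hunit : IsUnit A.det := (Matrix.isUnit_iff_isUnit_det _).1 hpos.isUnit
    refine dotProduct_mulVec_eq_sum ?_ _ _ (fun e => ?_) v
    · rw [cutoff, transpose_sub, transpose_one, transpose_nonsing_inv, ← hAdef, hAt]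
    · have hne : 1 + (hA.eigenvalues e ^ d) ^ 2 ≠ 0 := by positivity
      have h1 : A⁻¹ *ᵥ (hA.eigenvectorBasis e).ofLp =
          (1 + (hA.eigenvalues e ^ d) ^ 2)⁻¹ • (hA.eigenvectorBasis e).ofLp := by
        have h2 := congrArg (fun y => A⁻¹ *ᵥ y) (hAe e)
        simp only [mulVec_mulVec, nonsing_inv_mul A hunit, one_mulVec, mulVec_smul] at h2
        conv_rhs => rw [h2]
        rw [smul_smul, inv_mul_cancel₀ hne, one_smul]
      rw [cutoff, ← hAdef, sub_mulVec, one_mulVec, h1]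
      nth_rw 1 [← one_smul ℝ (hA.eigenvectorBasis e).ofLp]
      rw [← sub_smul, cutoffWeight]
      congr 1
      field_simp
      ring

/-- A linear map whose norm is given by weights on an orthonormal basis. -/
noncomputable def weightedMap (b : OrthonormalBasis (Fin d) ℝ (EuclideanSpace ℝ (Fin d)))
    (f : Fin d → ℝ) : EuclideanSpace ℝ (Fin d) →ₗ[ℝ] EuclideanSpace ℝ (Fin d) where
  toFun v := WithLp.toLp 2 fun e => Real.sqrt (f e) * ⟪b e, v⟫
  map_add' v w := by ext e; simp [inner_add_right, mul_add]
  map_smul' t v := by ext e; simp [inner_smul_right, mul_left_comm]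

theorem norm_weightedMap_sq (b : OrthonormalBasis (Fin d) ℝ (EuclideanSpace ℝ (Fin d)))
    {f : Fin d → ℝ} (hf : ∀ e, 0 ≤ f e) (v : EuclideanSpace ℝ (Fin d)) :
    ‖weightedMap b f v‖ ^ 2 = ∑ e, f e * ⟪b e, v⟫ ^ 2 := by
  rw [EuclideanSpace.norm_sq_eq]
  refine Finset.sum_congr rfl fun e _ => ?_
  simp only [weightedMap, LinearMap.coe_mk, AddHom.coe_mk, Real.norm_eq_abs, sq_abs, mul_pow,
    Real.sq_sqrt (hf e)]

theorem cutoffSqDist_eq {x : Fin n → EuclideanSpace ℝ (Fin d)} {s : ℝ}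
    {b : OrthonormalBasis (Fin d) ℝ (EuclideanSpace ℝ (Fin d))} {β : Fin d → ℝ}
    (h : ∀ v : EuclideanSpace ℝ (Fin d), v.ofLp ⬝ᵥ cutoff x s *ᵥ v.ofLp =
        ∑ e, cutoffWeight d (β e) * ⟪b e, v⟫ ^ 2) (i j : Fin n) :
    cutoffSqDist x s i j = ‖weightedMap b (fun e => cutoffWeight d (β e)) (x i - x j)‖ ^ 2 := by
  rw [norm_weightedMap_sq b (fun e => cutoffWeight_nonneg _), ← h, cutoffSqDist, coords_fin,
    coords_fin]
  rfl

theorem sum_partition {C : Fin k → Finset (Fin n)} (hC : IsPartition C) (f : Fin n → ℝ) :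
    ∑ l, ∑ i ∈ C l, f i = ∑ i, f i := by
  have hdisj : ((Finset.univ : Finset (Fin k)) : Set (Fin k)).PairwiseDisjoint C := by
    intro l _ l' _ hne
    refine Finset.disjoint_left.2 fun i hi hi' => hne ?_
    exact (hC i).unique hi hi'
  rw [← Finset.sum_biUnion hdisj]
  congr 1
  ext i
  obtain ⟨l, hl, -⟩ := hC i
  simpa using ⟨l, hl⟩

theorem sum_card {C : Fin k → Finset (Fin n)} (hC : IsPartition C) :
    ∑ l, ((C l).card : ℝ) = n := by
  simpa using sum_partition hC fun _ => 1

section Spectral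

variable {x : Fin n → EuclideanSpace ℝ (Fin d)} {s : ℝ} {C : Fin k → Finset (Fin n)}
  {b : OrthonormalBasis (Fin d) ℝ (EuclideanSpace ℝ (Fin d))} {β : Fin d → ℝ}

/-- In the order of quadratic forms, `|S|` times the square of the mean of `S` is below the sum of
the squares of all points. This is that inequality at the vector whose coordinates are those of the
mean times `g`. -/
theorem card_mul_weighted_sq_le (hn : 0 < n) (hs : 0 < s)
    (hβ : ∀ v, (4 * n * s)⁻¹ * ∑ i, ⟪v, x i⟫ ^ 2 = ∑ e, β e * ⟪b e, v⟫ ^ 2)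
    (S : Finset (Fin n)) (g : Fin d → ℝ) :
    (S.card : ℝ) * (∑ e, g e * ⟪b e, mean x S⟫ ^ 2) ^ 2 ≤
      4 * n * s * ∑ e, β e * (g e * ⟪b e, mean x S⟫) ^ 2 := by
  have hn0 : (0 : ℝ) < n := by exact_mod_cast hn
  set z : EuclideanSpace ℝ (Fin d) := ∑ e, (g e * ⟪b e, mean x S⟫) • b e with hz
  have hbz : ∀ e, ⟪b e, z⟫ = g e * ⟪b e, mean x S⟫ := by
    intro e
    rw [hz, b.orthonormal.inner_right_sum _ (Finset.mem_univ e)]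
  have hzm : ⟪z, mean x S⟫ = ∑ e, g e * ⟪b e, mean x S⟫ ^ 2 := by
    rw [← b.sum_inner_mul_inner]
    refine Finset.sum_congr rfl fun e _ => ?_
    rw [real_inner_comm, hbz]; ring
  have h1 := hβ z
  have h2 : ∑ i, ⟪z, x i⟫ ^ 2 = 4 * n * s * ∑ e, β e * ⟪b e, z⟫ ^ 2 := by
    rw [← h1, mul_inv_cancel_left₀ (by positivity)]
  simp only [hbz] at h2
  rw [← h2, ← hzm]
  have h3 := sum_inner_sub_sq x z 0 S
  simp only [sub_zero] at h3
  have h4 : ∑ i ∈ S, ⟪z, x i⟫ ^ 2 ≤ ∑ i, ⟪z, x i⟫ ^ 2 :=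
    Finset.sum_le_sum_of_subset_of_nonneg (Finset.subset_univ _) fun _ _ _ => sq_nonneg _
  linarith [deviation_nonneg x z S]

theorem eigenvalue_eq (hn : 0 < n) (hs : 0 < s)
    (hβ : ∀ v, (4 * n * s)⁻¹ * ∑ i, ⟪v, x i⟫ ^ 2 = ∑ e, β e * ⟪b e, v⟫ ^ 2) (e : Fin d) :
    4 * n * s * β e = ∑ i, ⟪b e, x i⟫ ^ 2 := by
  have hn0 : (0 : ℝ) < n := by exact_mod_cast hn
  have h := hβ (b e)
  have h2 : ∑ e', β e' * ⟪b e', b e⟫ ^ 2 = β e := by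
    rw [Finset.sum_eq_single e]
    · simp
    · intro e' _ hne
      simp [b.orthonormal.2 hne]
    · simp
  rw [h2] at h
  rw [← h, mul_inv_cancel_left₀ (by positivity)]

theorem eigenvalue_nonneg (hn : 0 < n) (hs : 0 < s)
    (hβ : ∀ v, (4 * n * s)⁻¹ * ∑ i, ⟪v, x i⟫ ^ 2 = ∑ e, β e * ⟪b e, v⟫ ^ 2) (e : Fin d) :
    0 ≤ β e := by
  have hn0 : (0 : ℝ) < n := by exact_mod_cast hn
  have h := eigenvalue_eq hn hs hβ e
  have : 0 ≤ 4 * n * s * β e := by rw [h]; positivity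
  exact nonneg_of_mul_nonneg_right this (by positivity)

theorem sum_deviation_le (hC : IsPartition C) {σ : ℝ}
    (hσ : ∀ l, sigma x (C l) ≤ σ) (e : Fin d) : ∑ l, deviation x (b e) (C l) ≤ n * σ ^ 2 := by
  rw [← sum_card hC, Finset.sum_mul]
  refine Finset.sum_le_sum fun l _ => ?_
  refine (deviation_le_sigma x (C l) (b e) (b.orthonormal.1 e)).trans ?_
  have := pow_le_pow_left₀ (sigma_nonneg x (C l)) (hσ l) 2
  gcongr

/-- The number of large eigenvalues is at most twice the number of clusters. -/
theorem card_large_eigenvalues_le (hn : 0 < n) (hs : 0 < s) (hC : IsPartition C) {σ : ℝ}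
    (hσ : ∀ l, sigma x (C l) ≤ σ) (hσs : σ ^ 2 ≤ s)
    (hβ : ∀ v, (4 * n * s)⁻¹ * ∑ i, ⟪v, x i⟫ ^ 2 = ∑ e, β e * ⟪b e, v⟫ ^ 2) :
    ((Finset.univ.filter fun e => 1 / 2 < β e).card : ℝ) ≤ 2 * k := by
  have hn0 : (0 : ℝ) < n := by exact_mod_cast hn
  set Λ : ℝ := 4 * n * s with hΛ
  have hΛ0 : 0 < Λ := by positivity
  set L := Finset.univ.filter fun e => 1 / 2 < β e with hL
  -- Double counting over eigenvectors and clusters. The scatter along `b e` exceeds `Λ / 2`, and at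
  -- most `Λ / 4` of it lies within the clusters, so the cluster means account for at least half.
  have hterm : ∀ e ∈ L, 1 / 2 ≤ ∑ l, (C l).card * ⟪b e, mean x (C l)⟫ ^ 2 / (Λ * β e) := by
    intro e he
    have hβe : 1 / 2 < β e := (Finset.mem_filter.1 he).2
    have h1 := eigenvalue_eq hn hs hβ e
    have h2 : ∑ i, ⟪b e, x i⟫ ^ 2 = ∑ l, deviation x (b e) (C l) +
        ∑ l, (C l).card * ⟪b e, mean x (C l)⟫ ^ 2 := by
      rw [← sum_partition hC, ← Finset.sum_add_distrib]
      refine Finset.sum_congr rfl fun l _ => ?_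
      simpa using sum_inner_sub_sq x (b e) 0 (C l)
    have h3 := sum_deviation_le (b := b) hC hσ e
    rw [← Finset.sum_div, le_div_iff₀ (by positivity)]
    have h4 : (n : ℝ) * σ ^ 2 ≤ n * s := by gcongr
    have h5 : Λ / 4 = n * s := by rw [hΛ]; ring
    have h6 : Λ * (1 / 2) ≤ Λ * β e := by gcongr
    linarith
  -- One mean contributes at most `1` in total: take `g = 1 / β` on `L`, for which both sums in
  -- `card_mul_weighted_sq_le` become the same `S`.
  have hcol : ∀ l, ∑ e ∈ L, (C l).card * ⟪b e, mean x (C l)⟫ ^ 2 / (Λ * β e) ≤ 1 := by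
    intro l
    have h1 := card_mul_weighted_sq_le hn hs hβ (C l) fun e => if 1 / 2 < β e then (β e)⁻¹ else 0
    set S := ∑ e ∈ L, ⟪b e, mean x (C l)⟫ ^ 2 / β e with hS
    have e1 : ∑ e, (if 1 / 2 < β e then (β e)⁻¹ else 0) * ⟪b e, mean x (C l)⟫ ^ 2 = S := by
      rw [hS, hL, Finset.sum_filter]
      refine Finset.sum_congr rfl fun e _ => ?_
      split_ifs <;> ring
    have e2 : ∑ e, β e * ((if 1 / 2 < β e then (β e)⁻¹ else 0) * ⟪b e, mean x (C l)⟫) ^ 2 = S := by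
      rw [hS, hL, Finset.sum_filter]
      refine Finset.sum_congr rfl fun e _ => ?_
      split_ifs with h
      · have : β e ≠ 0 := by linarith
        field_simp
      · ring
    rw [e1, e2, ← hΛ] at h1
    have hS0 : 0 ≤ S := Finset.sum_nonneg fun e he => by
      have : 1 / 2 < β e := (Finset.mem_filter.1 he).2
      positivity
    have h2 : ∑ e ∈ L, (C l).card * ⟪b e, mean x (C l)⟫ ^ 2 / (Λ * β e) =
        (C l).card * S / Λ := by
      rw [hS, Finset.mul_sum, Finset.sum_div]
      refine Finset.sum_congr rfl fun e _ => ?_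
      ring
    rw [h2, div_le_one hΛ0]
    rcases hS0.eq_or_lt with h0 | h0
    · rw [← h0]; simpa using hΛ0.le
    · refine le_of_mul_le_mul_right (a := S) ?_ h0
      calc (C l).card * S * S = (C l).card * S ^ 2 := by ring
        _ ≤ Λ * S := h1
  have h1 : (L.card : ℝ) * (1 / 2) ≤ ∑ e ∈ L, ∑ l,
      (C l).card * ⟪b e, mean x (C l)⟫ ^ 2 / (Λ * β e) := by
    rw [← nsmul_eq_mul]
    exact Finset.card_nsmul_le_sum _ _ _ hterm
  rw [Finset.sum_comm] at h1
  have h2 : ∑ l, ∑ e ∈ L, (C l).card * ⟪b e, mean x (C l)⟫ ^ 2 / (Λ * β e) ≤ ∑ _l : Fin k, (1 : ℝ) :=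
    Finset.sum_le_sum fun l _ => hcol l
  simp only [Finset.sum_const, Finset.card_univ, Fintype.card_fin, nsmul_eq_mul, mul_one] at h2
  linarith

theorem cutoffWeight_le_one (β : ℝ) : cutoffWeight d β ≤ 1 := by
  unfold cutoffWeight
  rw [div_le_one (by positivity)]
  linarith

/-- This is the reason for the power `d`: the at most `d` small eigenvalues have total weight at
most `d / 4 ^ d ≤ 1`. Eigenvalues between `1 / 2` and `1` need no estimate beyond weight at most
`1`, as they are counted among the large ones. -/
theorem cutoffWeight_le {β : ℝ} (h0 : 0 ≤ β) (h : β ≤ 1 / 2) :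
    cutoffWeight d β ≤ ((1 / 2 : ℝ) ^ d) ^ 2 := by
  have h1 : (β ^ d) ^ 2 ≤ ((1 / 2 : ℝ) ^ d) ^ 2 := by gcongr
  refine le_trans ?_ h1
  unfold cutoffWeight
  refine div_le_self (by positivity) ?_
  have : 0 ≤ (β ^ d) ^ 2 := by positivity
  linarith

theorem half_le_cutoffWeight {β : ℝ} (h : 1 ≤ β) : 1 / 2 ≤ cutoffWeight d β := by
  have h1 : 1 ≤ (β ^ d) ^ 2 := one_le_pow₀ (one_le_pow₀ h)
  unfold cutoffWeight
  rw [div_le_div_iff₀ (by norm_num) (by positivity)]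
  linarith

/-- The points are on average near the means of their clusters. -/
theorem sum_norm_weightedMap_le (hn : 0 < n) (hs : 0 < s) (hC : IsPartition C) {σ : ℝ}
    (hσ : ∀ l, sigma x (C l) ≤ σ) (hσs : σ ^ 2 ≤ s)
    (hβ : ∀ v, (4 * n * s)⁻¹ * ∑ i, ⟪v, x i⟫ ^ 2 = ∑ e, β e * ⟪b e, v⟫ ^ 2) :
    ∑ l, ∑ i ∈ C l, ‖weightedMap b (fun e => cutoffWeight d (β e)) (x i - mean x (C l))‖ ^ 2 ≤
      (2 * k + 1) * (n * σ ^ 2) := by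
  have h1 : ∑ l, ∑ i ∈ C l,
      ‖weightedMap b (fun e => cutoffWeight d (β e)) (x i - mean x (C l))‖ ^ 2 =
      ∑ e, cutoffWeight d (β e) * ∑ l, deviation x (b e) (C l) := by
    simp only [norm_weightedMap_sq b (fun e => cutoffWeight_nonneg (β e)), deviation,
      Finset.mul_sum]
    conv_rhs => rw [Finset.sum_comm]
    refine Finset.sum_congr rfl fun l _ => ?_
    rw [Finset.sum_comm]
  have h2 : ∑ e, cutoffWeight d (β e) ≤ 2 * k + 1 := by
    have h3 := card_large_eigenvalues_le hn hs hC hσ hσs hβ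
    rw [← Finset.sum_filter_add_sum_filter_not Finset.univ fun e => 1 / 2 < β e]
    refine add_le_add ?_ ?_
    · refine le_trans ?_ h3
      have := Finset.sum_le_card_nsmul (Finset.univ.filter fun e => 1 / 2 < β e)
        (fun e => cutoffWeight d (β e)) 1 fun e _ => cutoffWeight_le_one _
      simpa using this
    · have h4 := Finset.sum_le_card_nsmul (Finset.univ.filter fun e => ¬ 1 / 2 < β e)
        (fun e => cutoffWeight d (β e)) (((1 / 2 : ℝ) ^ d) ^ 2) fun e he =>
        cutoffWeight_le (eigenvalue_nonneg hn hs hβ e) (not_lt.1 (Finset.mem_filter.1 he).2)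
      refine h4.trans ?_
      rw [nsmul_eq_mul]
      have h5 : ((Finset.univ.filter fun e => ¬ 1 / 2 < β e).card : ℝ) ≤ d := by
        exact_mod_cast (Finset.card_le_univ _).trans_eq (by simp)
      have h6 : (d : ℝ) ≤ 2 ^ d := by exact_mod_cast Nat.lt_two_pow_self.le
      have h7 : (0 : ℝ) ≤ (1 / 2 : ℝ) ^ d := by positivity
      have h8 : (1 / 2 : ℝ) ^ d ≤ 1 := pow_le_one₀ (by norm_num) (by norm_num)
      have h9 : (2 : ℝ) ^ d * (1 / 2 : ℝ) ^ d = 1 := by rw [← mul_pow]; norm_num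
      calc ((Finset.univ.filter fun e => ¬ 1 / 2 < β e).card : ℝ) * ((1 / 2 : ℝ) ^ d) ^ 2
          ≤ 2 ^ d * ((1 / 2 : ℝ) ^ d) ^ 2 := by gcongr; exact h5.trans h6
        _ = (1 / 2 : ℝ) ^ d := by rw [sq, ← mul_assoc, h9, one_mul]
        _ ≤ 1 := h8
  rw [h1]
  calc ∑ e, cutoffWeight d (β e) * ∑ l, deviation x (b e) (C l)
      ≤ ∑ e, cutoffWeight d (β e) * (n * σ ^ 2) :=
        Finset.sum_le_sum fun e _ => mul_le_mul_of_nonneg_left (sum_deviation_le hC hσ e)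
          (cutoffWeight_nonneg _)
    _ = (∑ e, cutoffWeight d (β e)) * (n * σ ^ 2) := (Finset.sum_mul ..).symm
    _ ≤ (2 * k + 1) * (n * σ ^ 2) := by gcongr

/-- The means of the clusters stay apart. -/
theorem norm_weightedMap_sub_mean (hn : 0 < n) (hs : 0 < s) {w : ℝ} (hw : 0 < w)
    {S S' : Finset (Fin n)} (hS : w * n ≤ S.card) (hS' : w * n ≤ S'.card)
    (hβ : ∀ v, (4 * n * s)⁻¹ * ∑ i, ⟪v, x i⟫ ^ 2 = ∑ e, β e * ⟪b e, v⟫ ^ 2) :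
    ‖mean x S - mean x S'‖ ^ 2 - 16 * s / w ≤
      2 * ‖weightedMap b (fun e => cutoffWeight d (β e)) (mean x S - mean x S')‖ ^ 2 := by
  have hn0 : (0 : ℝ) < n := by exact_mod_cast hn
  -- With `g` the indicator of eigenvalues below `1`, the squared norm `t` of this part of the mean
  -- satisfies `|S| t² ≤ 4 n s t`. A mean of many points thus loses little.
  have hsmall : ∀ S : Finset (Fin n), w * n ≤ S.card →
      ∑ e, (if β e < 1 then 1 else 0) * ⟪b e, mean x S⟫ ^ 2 ≤ 4 * s / w := by
    intro S hS
    have h1 := card_mul_weighted_sq_le hn hs hβ S fun e => if β e < 1 then 1 else 0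
    set t := ∑ e, (if β e < 1 then 1 else 0) * ⟪b e, mean x S⟫ ^ 2 with ht
    have ht0 : 0 ≤ t := Finset.sum_nonneg fun e _ => by split_ifs <;> positivity
    have h2 : ∑ e, β e * ((if β e < 1 then 1 else 0) * ⟪b e, mean x S⟫) ^ 2 ≤ t := by
      refine Finset.sum_le_sum fun e _ => ?_
      split_ifs with h
      · rw [one_mul, one_mul]
        exact mul_le_of_le_one_left (sq_nonneg _) h.le
      · simp
    have h3 : w * n * t ^ 2 ≤ 4 * n * s * t := by
      calc w * n * t ^ 2 ≤ S.card * t ^ 2 := by gcongr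
        _ ≤ _ := h1
        _ ≤ _ := by gcongr
    rw [le_div_iff₀ hw]
    rcases ht0.eq_or_lt with h0 | h0
    · rw [← h0]; simpa using hs.le
    · refine le_of_mul_le_mul_left (a := n * t) ?_ (by positivity)
      calc n * t * (t * w) = w * n * t ^ 2 := by ring
        _ ≤ _ := h3
        _ = n * t * (4 * s) := by ring
  set δ := mean x S - mean x S' with hδ
  have h1 : ∑ e, (if β e < 1 then 1 else 0) * ⟪b e, δ⟫ ^ 2 ≤ 16 * s / w := by
    calc ∑ e, (if β e < 1 then 1 else 0) * ⟪b e, δ⟫ ^ 2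
        ≤ ∑ e, (2 * ((if β e < 1 then 1 else 0) * ⟪b e, mean x S⟫ ^ 2) +
          2 * ((if β e < 1 then 1 else 0) * ⟪b e, mean x S'⟫ ^ 2)) := by
          refine Finset.sum_le_sum fun e _ => ?_
          rw [hδ, inner_sub_right]
          split_ifs
          · nlinarith [sq_nonneg (⟪b e, mean x S⟫ + ⟪b e, mean x S'⟫)]
          · simp
      _ = 2 * ∑ e, (if β e < 1 then 1 else 0) * ⟪b e, mean x S⟫ ^ 2 +
          2 * ∑ e, (if β e < 1 then 1 else 0) * ⟪b e, mean x S'⟫ ^ 2 := by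
          rw [Finset.sum_add_distrib, Finset.mul_sum, Finset.mul_sum]
      _ ≤ 2 * (4 * s / w) + 2 * (4 * s / w) := by
          linarith [hsmall S hS, hsmall S' hS']
      _ = 16 * s / w := by ring
  have h2 : ‖δ‖ ^ 2 = ∑ e, ⟪b e, δ⟫ ^ 2 := (b.sum_sq_inner_right δ).symm
  rw [norm_weightedMap_sq b (fun e => cutoffWeight_nonneg (β e)), h2, Finset.mul_sum]
  -- On eigenvalues at least `1` the weight is at least `1 / 2`, which gives the factor `2`.
  have h3 : ∑ e, ⟪b e, δ⟫ ^ 2 ≤ ∑ e, (if β e < 1 then 1 else 0) * ⟪b e, δ⟫ ^ 2 +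
      ∑ e, 2 * (cutoffWeight d (β e) * ⟪b e, δ⟫ ^ 2) := by
    rw [← Finset.sum_add_distrib]
    refine Finset.sum_le_sum fun e _ => ?_
    have h0 := cutoffWeight_nonneg (d := d) (β e)
    split_ifs with h
    · have : 0 ≤ 2 * (cutoffWeight d (β e) * ⟪b e, δ⟫ ^ 2) := by positivity
      linarith
    · have h4 := half_le_cutoffWeight (d := d) (not_lt.1 h)
      nlinarith [sq_nonneg ⟪b e, δ⟫]
  linarith

end Spectral

end Clustering

/-! ### A good guess finds at least as many seeds as clusters. -/

namespace Clustering

variable {n d k : ℕ}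

theorem card_filter_range (n : ℕ) (P : ℕ → Prop) [DecidablePred P] :
    ((Finset.range n).filter P).card = (Finset.univ.filter fun i : Fin n => P i).card := by
  rw [Finset.card_filter, Finset.card_filter, Finset.sum_range]

theorem heavyRadius_nonneg {m : ℕ} {s : ℝ} (hs : 0 ≤ s) : 0 ≤ heavyRadius n m s := by
  unfold heavyRadius; positivity

/-- This fixes the factor `40000` and the eighth power in `sepRadius`: it is the square of the
separation in `IsSeparated`. -/
theorem sepRadius_eq {m : ℕ} {s : ℝ} (hs : 0 ≤ s) :
    sepRadius n m s = (200 * ((n : ℝ) / m) ^ 4 * Real.sqrt (heavyRadius n m s)) ^ 2 := by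
  rw [mul_pow, Real.sq_sqrt (heavyRadius_nonneg hs), sepRadius]
  ring

section Seeds

variable {x : Fin n → EuclideanSpace ℝ (Fin d)} {m : ℕ} {s : ℝ} {q : ℕ} {seed : ℕ → ℕ}
  {Φ : EuclideanSpace ℝ (Fin d) →ₗ[ℝ] EuclideanSpace ℝ (Fin d)}

theorem le_heavyRadius_iff (hs : 0 ≤ s)
    (hΦ : ∀ i j : Fin n, cutoffSqDist x s i j = ‖Φ (x i - x j)‖ ^ 2) (i j : Fin n) :
    cutoffSqDist x s i j ≤ heavyRadius n m s ↔
      ‖Φ (x j - x i)‖ ≤ Real.sqrt (heavyRadius n m s) := by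
  rw [hΦ, Real.le_sqrt (norm_nonneg _) (heavyRadius_nonneg hs), ← neg_sub (x j), map_neg, norm_neg]

theorem SeedsFor.isSeparated (h : SeedsFor x m s q seed) (hs : 0 ≤ s)
    (hΦ : ∀ i j : Fin n, cutoffSqDist x s i j = ‖Φ (x i - x j)‖ ^ 2) :
    IsSeparated x Φ m ((n : ℝ) / m) (Real.sqrt (heavyRadius n m s))
      fun j : Fin q => (⟨seed j, h.lt j j.2⟩ : Fin n) where
  heavy j := by
    refine (h.heavy j j.2).trans_eq ?_
    rw [card_filter_range]
    congr 1
    ext i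
    simp only [Finset.mem_filter, Finset.mem_univ, true_and]
    exact le_heavyRadius_iff hs hΦ ⟨seed j, h.lt j j.2⟩ i
  sep := by
    have key : ∀ j j' : Fin q, j' < j → 200 * ((n : ℝ) / m) ^ 4 * Real.sqrt (heavyRadius n m s) <
        ‖Φ (x ⟨seed j, h.lt j j.2⟩ - x ⟨seed j', h.lt j' j'.2⟩)‖ := by
      intro j j' hlt
      have h1 := h.sep j j.2 j' hlt
      have h2 := hΦ ⟨seed j, h.lt j j.2⟩ ⟨seed j', h.lt j' j'.2⟩
      simp only at h2
      rw [sepRadius_eq hs, h2] at h1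
      exact lt_of_pow_lt_pow_left₀ 2 (norm_nonneg _) h1
    intro j j' hne
    rcases lt_or_gt_of_ne hne with hlt | hlt
    · rw [← neg_sub, map_neg, norm_neg]; exact key j' j hlt
    · exact key j j' hlt

end Seeds

/-- The parameters of a clustering that fulfils the weight condition. -/
theorem MinWeight.params {w₀ : ℝ} {C : Fin k → Finset (Fin n)} (h : MinWeight w₀ C)
    (hC : IsPartition C) : 100 ≤ n ∧ w₀ ≤ 1 ∧ k * w₀ ≤ 1 ∧ 100 ≤ w₀ * n := by
  obtain ⟨hw, hcard, hn⟩ := h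
  have hn0 : (0 : ℝ) < n := lt_of_lt_of_le (by positivity) hn
  have hkw : k * w₀ ≤ 1 := by
    have h1 : ∑ _l : Fin k, w₀ * n ≤ ∑ l, ((C l).card : ℝ) :=
      Finset.sum_le_sum fun l _ => hcard l
    rw [sum_card hC, Finset.sum_const, Finset.card_univ, Fintype.card_fin, nsmul_eq_mul] at h1
    refine le_of_mul_le_mul_right (a := (n : ℝ)) ?_ hn0
    linarith
  have hk : 1 ≤ k := by
    obtain ⟨l, -⟩ := hC ⟨0, by exact_mod_cast hn0⟩
    exact l.pos
  have hw1 : w₀ ≤ 1 := by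
    have : (1 : ℝ) ≤ k := by exact_mod_cast hk
    nlinarith
  rw [div_le_iff₀ (by positivity)] at hn
  have h4 : w₀ ^ 4 ≤ 1 := pow_le_one₀ hw.le hw1
  have hwn : 100 ≤ w₀ * n := by
    have : (n : ℝ) * w₀ ^ 5 = w₀ ^ 4 * (w₀ * n) := by ring
    have h5 : 0 < w₀ * n := by positivity
    nlinarith
  refine ⟨?_, hw1, hkw, hwn⟩
  have : (100 : ℝ) ≤ n := by nlinarith
  exact_mod_cast this

/-- Up to `n` the integer part of `y` serves with second factor `1`. Beyond that the first factor is
`n` and the second is the integer part of `y / n`, capped at `d`; if the cap applies, `y ≤ 2 n d`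
keeps the factor `2`. -/
theorem exists_divisor {y : ℝ} (h1 : 1 ≤ y) (h2 : y ≤ 2 * n * d) :
    ∃ i < n, ∃ j < d, (((i + 1 : ℕ) : ℝ) * (j + 1 : ℕ)) ≤ y ∧
      y ≤ 2 * (((i + 1 : ℕ) : ℝ) * (j + 1 : ℕ)) := by
  have hn : 0 < n := by
    rcases Nat.eq_zero_or_pos n with rfl | h
    · norm_num at h2; linarith
    · exact h
  have hd : 0 < d := by
    rcases Nat.eq_zero_or_pos d with rfl | h
    · norm_num at h2; linarith
    · exact h
  have hn0 : (0 : ℝ) < n := by exact_mod_cast hn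
  have floor_spec : ∀ z : ℝ, 1 ≤ z → 1 ≤ ⌊z⌋₊ ∧ (⌊z⌋₊ : ℝ) ≤ z ∧ z ≤ 2 * ⌊z⌋₊ := by
    intro z hz
    have h3 : 1 ≤ ⌊z⌋₊ := Nat.le_floor (by simpa using hz)
    have h4 : (1 : ℝ) ≤ ⌊z⌋₊ := by exact_mod_cast h3
    refine ⟨h3, Nat.floor_le (by linarith), ?_⟩
    linarith [Nat.lt_floor_add_one z]
  obtain ⟨h3, h4, h5⟩ := floor_spec y h1
  by_cases hy : ⌊y⌋₊ ≤ n
  · refine ⟨⌊y⌋₊ - 1, by omega, 0, hd, ?_⟩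
    rw [Nat.sub_add_cancel h3]
    simpa using ⟨h4, h5⟩
  · have hyn : 1 ≤ y / n := by
      rw [le_div_iff₀ hn0, one_mul]
      have : (n : ℝ) ≤ ⌊y⌋₊ := by exact_mod_cast (not_le.1 hy).le
      linarith
    obtain ⟨h6, h7, h8⟩ := floor_spec _ hyn
    rw [le_div_iff₀ hn0] at h7
    rw [div_le_iff₀ hn0] at h8
    refine ⟨n - 1, by omega, ?_⟩
    rw [Nat.sub_add_cancel hn]
    by_cases hd' : ⌊y / n⌋₊ ≤ d
    · refine ⟨⌊y / n⌋₊ - 1, by omega, ?_⟩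
      rw [Nat.sub_add_cancel h6]
      constructor <;> linarith
    · refine ⟨d - 1, by omega, ?_⟩
      rw [Nat.sub_add_cancel hd]
      have : (d : ℝ) ≤ ⌊y / n⌋₊ := by exact_mod_cast (not_le.1 hd').le
      constructor <;> nlinarith

/-- One of the guesses approximates the squared standard deviation of a set of points. -/
theorem exists_scaleGuess {x : Fin n → EuclideanSpace ℝ (Fin d)} (hx : Function.Injective x)
    {S : Finset (Fin n)} (hS : 2 ≤ S.card) :
    0 < sigma x S ∧ ∃ a < n, ∃ b < n, ∃ i < n, ∃ j < d,
      sigma x S ^ 2 ≤ scaleGuess x a b i j ∧ scaleGuess x a b i j ≤ 2 * sigma x S ^ 2 := by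
  have hS0 : (0 : ℝ) < S.card := by exact_mod_cast (by omega : 0 < S.card)
  obtain ⟨i₀, hi₀, j₀, hj₀, hne₀⟩ := Finset.one_lt_card.1 hS
  obtain ⟨⟨a, b⟩, hab, hmax⟩ := (S ×ˢ S).exists_max_image (fun p => ‖x p.1 - x p.2‖ ^ 2)
    ⟨(i₀, j₀), Finset.mk_mem_product hi₀ hj₀⟩
  obtain ⟨ha, hb⟩ := Finset.mem_product.1 hab
  simp only at ha hb hmax
  set t := ‖x a - x b‖ ^ 2 with ht
  have ht0 : 0 < t := by
    refine lt_of_lt_of_le ?_ (hmax (i₀, j₀) (Finset.mk_mem_product hi₀ hj₀))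
    have : 0 < ‖x i₀ - x j₀‖ := norm_pos_iff.2 (sub_ne_zero.2 (hx.ne hne₀))
    positivity
  have hle : sigma x S ^ 2 ≤ t := by
    refine (sigma_sq_le x S (x b)).trans ?_
    rw [div_le_iff₀ hS0, mul_comm, ← nsmul_eq_mul]
    exact Finset.sum_le_card_nsmul _ _ _ fun i hi => hmax (i, b) (Finset.mk_mem_product hi hb)
  have hne : a ≠ b := by
    rintro rfl
    simp [ht] at ht0
  -- For a diametral pair, `t` is at most twice the total squared deviation of `S`, which is the sum
  -- of the deviations along `d` coordinate axes.
  have hge : t ≤ 2 * n * d * sigma x S ^ 2 := by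
    let e := EuclideanSpace.basisFun (Fin d) ℝ
    have h1 : ∑ p, deviation x (e p) S ≤ ∑ _p : Fin d, (S.card : ℝ) * sigma x S ^ 2 :=
      Finset.sum_le_sum fun p _ => deviation_le_sigma x S (e p) (e.orthonormal.1 p)
    have h2 : ∑ p, deviation x (e p) S = ∑ i ∈ S, ‖x i - mean x S‖ ^ 2 := by
      simp only [deviation]
      rw [Finset.sum_comm]
      exact Finset.sum_congr rfl fun i _ => e.sum_sq_inner_right _
    rw [h2, Finset.sum_const, Finset.card_univ, Fintype.card_fin, nsmul_eq_mul] at h1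
    have h3 : ∑ i ∈ ({a, b} : Finset (Fin n)), ‖x i - mean x S‖ ^ 2 ≤
        ∑ i ∈ S, ‖x i - mean x S‖ ^ 2 :=
      Finset.sum_le_sum_of_subset_of_nonneg (by
        intro i hi
        rcases Finset.mem_insert.1 hi with rfl | hi
        · exact ha
        · rw [Finset.mem_singleton.1 hi]; exact hb) fun _ _ _ => sq_nonneg _
    rw [Finset.sum_pair hne] at h3
    have h4 : t ≤ 2 * (‖x a - mean x S‖ ^ 2 + ‖x b - mean x S‖ ^ 2) := by
      have h5 : x a - x b = (x a - mean x S) - (x b - mean x S) := by abel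
      have h6 := norm_sub_le (x a - mean x S) (x b - mean x S)
      rw [← h5] at h6
      have h7 : t ≤ (‖x a - mean x S‖ + ‖x b - mean x S‖) ^ 2 :=
        pow_le_pow_left₀ (norm_nonneg _) h6 2
      nlinarith [sq_nonneg (‖x a - mean x S‖ - ‖x b - mean x S‖)]
    have h5 : (S.card : ℝ) ≤ n := by
      exact_mod_cast (Finset.card_le_univ S).trans_eq (by simp)
    have h6 : (d : ℝ) * (S.card * sigma x S ^ 2) ≤ d * (n * sigma x S ^ 2) := by gcongr
    linarith
  have hσ : 0 < sigma x S := by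
    refine (sigma_nonneg x S).lt_of_ne fun h0 => ?_
    rw [← h0] at hge
    norm_num at hge
    linarith
  refine ⟨hσ, ?_⟩
  obtain ⟨i, hi, j, hj, h1, h2⟩ := exists_divisor (n := n) (d := d) (y := t / sigma x S ^ 2)
    (by rw [le_div_iff₀ (by positivity), one_mul]; exact hle)
    (by rw [div_le_iff₀ (by positivity)]; exact hge)
  rw [le_div_iff₀ (by positivity)] at h1
  rw [div_le_iff₀ (by positivity)] at h2
  have hst : scaleGuess x a b i j = t / ((i + 1 : ℕ) * (j + 1 : ℕ)) := by
    rw [scaleGuess, ht, EuclideanSpace.norm_sq_eq]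
    simp [coords_fin]
  refine ⟨a, a.2, b, b.2, i, hi, j, hj, ?_, ?_⟩
  · rw [hst, le_div_iff₀ (by positivity)]; linarith
  · rw [hst, div_le_iff₀ (by positivity)]; linarith

/-- For good guesses, there are at least as many seeds as clusters. -/
theorem SeedsFor.le_card {x : Fin n → EuclideanSpace ℝ (Fin d)} {C : Fin k → Finset (Fin n)}
    {w₀ : ℝ} (hC : IsPartition C) (hW : MinWeight w₀ C) (hsep : WellSeparated (10 ^ 6) w₀ x C)
    {m : ℕ} {s : ℝ} {q : ℕ} {seed : ℕ → ℕ} (h : SeedsFor x m s q seed)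
    (hm : (m : ℝ) ≤ w₀ * n / 2) (hm' : 9 / 20 * (w₀ * n) ≤ m) {σ : ℝ}
    (hσ : σ = ⨆ r, sigma x (C r)) (hσ0 : 0 < σ) (hs : σ ^ 2 ≤ s) (hs' : s ≤ 2 * σ ^ 2) :
    k ≤ q := by
  obtain ⟨hn100, hw1, hkw, hwn⟩ := hW.params hC
  obtain ⟨hw, hcard, -⟩ := hW
  have hn : 0 < n := by omega
  have hn0 : (0 : ℝ) < n := by exact_mod_cast hn
  have hm0 : (0 : ℝ) < m := by linarith
  have hs0 : 0 < s := lt_of_lt_of_le (by positivity) hs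
  have hσl : ∀ l, sigma x (C l) ≤ σ := fun l => by
    rw [hσ]; exact le_ciSup (Set.finite_range fun r => sigma x (C r)).bddAbove l
  obtain ⟨b, β, hβ, hcut⟩ := exists_eigenbasis x s
  set Φ := weightedMap b fun e => cutoffWeight d (β e) with hΦdef
  have hΦ : ∀ i j : Fin n, cutoffSqDist x s i j = ‖Φ (x i - x j)‖ ^ 2 := cutoffSqDist_eq hcut
  set u : ℝ := n / m with hu
  have hu2 : 2 / w₀ ≤ u := by
    rw [hu, div_le_div_iff₀ hw hm0]; linarith
  have hu3 : u ≤ 3 / w₀ := by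
    rw [hu, div_le_div_iff₀ hm0 hw]; nlinarith
  have hu1 : 1 ≤ u := by
    refine le_trans ?_ hu2
    rw [le_div_iff₀ hw]; linarith
  set H := heavyRadius n m s with hH
  have hHval : H = 6 * s * u ^ 2 := rfl
  have hH0 : 0 < H := by rw [hHval]; positivity
  set r := Real.sqrt H with hr
  have hr0 : 0 < r := Real.sqrt_pos.2 hH0
  have hrsq : r ^ 2 = H := Real.sq_sqrt hH0.le
  let good : Fin k → Finset (Fin n) := fun l =>
    (C l).filter fun i => ‖Φ (x i - mean x (C l))‖ ≤ r / 2
  -- Markov's inequality. The factor `6` in `heavyRadius` is chosen here: `w₀ u ≥ 2` and `s ≥ σ²`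
  -- give `w₀² H ≥ 24 σ²`, while `w₀ (2k + 1) ≤ 3`.
  have hbad : ∀ l, (((C l).filter fun i => ¬ ‖Φ (x i - mean x (C l))‖ ≤ r / 2).card : ℝ) ≤
      w₀ * n / 2 := by
    intro l
    set B := (C l).filter fun i => ¬ ‖Φ (x i - mean x (C l))‖ ≤ r / 2 with hB
    have h1 : (B.card : ℝ) * (H / 4) ≤ ∑ i ∈ B, ‖Φ (x i - mean x (C l))‖ ^ 2 := by
      rw [← nsmul_eq_mul]
      refine Finset.card_nsmul_le_sum _ _ _ fun i hi => ?_
      have h2 := not_le.1 (Finset.mem_filter.1 hi).2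
      have h3 := pow_le_pow_left₀ (by positivity) h2.le 2
      rw [div_pow, hrsq] at h3
      linarith
    have h2 : ∑ i ∈ B, ‖Φ (x i - mean x (C l))‖ ^ 2 ≤ (2 * k + 1) * (n * σ ^ 2) := by
      calc ∑ i ∈ B, ‖Φ (x i - mean x (C l))‖ ^ 2
          ≤ ∑ i ∈ C l, ‖Φ (x i - mean x (C l))‖ ^ 2 :=
            Finset.sum_le_sum_of_subset_of_nonneg (Finset.filter_subset _ _)
              fun _ _ _ => sq_nonneg _
        _ ≤ ∑ l, ∑ i ∈ C l, ‖Φ (x i - mean x (C l))‖ ^ 2 :=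
            Finset.single_le_sum (f := fun l => ∑ i ∈ C l, ‖Φ (x i - mean x (C l))‖ ^ 2)
              (fun _ _ => by positivity) (Finset.mem_univ l)
        _ ≤ _ := sum_norm_weightedMap_le hn hs0 hC hσl hs hβ
    have hk1 : (1 : ℝ) ≤ k := by exact_mod_cast l.pos
    have h3 : w₀ * (2 * k + 1) ≤ 3 := by nlinarith
    have h4 : 24 * σ ^ 2 ≤ w₀ ^ 2 * H := by
      have h5 : 4 ≤ w₀ ^ 2 * u ^ 2 := by
        have h6 : 2 ≤ w₀ * u := by rwa [div_le_iff₀ hw, mul_comm] at hu2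
        nlinarith
      rw [hHval]
      nlinarith
    refine le_of_mul_le_mul_right (a := H / 4 * w₀) ?_ (by positivity)
    calc (B.card : ℝ) * (H / 4 * w₀) = w₀ * (B.card * (H / 4)) := by ring
      _ ≤ w₀ * ((2 * k + 1) * (n * σ ^ 2)) :=
        mul_le_mul_of_nonneg_left (h1.trans h2) hw.le
      _ = (w₀ * (2 * k + 1)) * (n * σ ^ 2) := by ring
      _ ≤ 3 * (n * σ ^ 2) := by gcongr
      _ = n / 8 * (24 * σ ^ 2) := by ring
      _ ≤ n / 8 * (w₀ ^ 2 * H) := by gcongr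
      _ = w₀ * n / 2 * (H / 4 * w₀) := by ring
  have hgood : ∀ l, (m : ℝ) ≤ (good l).card := by
    intro l
    have h1 := Finset.card_filter_add_card_filter_not (s := C l)
      (fun i => ‖Φ (x i - mean x (C l))‖ ≤ r / 2)
    have h2 : ((good l).card : ℝ) +
        ((C l).filter fun i => ¬ ‖Φ (x i - mean x (C l))‖ ≤ r / 2).card = (C l).card := by
      exact_mod_cast h1
    linarith [hbad l, hcard l]
  -- Two good points of a cluster are within `r / 2 + r / 2` of each other, so each good point is
  -- heavy and is covered by a seed.
  have hcover : ∀ l, ∃ j : Fin q, ‖Φ (mean x (C l) - x ⟨seed j, h.lt j j.2⟩)‖ ≤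
      (r / 2) + 200 * u ^ 4 * r := by
    intro l
    have hpos : 0 < (good l).card := by
      have := hgood l
      exact_mod_cast hm0.trans_le this
    obtain ⟨g, hg⟩ := Finset.card_pos.1 hpos
    have hgr := (Finset.mem_filter.1 hg).2
    obtain ⟨j, hj, hjs⟩ := h.cover g g.2 (by
      rw [card_filter_range]
      have h1 : m ≤ (good l).card := by exact_mod_cast hgood l
      refine h1.trans (Finset.card_le_card fun i hi => ?_)
      simp only [Finset.mem_filter, Finset.mem_univ, true_and]
      rw [le_heavyRadius_iff hs0.le hΦ]
      have hir := (Finset.mem_filter.1 hi).2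
      have h2 : x i - x g = (x i - mean x (C l)) - (x g - mean x (C l)) := by abel
      rw [h2, map_sub]
      refine (norm_sub_le _ _).trans ?_
      rw [← hH, ← hr]
      linarith)
    refine ⟨⟨j, hj⟩, ?_⟩
    have h1 : ‖Φ (x g - x ⟨seed j, h.lt j hj⟩)‖ ≤ 200 * u ^ 4 * r := by
      have h2 := hΦ g ⟨seed j, h.lt j hj⟩
      simp only at h2
      rw [h2] at hjs
      exact le_of_sq_le_sq (hjs.trans_eq (sepRadius_eq hs0.le)) (by positivity)
    have h2 : mean x (C l) - x ⟨seed j, h.lt j hj⟩ =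
        (x g - x ⟨seed j, h.lt j hj⟩) - (x g - mean x (C l)) := by abel
    rw [h2, map_sub]
    refine (norm_sub_le _ _).trans ?_
    linarith
  choose f hf using hcover
  have hinj : Function.Injective f := by
    intro l l' hll
    by_contra hne
    have h1 := hf l
    have h2 := hf l'
    rw [← hll] at h2
    have h3 : mean x (C l) - mean x (C l') =
        (mean x (C l) - x ⟨seed (f l), h.lt _ (f l).2⟩) -
          (mean x (C l') - x ⟨seed (f l), h.lt _ (f l).2⟩) := by abel
    have h4 : ‖Φ (mean x (C l) - mean x (C l'))‖ ≤ 401 * u ^ 4 * r := by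
      rw [h3, map_sub]
      refine (norm_sub_le _ _).trans ?_
      have h5 : r ≤ u ^ 4 * r := le_mul_of_one_le_left hr0.le (one_le_pow₀ hu1)
      linarith
    have h5 := norm_weightedMap_sub_mean hn hs0 hw (hcard l) (hcard l') hβ
    rw [← hΦdef] at h5
    have h6 : ‖Φ (mean x (C l) - mean x (C l'))‖ ^ 2 ≤ (401 * u ^ 4 * r) ^ 2 :=
      pow_le_pow_left₀ (norm_nonneg _) h4 2
    have h7 := hsep l l' hne
    rw [← hσ] at h7
    have h8 : (10 ^ 6 / w₀ ^ 11 * σ) ^ 2 ≤ ‖mean x (C l) - mean x (C l')‖ ^ 2 :=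
      pow_le_pow_left₀ (by positivity) h7 2
    set y := 1 / w₀ with hy
    have hy1 : 1 ≤ y := by rw [hy, le_div_iff₀ hw]; linarith
    have hu3' : u ≤ 3 * y := by rw [hy]; simpa [div_eq_mul_inv] using hu3
    have h9 : (401 * u ^ 4 * r) ^ 2 ≤ 2 * 10 ^ 11 * (y ^ 10 * σ ^ 2) := by
      calc (401 * u ^ 4 * r) ^ 2 = 160801 * u ^ 8 * r ^ 2 := by ring
        _ = 160801 * 6 * (u ^ 10 * s) := by rw [hrsq, hHval]; ring
        _ ≤ 160801 * 6 * ((3 * y) ^ 10 * (2 * σ ^ 2)) := by gcongr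
        _ = 113941658988 * (y ^ 10 * σ ^ 2) := by ring
        _ ≤ 2 * 10 ^ 11 * (y ^ 10 * σ ^ 2) := by gcongr; norm_num
    -- The seeds only require the tenth power of `1 / w₀` in the squared separation; the exponent
    -- `11` in the hypothesis leaves room.
    have h10 : y ^ 10 * σ ^ 2 ≤ y ^ 22 * σ ^ 2 := by gcongr; norm_num
    have h11 : y * σ ^ 2 ≤ y ^ 22 * σ ^ 2 := by
      gcongr
      exact le_self_pow₀ hy1 (by norm_num)
    have h12 : (10 ^ 6 / w₀ ^ 11 * σ) ^ 2 = 10 ^ 12 * (y ^ 22 * σ ^ 2) := by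
      rw [hy]; field_simp
    have h13 : 16 * s / w₀ ≤ 32 * (y * σ ^ 2) := by
      have : 16 * s / w₀ = 16 * s * y := by rw [hy]; ring
      rw [this]
      nlinarith
    have h14 : 0 < y ^ 22 * σ ^ 2 := by positivity
    linarith
  simpa using Fintype.card_le_of_injective f hinj

/-- The size guess for the weight `w₀`. -/
theorem exists_size {w₀ : ℝ} {C : Fin k → Finset (Fin n)} (hC : IsPartition C)
    (hW : MinWeight w₀ C) : ∃ m : ℕ, 1 ≤ m ∧ m ≤ n ∧ n ^ 4 ≤ m ^ 5 ∧
      (m : ℝ) ≤ w₀ * n / 2 ∧ 9 / 20 * (w₀ * n) ≤ m := by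
  obtain ⟨hn100, hw1, hkw, hwn⟩ := hW.params hC
  obtain ⟨hw, -, hn⟩ := hW
  have hn0 : (0 : ℝ) < n := by exact_mod_cast (by omega : 0 < n)
  have h1 : ((⌊w₀ * n / 2⌋₊ : ℕ) : ℝ) ≤ w₀ * n / 2 := Nat.floor_le (by positivity)
  have h2 : 9 / 20 * (w₀ * n) ≤ ⌊w₀ * n / 2⌋₊ := by
    linarith [Nat.lt_floor_add_one (w₀ * n / 2)]
  refine ⟨⌊w₀ * n / 2⌋₊, Nat.le_floor (by norm_num; linarith), ?_, ?_, h1, h2⟩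
  · have : ((⌊w₀ * n / 2⌋₊ : ℕ) : ℝ) ≤ n := by nlinarith
    exact_mod_cast this
  · have h3 : (9 / 20 * (w₀ * n)) ^ 5 ≤ ((⌊w₀ * n / 2⌋₊ : ℕ) : ℝ) ^ 5 :=
      pow_le_pow_left₀ (by positivity) h2 5
    rw [div_le_iff₀ (by positivity)] at hn
    -- The hypothesis `n ≥ 100 / w₀ ^ 5` enters here; `100 · (9 / 20)⁵` exceeds `1`, so the size
    -- passes the test `n ^ 4 ≤ m ^ 5`.
    have h4 : (n : ℝ) ^ 4 ≤ (9 / 20 * (w₀ * n)) ^ 5 := by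
      have : (9 / 20 * (w₀ * n)) ^ 5 = (9 / 20 : ℝ) ^ 5 * (n ^ 4 * (n * w₀ ^ 5)) := by ring
      rw [this]
      have h5 : (n : ℝ) ^ 4 * 100 ≤ n ^ 4 * (n * w₀ ^ 5) := by gcongr
      have h6 : 0 < (n : ℝ) ^ 4 := by positivity
      nlinarith
    exact_mod_cast h4.trans h3

end Clustering

/-! ### The main theorem. -/

open Clustering

theorem theorem2 :
    ∃ K : ℝ, 0 < K ∧ ∃ (prog : RealRAM.Prog) (p : Polynomial ℕ),
      ∀ (n d : ℕ) (x : Fin n → EuclideanSpace ℝ (Fin d)),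
        ∃ (s : RealRAM.State) (t : ℕ),
          prog.Runs (RealRAM.State.input x) s t ∧ t ≤ p.eval (n + d) ∧
          ∀ (k : ℕ) (w₀ : ℝ) (C : Fin k → Finset (Fin n)),
            Function.Injective x →
            Clustering.IsPartition C →
            Clustering.MinWeight w₀ C →
            Clustering.WellSeparated K w₀ x C →
            Clustering.NTSC x C →
            s.nat 0 0 = k ∧ Clustering.ApproxClustering w₀ C (fun i => s.nat 1 i) := by
  refine ⟨10 ^ 6, by norm_num, RealRAM.clusterProg, RealRAM.Code.clusterCode.cost + 2, ?_⟩
  intro n d x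
  obtain ⟨st, t, hrun, ht, m, hbest, hall⟩ := RealRAM.clusterProg_spec x
  refine ⟨st, t, hrun, ht, fun k w₀ C hx hC hW hsep hN => ?_⟩
  obtain ⟨hn100, hw1, hkw, hwn⟩ := hW.params hC
  have hn : 0 < n := by omega
  have hn0 : (0 : ℝ) < n := by exact_mod_cast hn
  have hk : 0 < k := by
    obtain ⟨l, -⟩ := hC ⟨0, hn⟩
    exact l.pos
  have : Nonempty (Fin k) := ⟨⟨0, hk⟩⟩
  -- The scale to be guessed is that of a cluster with the largest deviation.
  obtain ⟨r, hr⟩ := exists_eq_ciSup_of_finite (f := fun r => sigma x (C r))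
  have hcr : 2 ≤ (C r).card := by
    have h1 := hW.2.1 r
    have : (2 : ℝ) ≤ (C r).card := by linarith
    exact_mod_cast this
  obtain ⟨hσ0, a, ha, b, hb, i, hi, j, hj, hs, hs'⟩ := exists_scaleGuess hx hcr
  obtain ⟨m₀, hm1, hmn, hm5, hmw, hmw'⟩ := exists_size hC hW
  obtain ⟨q, seed, hseed, hq, hqm⟩ := hall m₀ (scaleGuess x a b i j)
    ⟨⟨hm1, hmn, hm5⟩, a, ha, b, hb, i, hi, j, hj, rfl⟩
  have hkq : k ≤ q := hseed.le_card hC hW hsep hmw hmw' hr hσ0 hs hs'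
  have hk' : k ≤ st.nat 0 0 := hkq.trans hq
  rcases hbest with h0 | ⟨s, seed', hs0, hm, hseed', hlab⟩
  · omega
  -- The winning scale `s` may be wrong, even `0`. Only the diagonal form of the cutoff with
  -- nonnegative weights is used, not the relation of the eigenvalues to the points.
  obtain ⟨β, β', -, hcut⟩ := exists_eigenbasis x s
  have hΦ := cutoffSqDist_eq hcut
  have hsepd := hseed'.isSeparated hs0 hΦ
  have hm0 : 0 < m := by
    rcases Nat.eq_zero_or_pos m with rfl | h
    · have : 0 < n ^ 4 := by positivity
      omega
    · exact h
  have hm0' : (0 : ℝ) < m := by exact_mod_cast hm0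
  have hq0 : 0 < st.nat 0 0 := by omega
  have hmn' : m ≤ n := by
    refine (hseed'.heavy 0 hq0).trans ((Finset.card_filter_le _ _).trans_eq ?_)
    simp
  have hu1 : 1 ≤ (n : ℝ) / m := by
    rw [le_div_iff₀ hm0', one_mul]; exact_mod_cast hmn'
  have hqk : st.nat 0 0 ≤ k :=
    hsepd.card_le hC hN (Real.sqrt_nonneg _) hn hm0 hm rfl hu1
  have hkeq : st.nat 0 0 = k := le_antisymm hqk hk'
  -- The good guess `m₀` also attains the maximum `k`, so the tie rule bounds the winning size by
  -- it.
  have hmm : m ≤ m₀ := hqm (by omega)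
  have hmw₀ : (m : ℝ) ≤ w₀ * n := by
    have : (m : ℝ) ≤ m₀ := by exact_mod_cast hmm
    linarith
  refine ⟨hkeq, hsepd.approxClustering hC hN (Real.sqrt_nonneg _) hn hm0 hm rfl hu1 hkeq.symm
    hmw₀ (fun i => (hlab i i.2).1) fun i j => ?_⟩
  have h1 := (hlab i i.2).2 j j.2
  have e1 := hΦ i ⟨seed' j, hseed'.lt j j.2⟩
  have e2 := hΦ i ⟨seed' (st.nat 1 i), hseed'.lt _ (hlab i i.2).1⟩
  simp only at e1 e2
  rw [e1, e2] at h1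
  exact le_of_sq_le_sq h1 (norm_nonneg _)
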